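/- Let $m\ge 2$ and let $\Sigma=\{\alpha_1,\dots,\alpha_m,\beta_1,\dots,\beta_m\}$. Let $M$ be the monoid with zero generated by $\Sigma$ with the relations $\alpha_j\beta_j=1$ and $\alpha_i\beta_j=0$ for $i\ne j$. The two-sided $m$-Dyck shift $X\subset\Sigma^{\mathbb Z}$ is the set of those $x$ all of whose finite subwords are nonzero in $M$; $T$ denotes the shift on $X$. Two points $x,x'\in X$ are double-tail (homoclinic) equivalent if there is $n\ge 0$ with $x_k=x'_k$ for all $|k|>n$. A holonomy is an injective Borel function $g:A\to X$, with $A\subset X$ Borel, such that $x$ and $g(x)$ are equivalent for every $x\in A$. A Borel probability $\mu$ on $X$ is double-tail invariant if $\mu(g(A))=\mu(A)$ for every holonomy $g:A\to X$, and it is then called ergodic if every Borel set that is a union of equivalence classes has $\mu$-measure $0$ or $1$. For a sequence of letters $x$ let $H_i(x)$, $i\in\mathbb Z$, be the walk with $H_0(x)=0$ and with increment $H_{i+1}(x)-H_i(x)$ equal to $+1$ if $x_i$ is one of the $\alpha_j$ and $-1$ if $x_i$ is one of the $\beta_j$. For $s,t\in\{\{+\infty\},\{-\infty\},\mathbb R\}$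 put $$B^s_t=\{x\in X:\ \liminf_{i\to+\infty}H_i(x)\in s,\ \liminf_{i\to-\infty}H_i(x)\in t\}.$$ Define three Borel measures on $X$. * $\mu_+(A)=p\bigl(g_+(A\cap B^{+\infty}_{-\infty})\bigr)$, where $p$ is the symmetric product measure on $\{\alpha_1,\dots,\alpha_m,\beta\}^{\mathbb Z}$ and $g_+$ (injective on $B^{+\infty}_{-\infty}$) replaces every $\beta_j$ by $\beta$. * $\mu_-(A)=p'\bigl(g_-(A\cap B^{-\infty}_{+\infty})\bigr)$, where $p'$ is the symmetric product measure on $\{\beta_1,\dots,\beta_m,\alpha\}^{\mathbb Z}$ and $g_-$ (injective on $B^{-\infty}_{+\infty}$) replaces every $\alpha_j$ by $\alpha$. * $\tilde\mu=(\mu_1\times\mu_2)\circ F^{-1}$, where $\mu_1$ and $\mu_2$ are the symmetric product measures on $\{0,1\}^{\mathbb Z}$ and $\{1,\dots,m\}^{\mathbb Z}$, and $F$ is the following $(\mu_1\times\mu_2)$-a.e. defined map into $X$. Let $\tilde H_i(z)$ be the walk with $\tilde H_0(z)=0$ and with increment $\tilde H_{i+1}(z)-\tilde H_i(z)$ equal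 to $+1$ if $z_i=1$ and $-1$ if $z_i=0$. Let $\gamma_k(z)=\sum_{i=0}^k z_i$ for $k\ge 0$ and $\gamma_k(z)=-\sum_{i=k}^{-1}z_i$ for $k<0$, and let $\varepsilon_n(z)=\max\{l<n:\tilde H_l(z)\le\tilde H_{n+1}(z)\}$. Then $F(z,a)_n=\alpha_{a_{\gamma_n(z)}}$ if $z_n=1$, and $F(z,a)_n=\beta_{a_{\gamma_k(z)}}$ with $k=\varepsilon_n(z)$ if $z_n=0$. Then: 1. For all $s,t\in\{\{+\infty\},\mathbb R\}$ there is no double-tail invariant probability $\mu$ on $X$ with $\mu(B^s_t)=1$. 2. $\mu_+$ and $\mu_-$ (the two Krieger measures) are $T$-invariant probabilities of maximal entropy, that is, their entropy with respect to $T$ is at least that of every $T$-invariant Borel probability on $X$. 3. $\mu_+$, $\mu_-$ and $\tilde\mu$ are pairwise distinct, and they are exactly the ergodic double-tail invariant probabilities on $X$. -/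

import Mathlib

open MeasureTheory Filter

noncomputable section

namespace Dyck

/-! ### The alphabet, the syntactic monoid and the Dyck language -/

/-- The alphabet `{α_1, …, α_m} ∪ {β_1, …, β_m}`; `Sum.inl j` is the opening bracket `α_j` and
`Sum.inr j` is the closing bracket `β_j`. -/
abbrev Letter (m : ℕ) : Type := Fin m ⊕ Fin m

/-- The letter `α_j`. -/
abbrev α {m : ℕ} (j : Fin m) : Letter m := Sum.inl j

/-- The letter `β_j`. -/
abbrev β {m : ℕ} (j : Fin m) : Letter m := Sum.inr j

/-- The free monoid with zero on the alphabet. -/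
abbrev FreeZero (m : ℕ) : Type := WithZero (FreeMonoid (Letter m))

/-- A finite word as an element of the free monoid with zero. -/
def word {m : ℕ} (w : List (Letter m)) : FreeZero m :=
  ((FreeMonoid.ofList w : FreeMonoid (Letter m)) : FreeZero m)

/-- The defining relations of the Dyck monoid: `α_j β_j ≡ 1`, and `α_i β_j ≡ 0` for `i ≠ j`. -/
inductive Relation (m : ℕ) : FreeZero m → FreeZero m → Prop
  | matched (j : Fin m) : Relation m (word [α j, β j]) 1
  | mismatched (i j : Fin m) (h : i ≠ j) : Relation m (word [α i, β j]) 0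

/-- The congruence "equal modulo `M`"; its quotient is the Dyck monoid `M`. -/
def modM (m : ℕ) : Con (FreeZero m) := conGen (Relation m)

/-- The `m`-Dyck language: the words that are nonzero in the Dyck monoid. -/
def language (m : ℕ) : Set (List (Letter m)) := {w | ¬ modM m (word w) 0}

/-! ### The two-sided Dyck shift -/

/-- The word `x_r x_{r+1} ⋯ x_{r+n-1}`. -/
def block {m : ℕ} (x : ℤ → Letter m) (r : ℤ) (n : ℕ) : List (Letter m) :=
  List.ofFn fun k : Fin n => x (r + ((k : ℕ) : ℤ))

/-- The two-sided `m`-Dyck shift, as a subset of the full shift. -/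
def shiftSet (m : ℕ) : Set (ℤ → Letter m) := {x | ∀ (r : ℤ) (n : ℕ), block x r n ∈ language m}

/-- The two-sided `m`-Dyck shift `X`, with the σ-algebra induced from the product σ-algebra, which
is its Borel σ-algebra. -/
abbrev X (m : ℕ) : Type := shiftSet m

/-- The shift transformation `(T x)_i = x_{i+1}` of `X`. -/
def T {m : ℕ} (x : X m) : X m :=
  ⟨fun i => x.1 (i + 1), fun r n => by
    have h := x.2 (r + 1) n
    simpa only [block, add_right_comm r] using h⟩

/-! ### The double-tail relation -/

/-- The double-tail (homoclinic) relation of `X`. -/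
def DoubleTail {m : ℕ} (x y : X m) : Prop := ∃ n : ℕ, ∀ k : ℤ, (n : ℤ) < |k| → x.1 k = y.1 k

/-- `g : A → X` is a holonomy of the double-tail relation: `A` is Borel and `g` is an injective
Borel function with `(x, g x)` in the relation for all `x ∈ A`. -/
structure IsHolonomy {m : ℕ} (A : Set (X m)) (g : A → X m) : Prop where
  measurableSet : MeasurableSet A
  measurable : Measurable g
  injective : Function.Injective g
  doubleTail : ∀ x : A, DoubleTail (x : X m) (g x)

/-- `μ` is a double-tail invariant probability: `μ (g A) = μ A` for all holonomies `g : A → X`. -/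
structure IsInvariantProbability {m : ℕ} (μ : Measure (X m)) : Prop where
  isProbabilityMeasure : IsProbabilityMeasure μ
  invariant : ∀ (A : Set (X m)) (g : A → X m), IsHolonomy A g → μ (Set.range g) = μ A

/-- `μ` is an ergodic double-tail invariant probability: every Borel set which is saturated under
the double-tail relation has measure zero or one. -/
structure IsErgodicInvariantProbability {m : ℕ} (μ : Measure (X m)) : Prop
    extends IsInvariantProbability μ where
  ergodic : ∀ A : Set (X m), MeasurableSet A → (∀ x y, DoubleTail x y → x ∈ A → y ∈ A) →
    μ A = 0 ∨ μ A = 1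

/-! ### Heights and the sets `B^s_t` -/

/-- The walk with steps `s`: `∑_{0 ≤ j < i} s_j` for `i ≥ 0` and `-∑_{i ≤ j < 0} s_j` for
`i < 0`. -/
def walk (s : ℤ → ℤ) (i : ℤ) : ℤ := ∑ j ∈ Finset.Ico 0 i, s j - ∑ j ∈ Finset.Ico i 0, s j

/-- The step of a letter: `1` for every `α_j` and `-1` for every `β_j`. -/
def step {m : ℕ} : Letter m → ℤ
  | Sum.inl _ => 1
  | Sum.inr _ => -1

/-- The height `H_i(x)`. -/
def H {m : ℕ} (x : ℤ → Letter m) (i : ℤ) : ℤ := walk (fun j => step (x j)) i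

/-- The set `B^s_t` of points with `liminf_{i → +∞} H_i(x) ∈ s` and
`liminf_{i → -∞} H_i(x) ∈ t`. -/
def B (m : ℕ) (s t : Set EReal) : Set (X m) :=
  {x | liminf (fun i : ℤ => ((H x.1 i : ℝ) : EReal)) atTop ∈ s ∧
    liminf (fun i : ℤ => ((H x.1 i : ℝ) : EReal)) atBot ∈ t}

/-- The real numbers, as a set of extended reals. -/
def reals : Set EReal := Set.range ((↑) : ℝ → EReal)

/-! ### Symmetric product measures -/

/-- The symmetric (uniform) Bernoulli measure on the two-sided full shift over the finite
alphabet `S`. -/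
def bernoulli (S : Type) [Finite S] [Nonempty S] [MeasurableSpace S] : Measure (ℤ → S) :=
  Measure.infinitePi fun _ : ℤ => ProbabilityTheory.uniformOn (Set.univ : Set S)

/-! ### The two measures of Krieger -/

/-- The alphabet with `m + 1` letters obtained by identifying all the `β`'s, or all the `α`'s:
`Sum.inl j` is a letter that keeps its type `j`, and `Sum.inr ()` is the letter without type. -/
abbrev Merged (m : ℕ) : Type := Fin m ⊕ Unit

/-- The map `g_+`, which forgets the types of the `β`'s. -/
def gPlus {m : ℕ} (x : X m) : ℤ → Merged m := fun i =>
  match x.1 i with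
  | Sum.inl j => Sum.inl j
  | Sum.inr _ => Sum.inr ()

/-- The map `g_-`, which forgets the types of the `α`'s. -/
def gMinus {m : ℕ} (x : X m) : ℤ → Merged m := fun i =>
  match x.1 i with
  | Sum.inl _ => Sum.inr ()
  | Sum.inr j => Sum.inl j

/-- The first Krieger measure: the symmetric Bernoulli measure `p` on `{α_1, …, α_m, β}^ℤ`
transported by the inverse of `g_+` on `B^{+∞}_{-∞}`, that is,
`A ↦ p (g_+ (A ∩ B^{+∞}_{-∞}))`. -/
def muPlus (m : ℕ) : Measure (X m) :=
  ((bernoulli (Merged m)).comap fun x : B m {⊤} {⊥} => gPlus (x : X m)).map Subtype.val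

/-- The second Krieger measure: the symmetric Bernoulli measure `p` on `{β_1, …, β_m, α}^ℤ`
transported by the inverse of `g_-` on `B^{-∞}_{+∞}`, that is,
`A ↦ p (g_- (A ∩ B^{-∞}_{+∞}))`. -/
def muMinus (m : ℕ) : Measure (X m) :=
  ((bernoulli (Merged m)).comap fun x : B m {⊥} {⊤} => gMinus (x : X m)).map Subtype.val

/-! ### Entropy -/

/-- The entropy `-∑_w μ[w] log μ[w]` of the partition of `X` into cylinders `[w]` over the
coordinates `0, …, n - 1`. -/
def blockEntropy {m : ℕ} (μ : Measure (X m)) (n : ℕ) : ℝ :=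
  ∑ w : Fin n → Letter m, Real.negMulLog (μ.real {x : X m | ∀ k : Fin n, x.1 ((k : ℕ) : ℤ) = w k})

/-- The entropy of the shift `T` with respect to `μ`; for a shift-invariant probability the limit
superior is a limit. -/
def entropy {m : ℕ} (μ : Measure (X m)) : ℝ := limsup (fun n : ℕ => blockEntropy μ n / n) atTop

/-- `μ` is a shift-invariant probability of maximal entropy. -/
def IsMaximalEntropy {m : ℕ} (μ : Measure (X m)) : Prop :=
  IsProbabilityMeasure μ ∧ MeasurePreserving T μ μ ∧
    ∀ ν : Measure (X m), IsProbabilityMeasure ν → MeasurePreserving T ν ν → entropy ν ≤ entropy μ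

/-! ### The third measure -/

/-- The walk of `z ∈ {0,1}^ℤ` with steps `1` where `z_j = 1` and `-1` where `z_j = 0`. -/
def zWalk (z : ℤ → Bool) (i : ℤ) : ℤ := walk (fun j => if z j then 1 else -1) i

/-- `γ_k(z)`, which enumerates the positions of the `1`s of `z`: it is `∑_{0 ≤ i ≤ k} z_i` for
`k ≥ 0` and `-∑_{k ≤ i < 0} z_i` for `k < 0`. -/
def gam (z : ℤ → Bool) (k : ℤ) : ℤ :=
  if 0 ≤ k then ∑ i ∈ Finset.Icc 0 k, (if z i then 1 else 0)
  else -∑ i ∈ Finset.Ico k 0, (if z i then 1 else 0)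

/-- `ε_n(z) = max {l < n : zWalk z l ≤ zWalk z (n+1)}`; the maximum exists for all `n` whenever
`zWalk z` is unbounded below at `-∞`. -/
def eps (z : ℤ → Bool) (n : ℤ) : ℤ := sSup {l : ℤ | l < n ∧ zWalk z l ≤ zWalk z (n + 1)}

/-- The map `F`: the sequence `z` says where the `α`'s are, the types of the `α`'s are read off
`a`, and a `β` receives the type of the `α` that it matches. The value is irrelevant on the null
set of those `z` whose walk is not unbounded below in both directions. -/
def F {m : ℕ} (q : (ℤ → Bool) × (ℤ → Fin m)) : ℤ → Letter m := fun n =>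
  if q.1 n then α (q.2 (gam q.1 n)) else β (q.2 (gam q.1 (eps q.1 n)))

/-- The measure `μ̃ = (μ₁ × μ₂) ∘ F⁻¹`, regarded as a measure on `X`, where `μ₁` and `μ₂` are the
symmetric product measures on `{0,1}^ℤ` and `{1, …, m}^ℤ`. -/
def muTilde (m : ℕ) [NeZero m] : Measure (X m) :=
  (((bernoulli Bool).prod (bernoulli (Fin m))).map F).comap Subtype.val

end Dyck

end

noncomputable section

namespace Dyck

variable {m : ℕ}

/-! ### Walks and matched positions -/

/-! A point of X is a pattern (which positions carry opening brackets) together with a type for each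
bracket. The walk of the pattern decides which positions match, and a sequence lies in X exactly
when matched positions carry equal types (`mem_shiftSet_iff`). What matters is whether the walk is
unbounded below at −∞ (`LU`, so that every closing bracket has a partner) and at +∞ (`RU`, likewise
for opening brackets). Both properties are saturated, so an ergodic probability lives on one of four
sets.

Neither property: the walk attains its minimum. Flipping single brackets shows that the first
minimum is at n + 1 as often as the last one is at n, and flipping two brackets shows that the
minima are almost surely finite in number. Since the first minimum never comes after the last, the
first one has probability 0 at every place (`not_invariant_of_bounded_below`). This also gives part
1.

Only `LU`: forgetting the types of the closing brackets loses nothing, and a change of one letter of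
the merged sequence moves the point within its class. Hence all letters are equally likely given
finitely many others, and the merged law is the symmetric product measure (`eq_krieger`). Only `RU`
is the mirror image under `rev`.

Both: permuting the types of matched pairs preserves the measure, so it is determined by the law of
its pattern (`TypeSymmetric.ext`). Exchanging neighbouring brackets makes that law exchangeable
(`measure_exchange`, `symm_swap_succ`). Reversing the excursion that begins at an opening bracket
gives one inequality between the weights of the two kinds of bracket, time reversal gives the other,
and the law is the fair coin (`map_pattern_eq`, `eq_muTilde`).

Conversely, the measures are invariant because tail-equivalent points have central cylinders of
equal weight (`measure_range_eq_of_centralCylinder`). For the Krieger measures this is immediate in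
merged coordinates. For μ̃ the weight is governed by the number of independent types in a window,
which agrees for two equivalent points unless the modification changes the height difference between
the two ends; in that case the types far to the left obey a periodicity that has probability 0
(`muTilde_invariant`).

Uniqueness on each set yields ergodicity by conditioning, and shift invariance because the shift
carries invariant measures to invariant measures and preserves `LU` and `RU`. Maximal entropy holds
because X has at most (n + 1)(m + 1)^n words of length n, while a Krieger measure gives each of them
at most (m + 1)^(-n). -/

theorem walk_succ (s : ℤ → ℤ) (i : ℤ) : walk s (i + 1) = walk s i + s i := by
  unfold walk
  rcases le_or_gt 0 i with h | h
  · have h1 : Finset.Ico 0 (i + 1) = insert i (Finset.Ico 0 i) := by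
      ext j; simp only [Finset.mem_Ico, Finset.mem_insert]; omega
    have h2 : Finset.Ico (i + 1) 0 = ∅ := Finset.Ico_eq_empty (by omega)
    have h3 : Finset.Ico i 0 = ∅ := Finset.Ico_eq_empty (by omega)
    rw [h1, h2, h3, Finset.sum_insert (by simp)]
    simp; ring
  · have h1 : Finset.Ico i 0 = insert i (Finset.Ico (i + 1) 0) := by
      ext j; simp only [Finset.mem_Ico, Finset.mem_insert]; omega
    have h2 : Finset.Ico 0 (i + 1) = ∅ := Finset.Ico_eq_empty (by omega)
    have h3 : Finset.Ico 0 i = ∅ := Finset.Ico_eq_empty (by omega)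
    rw [h1, h2, h3, Finset.sum_insert (by simp)]
    simp

theorem zWalk_zero (z : ℤ → Bool) : zWalk z 0 = 0 := by simp [zWalk, walk]

theorem zWalk_succ (z : ℤ → Bool) (i : ℤ) :
    zWalk z (i + 1) = zWalk z i + if z i then 1 else -1 := walk_succ _ _

theorem zWalk_succ_true {z : ℤ → Bool} {i : ℤ} (h : z i = true) :
    zWalk z (i + 1) = zWalk z i + 1 := by rw [zWalk_succ, h]; simp

theorem zWalk_succ_false {z : ℤ → Bool} {i : ℤ} (h : z i = false) :
    zWalk z (i + 1) = zWalk z i - 1 := by rw [zWalk_succ, h]; simp; ring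

theorem zWalk_step (z : ℤ → Bool) (i : ℤ) :
    zWalk z (i + 1) = zWalk z i + 1 ∨ zWalk z (i + 1) = zWalk z i - 1 := by
  cases h : z i
  · exact .inr (zWalk_succ_false h)
  · exact .inl (zWalk_succ_true h)

theorem zWalk_sub_congr {z z' : ℤ → Bool} {a b : ℤ} (hab : a ≤ b)
    (h : ∀ i, a ≤ i → i < b → z i = z' i) :
    zWalk z b - zWalk z a = zWalk z' b - zWalk z' a := by
  induction b, hab using Int.leInduction with
  | base => simp
  | succ n hn ih =>
    have := ih fun i hi hi' => h i hi (by omega)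
    rw [zWalk_succ, zWalk_succ, h n hn (by omega)]
    omega

/-- The positions `l ≤ n` carry an opening bracket and the closing bracket matching it. -/
def Matched (z : ℤ → Bool) (l n : ℤ) : Prop :=
  l ≤ n ∧ zWalk z (n + 1) = zWalk z l ∧ ∀ k, l < k → k ≤ n → zWalk z l < zWalk z k

theorem Matched.lt {z : ℤ → Bool} {l n : ℤ} (h : Matched z l n) : l < n := by
  rcases h.1.lt_or_eq with h' | rfl
  · exact h'
  · have := h.2.1; rcases zWalk_step z l with h | h <;> omega

theorem Matched.left {z : ℤ → Bool} {l n : ℤ} (h : Matched z l n) : z l = true := by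
  have h1 := h.2.2 (l + 1) (by omega) (by have := h.lt; omega)
  cases hz : z l
  · rw [zWalk_succ_false hz] at h1; omega
  · rfl

theorem Matched.right {z : ℤ → Bool} {l n : ℤ} (h : Matched z l n) : z n = false := by
  have h1 := h.2.2 n h.lt le_rfl
  have h2 := h.2.1
  cases hz : z n
  · rfl
  · rw [zWalk_succ_true hz] at h2; omega

theorem Matched.eq_right {z : ℤ → Bool} {l n n' : ℤ} (h : Matched z l n) (h' : Matched z l n') :
    n = n' := by
  by_contra hne
  rcases lt_or_gt_of_ne hne with hlt | hlt
  · have := h'.2.2 (n + 1) (by have := h.1; omega) (by omega); have := h.2.1; omega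
  · have := h.2.2 (n' + 1) (by have := h'.1; omega) (by omega); have := h'.2.1; omega

theorem Matched.eq_left {z : ℤ → Bool} {l l' n : ℤ} (h : Matched z l n) (h' : Matched z l' n) :
    l = l' := by
  by_contra hne
  rcases lt_or_gt_of_ne hne with hlt | hlt
  · have := h.2.2 l' hlt h'.1; have := h.2.1; have := h'.2.1; omega
  · have := h'.2.2 l hlt h.1; have := h.2.1; have := h'.2.1; omega

theorem Matched.congr {z z' : ℤ → Bool} {l n : ℤ} (h : Matched z l n)
    (hz : ∀ i, l ≤ i → i ≤ n → z i = z' i) : Matched z' l n := by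
  refine ⟨h.1, ?_, fun k hk hk' => ?_⟩
  · have := zWalk_sub_congr (z := z) (z' := z') (a := l) (b := n + 1) (by have := h.1; omega)
      fun i hi hi' => hz i hi (by omega)
    have := h.2.1; omega
  · have := zWalk_sub_congr (z := z) (z' := z') (a := l) (b := k) hk.le
      fun i hi hi' => hz i hi (by omega)
    have := h.2.2 k hk hk'; omega

theorem eps_eq_of_isGreatest {z : ℤ → Bool} {l n : ℤ}
    (h : IsGreatest {l : ℤ | l < n ∧ zWalk z l ≤ zWalk z (n + 1)} l) : eps z n = l :=
  h.csSup_eq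

theorem eps_isGreatest {z : ℤ → Bool} {n : ℤ} (h : ∃ l < n, zWalk z l ≤ zWalk z (n + 1)) :
    IsGreatest {l : ℤ | l < n ∧ zWalk z l ≤ zWalk z (n + 1)} (eps z n) := by
  obtain ⟨l, hl, hl'⟩ := h
  have hb : BddAbove {l : ℤ | l < n ∧ zWalk z l ≤ zWalk z (n + 1)} := ⟨n, fun i hi => hi.1.le⟩
  exact ⟨Int.csSup_mem ⟨l, hl, hl'⟩ hb, fun i hi => le_csSup hb hi⟩

/-- Maximality keeps the walk strictly above its final height between `eps z n` and n; steps of size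
one then force the height at `eps z n` to be exactly the final one. -/
theorem matched_eps {z : ℤ → Bool} {n : ℤ} (hn : z n = false)
    (h : ∃ l < n, zWalk z l ≤ zWalk z (n + 1)) : Matched z (eps z n) n := by
  obtain ⟨⟨h1, h2⟩, h3⟩ := eps_isGreatest h
  generalize eps z n = l at h1 h2 h3
  have hW := zWalk_succ_false hn
  have key : ∀ k, l < k → k ≤ n → zWalk z (n + 1) < zWalk z k := by
    intro k hk hk'
    rcases hk'.lt_or_eq with hlt | rfl
    · by_contra hcon
      have := h3 (show k ∈ {l : ℤ | l < n ∧ zWalk z l ≤ zWalk z (n + 1)} from ⟨hlt, not_lt.1 hcon⟩)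
      omega
    · omega
  have hl := key (l + 1) (by omega) (by omega)
  have heq : zWalk z (n + 1) = zWalk z l := by
    rcases zWalk_step z l with h | h <;> omega
  exact ⟨h1.le, heq, fun k hk hk' => heq ▸ key k hk hk'⟩

theorem Matched.eps_eq {z : ℤ → Bool} {l n : ℤ} (h : Matched z l n) : eps z n = l := by
  refine eps_eq_of_isGreatest ⟨⟨h.lt, h.2.1.ge⟩, fun k hk => ?_⟩
  by_contra hcon
  have := h.2.2 k (by omega) hk.1.le
  have := h.2.1
  have := hk.2
  omega

theorem exists_matched_right {z : ℤ → Bool} {l : ℤ} (hl : z l = true)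
    (h : ∃ k > l, zWalk z k ≤ zWalk z l) : ∃ n, Matched z l n := by
  obtain ⟨k, ⟨hk, hk'⟩, hmin⟩ := Int.exists_least_of_bdd
    (P := fun k => l < k ∧ zWalk z k ≤ zWalk z l) ⟨l, fun k hk => hk.1.le⟩ h
  have hW := zWalk_succ_true hl
  have hlk : l + 1 < k := by
    rcases (show l + 1 ≤ k by omega).lt_or_eq with h | h
    · exact h
    · rw [← h] at hk'; omega
  have key : ∀ j, l < j → j ≤ k - 1 → zWalk z l < zWalk z j := by
    intro j hj hj'
    by_contra hcon
    have := hmin j ⟨hj, not_lt.1 hcon⟩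
    omega
  refine ⟨k - 1, by omega, ?_, key⟩
  have := key (k - 1) (by omega) le_rfl
  have h2 := zWalk_step z (k - 1)
  rw [sub_add_cancel] at h2 ⊢
  omega

/-- The walk of `z` is unbounded below at `-∞`. -/
def LU (z : ℤ → Bool) : Prop := ∀ b n : ℤ, ∃ i < n, zWalk z i < b

/-- The walk of `z` is unbounded below at `+∞`. -/
def RU (z : ℤ → Bool) : Prop := ∀ b n : ℤ, ∃ i > n, zWalk z i < b

theorem LU.matched {z : ℤ → Bool} (h : LU z) {n : ℤ} (hn : z n = false) :
    Matched z (eps z n) n :=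
  matched_eps hn (by obtain ⟨i, hi, hi'⟩ := h (zWalk z (n + 1)) n; exact ⟨i, hi, hi'.le⟩)

theorem RU.matched {z : ℤ → Bool} (h : RU z) {l : ℤ} (hl : z l = true) : ∃ n, Matched z l n :=
  exists_matched_right hl (by obtain ⟨i, hi, hi'⟩ := h (zWalk z l) l; exact ⟨i, hi, hi'.le⟩)

theorem exists_bound_Icc (f : ℤ → ℤ) (a b : ℤ) : ∃ c, ∀ i, a ≤ i → i ≤ b → c ≤ f i := by
  obtain ⟨c, hc⟩ := ((Set.finite_Icc a b).image f).bddBelow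
  exact ⟨c, fun i hi hi' => hc ⟨i, ⟨hi, hi'⟩, rfl⟩⟩

theorem not_LU_iff {z : ℤ → Bool} : ¬ LU z ↔ ∃ b, ∀ i ≤ 0, b ≤ zWalk z i := by
  constructor
  · intro h
    simp only [LU, not_forall, not_exists, not_and, not_lt] at h
    obtain ⟨b, n, h⟩ := h
    obtain ⟨c, hc⟩ := exists_bound_Icc (zWalk z) n 0
    refine ⟨min b c, fun i hi => ?_⟩
    rcases lt_or_ge i n with h' | h'
    · exact (min_le_left _ _).trans (h i h')
    · exact (min_le_right _ _).trans (hc i h' hi)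
  · rintro ⟨b, hb⟩ h
    obtain ⟨i, hi, hi'⟩ := h b 0
    have := hb i hi.le
    omega

theorem not_RU_iff {z : ℤ → Bool} : ¬ RU z ↔ ∃ b, ∀ i ≥ 0, b ≤ zWalk z i := by
  constructor
  · intro h
    simp only [RU, not_forall, not_exists, not_and, not_lt] at h
    obtain ⟨b, n, h⟩ := h
    obtain ⟨c, hc⟩ := exists_bound_Icc (zWalk z) 0 n
    refine ⟨min b c, fun i hi => ?_⟩
    rcases lt_or_ge n i with h' | h'
    · exact (min_le_left _ _).trans (h i h')
    · exact (min_le_right _ _).trans (hc i hi h')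
  · rintro ⟨b, hb⟩ h
    obtain ⟨i, hi, hi'⟩ := h b 0
    have := hb i hi.le
    omega

theorem LU.congr {z z' : ℤ → Bool} {n : ℤ} (h : LU z) (hz : ∀ i < n, z i = z' i) : LU z' := by
  intro b k
  obtain ⟨i, hi, hi'⟩ := h (b + zWalk z n - zWalk z' n) (min k n)
  have := zWalk_sub_congr (z := z) (z' := z') (a := i) (b := n) (by omega) fun j _ hj => hz j hj
  exact ⟨i, by omega, by omega⟩

theorem RU.congr {z z' : ℤ → Bool} {n : ℤ} (h : RU z) (hz : ∀ i, n < i → z i = z' i) : RU z' := by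
  intro b k
  obtain ⟨i, hi, hi'⟩ := h (b + zWalk z (n + 1) - zWalk z' (n + 1)) (max k (n + 1))
  have := zWalk_sub_congr (z := z) (z' := z') (a := n + 1) (b := i) (by omega)
    fun j hj _ => hz j (by omega)
  exact ⟨i, by omega, by omega⟩

/-- Reversal of time together with the exchange of opening and closing brackets. -/
def mirror (z : ℤ → Bool) : ℤ → Bool := fun i => !z (-1 - i)

theorem mirror_mirror (z : ℤ → Bool) : mirror (mirror z) = z := by
  funext i; simp [mirror]

/-- Reversing time negates increments and exchanging brackets negates them again, so the walk is
merely reflected. Position i is the step from time i to i + 1, which is why positions reflect by −1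
− i and times by −i. -/
theorem zWalk_mirror (z : ℤ → Bool) (i : ℤ) : zWalk (mirror z) i = zWalk z (-i) := by
  have step : ∀ i, zWalk (mirror z) (i + 1) - zWalk (mirror z) i
      = zWalk z (-(i + 1)) - zWalk z (-i) := by
    intro i
    have h1 := zWalk_succ (mirror z) i
    have h2 := zWalk_succ z (-1 - i)
    rw [show -1 - i + 1 = -i by ring] at h2
    rw [show -(i + 1) = -1 - i by ring, h1, h2]
    cases hz : z (-1 - i) <;> simp [mirror, hz]
  induction i using Int.induction_on with
  | zero => simp [zWalk_zero]
  | succ n ih => have := step n; omega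
  | pred n ih =>
    have := step (-n - 1)
    rw [sub_add_cancel] at this
    omega

theorem Matched.mirror {z : ℤ → Bool} {l n : ℤ} (h : Matched z l n) :
    Matched (mirror z) (-1 - n) (-1 - l) := by
  refine ⟨by have := h.1; omega, ?_, fun k hk hk' => ?_⟩
  · rw [zWalk_mirror, zWalk_mirror, show -(-1 - l + 1) = l by ring,
      show -(-1 - n) = n + 1 by ring, h.2.1]
  · rw [zWalk_mirror, zWalk_mirror, show -(-1 - n) = n + 1 by ring, h.2.1]
    exact h.2.2 _ (by omega) (by omega)

theorem LU_mirror {z : ℤ → Bool} : LU (mirror z) ↔ RU z := by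
  simp only [LU, RU, zWalk_mirror]
  constructor
  · intro h b n
    obtain ⟨i, hi, hi'⟩ := h b (-n)
    exact ⟨-i, by omega, hi'⟩
  · intro h b n
    obtain ⟨i, hi, hi'⟩ := h b (-n)
    exact ⟨-i, by omega, by simpa using hi'⟩

theorem RU_mirror {z : ℤ → Bool} : RU (mirror z) ↔ LU z := by
  rw [← LU_mirror, mirror_mirror]

/-! ### The Dyck language in terms of matched positions -/

/-- The type of a bracket. -/
def typ : Letter m → Fin m
  | Sum.inl j => j
  | Sum.inr j => j

/-- The positions of the opening brackets. -/
def pattern (x : ℤ → Letter m) : ℤ → Bool := fun i => (x i).isLeft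

theorem letter_ext {a b : Letter m} (h : a.isLeft = b.isLeft) (h' : typ a = typ b) : a = b := by
  cases a <;> cases b <;> simp_all [typ]

theorem eq_α_of_isLeft {a : Letter m} (h : a.isLeft = true) : a = α (typ a) :=
  letter_ext (by simp [h]) rfl

theorem eq_β_of_isLeft {a : Letter m} (h : a.isLeft = false) : a = β (typ a) :=
  letter_ext (by simp [h]) rfl

theorem H_eq (x : ℤ → Letter m) : H x = zWalk (pattern x) := by
  funext i
  unfold H zWalk
  congr 1
  funext j
  cases h : x j <;> simp [step, pattern, h]

/-! ### The Dyck monoid acting on stacks of types -/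

/-- The partial action of a letter on stacks of types; a word is read from right to left. -/
def act : Letter m → Option (List (Fin m)) → Option (List (Fin m))
  | _, none => none
  | Sum.inr j, some s => some (j :: s)
  | Sum.inl _, some [] => none
  | Sum.inl i, some (j :: s) => if i = j then some s else none

/-- The partial action of a word on stacks. -/
def run (w : List (Letter m)) (s : Option (List (Fin m))) : Option (List (Fin m)) :=
  w.foldr act s

theorem act_none (a : Letter m) : act a none = none := by cases a <;> rfl

theorem run_cons (a : Letter m) (w s) : run (a :: w) s = act a (run w s) := rfl

theorem run_append (v w : List (Letter m)) (s) : run (v ++ w) s = run v (run w s) :=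
  List.foldr_append

theorem run_none (w : List (Letter m)) : run w none = none := by
  induction w with
  | nil => rfl
  | cons a w ih => rw [run_cons, ih, act_none]

/-- The partial action of the free monoid with zero on stacks. -/
def ev : FreeZero m → Option (List (Fin m)) → Option (List (Fin m))
  | none => fun _ => none
  | some w => run w.toList

theorem ev_word (w : List (Letter m)) : ev (word w) = run w := rfl

theorem ev_zero : ev (0 : FreeZero m) = fun _ => none := rfl

theorem ev_one : ev (1 : FreeZero m) = id := rfl

theorem word_append (v w : List (Letter m)) : word (v ++ w) = word v * word w := by
  simp [word]

theorem ev_mul (a b : FreeZero m) : ev (a * b) = ev a ∘ ev b := by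
  induction a using WithZero.recZeroCoe with
  | zero => rw [zero_mul]; rfl
  | coe v =>
    induction b using WithZero.recZeroCoe with
    | zero =>
      rw [mul_zero]; funext s; exact (run_none _).symm
    | coe w =>
      rw [← WithZero.coe_mul]
      funext s
      exact run_append _ _ _

/-- Two elements are congruent when they act in the same way on all stacks. -/
def evCon (m : ℕ) : Con (FreeZero m) where
  r a b := ev a = ev b
  iseqv := ⟨fun _ => rfl, fun h => h.symm, fun h h' => h.trans h'⟩
  mul' h h' := by rw [ev_mul, ev_mul, h, h']

/-- Both defining relations hold for the action on stacks, so the generated congruence is contained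
in its kernel. -/
theorem ev_eq_of_modM {a b : FreeZero m} (h : modM m a b) : ev a = ev b := by
  have hle : modM m ≤ evCon m := by
    refine Con.conGen_le.2 fun a b hab => ?_
    show ev a = ev b
    cases hab with
    | matched j =>
      funext s
      cases s <;> simp [ev_word, ev_one, run, act]
    | mismatched i j hij =>
      funext s
      cases s <;> simp [ev_word, ev_zero, run, act, hij]
  exact hle h

theorem modM_zero_mul {a b : FreeZero m} (h : modM m a 0) : modM m (a * b) 0 := by
  simpa using (modM m).mul h ((modM m).refl b)

theorem modM_mul_zero {a b : FreeZero m} (h : modM m b 0) : modM m (a * b) 0 := by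
  simpa using (modM m).mul ((modM m).refl a) h

/-- Prepending an opening bracket to a normal form either cancels its first closing bracket, gives
zero, or lengthens the block of opening brackets. -/
theorem modM_zero_or_normal (w : List (Letter m)) : modM m (word w) 0 ∨
    ∃ P Q : List (Fin m), modM m (word w) (word (P.map β ++ Q.map α)) := by
  induction w with
  | nil => exact .inr ⟨[], [], (modM m).refl _⟩
  | cons a w ih =>
    rw [← List.singleton_append, word_append]
    rcases ih with ih | ⟨P, Q, ih⟩
    · exact .inl (modM_mul_zero ih)
    have h0 : modM m (word [a] * word w) (word [a] * word (P.map β ++ Q.map α)) :=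
      (modM m).mul ((modM m).refl _) ih
    rcases a with j | j
    · rcases P with _ | ⟨i, P⟩
      · exact .inr ⟨[], j :: Q, by simpa [← word_append] using h0⟩
      · have h1 : word [α j] * word ((i :: P).map β ++ Q.map α)
            = word [α j, β i] * word (P.map β ++ Q.map α) := by
          rw [← word_append, ← word_append]; rfl
        rw [h1] at h0
        by_cases hij : j = i
        · subst hij
          have h2 : modM m (word [α j, β j]) 1 := ConGen.Rel.of _ _ (.matched j)
          refine .inr ⟨P, Q, (modM m).trans h0 ?_⟩
          simpa using (modM m).mul h2 ((modM m).refl (word (P.map β ++ Q.map α)))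
        · have h2 : modM m (word [α j, β i]) 0 := ConGen.Rel.of _ _ (.mismatched j i hij)
          exact .inl ((modM m).trans h0 (modM_zero_mul h2))
    · exact .inr ⟨j :: P, Q, by simpa [← word_append] using h0⟩

theorem run_map_β (P : List (Fin m)) (s : List (Fin m)) :
    run (P.map β) (some s) = some (P ++ s) := by
  induction P with
  | nil => rfl
  | cons j P ih => rw [List.map_cons, run_cons, ih]; rfl

theorem run_map_α (Q : List (Fin m)) (s : List (Fin m)) :
    run (Q.map α) (some (Q.reverse ++ s)) = some s := by
  induction Q generalizing s with
  | nil => rfl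
  | cons j Q ih =>
    rw [List.map_cons, run_cons, List.reverse_cons, List.append_assoc, ih]
    simp [act]

/-- Zero acts as the nowhere defined map, whereas a normal form is defined on a stack that supplies
what its opening brackets pop. Thus being nonzero becomes a question about running a stack machine.
-/
theorem mem_language_iff {w : List (Letter m)} :
    w ∈ language m ↔ ∃ s t, run w (some s) = some t := by
  constructor
  · intro h
    rcases modM_zero_or_normal w with h0 | ⟨P, Q, h0⟩
    · exact absurd h0 h
    · refine ⟨Q.reverse ++ [], P ++ [], ?_⟩
      rw [← ev_word, ev_eq_of_modM h0, ev_word, run_append, run_map_α, run_map_β]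
  · rintro ⟨s, t, h⟩ h0
    rw [← ev_word, ev_eq_of_modM h0] at h
    simp [ev_zero] at h

/-- A run that is defined never tries to pop from below its initial stack, so further entries
underneath do not interfere. -/
theorem run_append_stack {w : List (Letter m)} {s t : List (Fin m)} (c : List (Fin m))
    (h : run w (some s) = some t) : run w (some (s ++ c)) = some (t ++ c) := by
  induction w generalizing t with
  | nil => cases h; rfl
  | cons a w ih =>
    rw [run_cons] at h ⊢
    cases hu : run w (some s) with
    | none => rw [hu, act_none] at h; cases h
    | some u =>
      rw [ih hu]
      rw [hu] at h
      rcases a with i | i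
      · rcases u with _ | ⟨j, u⟩
        · cases h
        · simp only [act] at h
          split_ifs at h with hij
          cases h
          simp [act, hij]
      · cases h; rfl

theorem block_succ (x : ℤ → Letter m) (r : ℤ) (n : ℕ) :
    block x r (n + 1) = x r :: block x (r + 1) n := by
  simp only [block, List.ofFn_succ]
  congr 1
  · simp
  · congr 1; funext k; congr 1; simp; ring

/-- Reading leftwards from n, the type pushed at n stays on the stack while the walk is above its
closing height; the entries above it number the excess of height, less one. -/
theorem run_of_matched {x : ℤ → Letter m} {l n : ℤ} (h : Matched (pattern x) l n)
    {s t : List (Fin m)} (d : ℕ) (hd : (d : ℤ) ≤ n - 1 - l)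
    (hrun : run (block x (n - d) (d + 1)) (some s) = some t) :
    ∃ u, t = u ++ typ (x n) :: s ∧
      (u.length : ℤ) = zWalk (pattern x) (n - d) - zWalk (pattern x) (n + 1) - 1 := by
  have hn : x n = β (typ (x n)) := eq_β_of_isLeft h.right
  induction d generalizing t with
  | zero =>
    rw [block_succ] at hrun
    simp only [Nat.cast_zero, sub_zero] at hrun ⊢
    rw [hn] at hrun
    have hrun' : some (typ (x n) :: s) = some t := hrun
    cases hrun'
    refine ⟨[], rfl, ?_⟩
    have := zWalk_succ_false h.right
    simp only [List.length_nil, Nat.cast_zero]; omega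
  | succ d ih =>
    rw [block_succ, run_cons, show n - ((d + 1 : ℕ) : ℤ) + 1 = n - d by push_cast; ring] at hrun
    cases hu : run (block x (n - d) (d + 1)) (some s) with
    | none => rw [hu, act_none] at hrun; cases hrun
    | some v =>
      obtain ⟨u, rfl, hlen⟩ := ih (by push_cast at hd; omega) hu
      rw [hu] at hrun
      have hpos := h.2.2 (n - ((d + 1 : ℕ) : ℤ)) (by omega) (by omega)
      have heq := h.2.1
      set k := n - ((d + 1 : ℕ) : ℤ) with hk
      have hk1 : n - (d : ℤ) = k + 1 := by rw [hk]; push_cast; ring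
      rw [hk1] at hlen
      cases hx : (x k).isLeft
      · rw [eq_β_of_isLeft hx] at hrun
        refine ⟨typ (x k) :: u, by simpa [act] using hrun.symm, ?_⟩
        have := zWalk_succ_false (z := pattern x) (i := k) hx
        push_cast [List.length_cons]
        omega
      · rw [eq_α_of_isLeft hx] at hrun
        have hW := zWalk_succ_true (z := pattern x) (i := k) hx
        rcases u with _ | ⟨i, u⟩
        · simp at hlen; omega
        · simp only [List.cons_append, act] at hrun
          split_ifs at hrun
          cases hrun
          refine ⟨u, rfl, ?_⟩
          push_cast [List.length_cons] at hlen
          omega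

theorem typ_eq_of_matched {x : ℤ → Letter m} (hx : x ∈ shiftSet m) {l n : ℤ}
    (h : Matched (pattern x) l n) : typ (x l) = typ (x n) := by
  have hlt := h.lt
  obtain ⟨d, hd⟩ : ∃ d : ℕ, (d : ℤ) = n - 1 - l := ⟨(n - 1 - l).toNat, by omega⟩
  obtain ⟨s, t, hst⟩ := mem_language_iff.1 (hx l (d + 1 + 1))
  rw [block_succ, run_cons, show l + 1 = n - d by omega] at hst
  cases hu : run (block x (n - d) (d + 1)) (some s) with
  | none => rw [hu, act_none] at hst; cases hst
  | some v =>
    obtain ⟨u, rfl, hlen⟩ := run_of_matched h d (by omega) hu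
    rw [hu, eq_α_of_isLeft h.left] at hst
    have hW := zWalk_succ_true h.left
    have := h.2.1
    rw [show n - (d : ℤ) = l + 1 by omega] at hlen
    -- At l + 1 the walk is one above the closing height, so the entry pushed at n is on top when
    -- the opening bracket at l is read.
    have hu0 : u = [] := List.length_eq_zero_iff.1 (by omega)
    subst hu0
    simp only [List.nil_append, act] at hst
    split_ifs at hst with hij
    exact hij

/-- The run is built by extending the window to the left. The invariant says that entry k of the
stack is the type of the closing bracket by which the walk first drops k + 1 below its height at the
left end. An opening bracket put in front therefore pops precisely its partner. -/
theorem exists_run {x : ℤ → Letter m}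
    (hx : ∀ l n, Matched (pattern x) l n → typ (x l) = typ (x n)) (e : ℤ) (d : ℕ) :
    ∃ s t : List (Fin m), run (block x (e - d) d) (some s) = some t ∧
      ∀ (k : ℕ) (hk : k < t.length), ∃ n, e - d ≤ n ∧
        zWalk (pattern x) (n + 1) = zWalk (pattern x) (e - d) - 1 - k ∧
        (∀ i, e - d ≤ i → i ≤ n → zWalk (pattern x) (n + 1) < zWalk (pattern x) i) ∧
        typ (x n) = t[k] := by
  induction d with
  | zero => exact ⟨[], [], rfl, fun k hk => absurd hk (by simp)⟩
  | succ d ih =>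
    obtain ⟨s, t, hst, hinv⟩ := ih
    rw [block_succ]
    set r := e - ((d + 1 : ℕ) : ℤ) with hr
    have hr1 : e - (d : ℤ) = r + 1 := by rw [hr]; push_cast; ring
    rw [hr1] at hst hinv
    cases hl : (x r).isLeft
    · have hW := zWalk_succ_false (z := pattern x) (i := r) hl
      refine ⟨s, typ (x r) :: t, ?_, ?_⟩
      · rw [run_cons, hst, eq_β_of_isLeft hl]; rfl
      · rintro (_ | k) hk
        · refine ⟨r, le_rfl, by push_cast; omega, fun i hi hi' => ?_, rfl⟩
          obtain rfl : i = r := le_antisymm hi' hi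
          omega
        · obtain ⟨n, h1, h2, h3, h4⟩ := hinv k (by simpa using hk)
          refine ⟨n, by omega, by push_cast; omega, fun i hi hi' => ?_, by simpa using h4⟩
          rcases hi.lt_or_eq with h | rfl
          · exact h3 i (by omega) hi'
          · omega
    · have hW := zWalk_succ_true (z := pattern x) (i := r) hl
      rcases t with _ | ⟨a, t⟩
      -- An opening bracket unmatched in the window needs one more entry at the bottom of the
      -- initial stack.
      · refine ⟨s ++ [typ (x r)], [], ?_, fun k hk => absurd hk (by simp)⟩
        rw [run_cons, run_append_stack _ hst, eq_α_of_isLeft hl]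
        simp [act, typ]
      · refine ⟨s, t, ?_, fun k hk => ?_⟩
        · obtain ⟨n, h1, h2, h3, h4⟩ := hinv 0 (by simp)
          have hm : Matched (pattern x) r n := by
            refine ⟨by omega, by simp at h2; omega, fun k hk hk' => ?_⟩
            have := h3 k (by omega) hk'
            simp at h2; omega
          have := hx r n hm
          rw [run_cons, hst, eq_α_of_isLeft hl]
          simp only [List.getElem_cons_zero] at h4
          simp [act, this, h4]
        · obtain ⟨n, h1, h2, h3, h4⟩ := hinv (k + 1) (by simpa using hk)
          refine ⟨n, by omega, by push_cast at h2; omega, fun i hi hi' => ?_, by simpa using h4⟩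
          rcases hi.lt_or_eq with h | rfl
          · exact h3 i (by omega) hi'
          · push_cast at h2; omega

/-- The working description of X: admissibility of a modified sequence has to be checked only on its
matched pairs. -/
theorem mem_shiftSet_iff {x : ℤ → Letter m} :
    x ∈ shiftSet m ↔ ∀ l n, Matched (pattern x) l n → typ (x l) = typ (x n) := by
  refine ⟨fun hx l n h => typ_eq_of_matched hx h, fun hx r n => mem_language_iff.2 ?_⟩
  obtain ⟨s, t, h, -⟩ := exists_run hx (r + n) n
  exact ⟨s, t, by simpa using h⟩

end Dyck

namespace Dyck

variable {m : ℕ}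

/-! ### Measurability -/

instance {A B : Type*} [MeasurableSpace A] [MeasurableSpace B] [DiscreteMeasurableSpace A]
    [DiscreteMeasurableSpace B] : DiscreteMeasurableSpace (A ⊕ B) :=
  ⟨fun _ => measurableSet_sum_iff.2 ⟨.of_discrete, .of_discrete⟩⟩

@[fun_prop]
theorem measurable_zWalk (i : ℤ) : Measurable fun z => zWalk z i := by
  unfold zWalk walk
  refine .sub (Finset.measurable_sum _ fun j _ => ?_) (Finset.measurable_sum _ fun j _ => ?_) <;>
  exact (Measurable.of_discrete (f := fun b : Bool => if b then (1 : ℤ) else -1)).comp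
    (measurable_pi_apply j)

@[fun_prop]
theorem measurable_pattern : Measurable (pattern : (ℤ → Letter m) → ℤ → Bool) :=
  measurable_pi_lambda _ fun i =>
    (Measurable.of_discrete (f := fun a : Letter m => a.isLeft)).comp (measurable_pi_apply i)

@[fun_prop]
theorem measurable_matched (l n : ℤ) : Measurable fun z => Matched z l n := by
  unfold Matched; fun_prop

@[fun_prop]
theorem measurable_LU : Measurable LU := by unfold LU; fun_prop

@[fun_prop]
theorem measurable_RU : Measurable RU := by unfold RU; fun_prop

theorem measurable_eps (n : ℤ) : Measurable fun z => eps z n := by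
  refine measurable_to_countable' fun k => ?_
  -- The last alternative records the default value: `sSup` of the empty set of integers is 0.
  have h : (fun z => eps z n) ⁻¹' {k} = {z | ((∃ l < n, zWalk z l ≤ zWalk z (n + 1)) ∧
      ((k < n ∧ zWalk z k ≤ zWalk z (n + 1)) ∧
        ∀ l, l < n ∧ zWalk z l ≤ zWalk z (n + 1) → l ≤ k)) ∨
      (¬ (∃ l < n, zWalk z l ≤ zWalk z (n + 1)) ∧ 0 = k)} := by
    ext z
    simp only [Set.mem_preimage, Set.mem_singleton_iff, Set.mem_ofPred_eq]
    by_cases hz : ∃ l < n, zWalk z l ≤ zWalk z (n + 1)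
    · simp only [hz, true_and, not_true_eq_false, false_and, or_false]
      constructor
      · rintro rfl
        exact ⟨(eps_isGreatest hz).1, fun l hl => (eps_isGreatest hz).2 hl⟩
      · rintro ⟨h1, h2⟩
        exact eps_eq_of_isGreatest ⟨h1, h2⟩
    · have : eps z n = 0 := by
        have he : {l : ℤ | l < n ∧ zWalk z l ≤ zWalk z (n + 1)} = ∅ :=
          Set.eq_empty_iff_forall_notMem.2 fun l hl => hz ⟨l, hl.1, hl.2⟩
        rw [eps, he, Int.csSup_empty]
      simp [hz, this]
  rw [h]
  exact Measurable.setOf (by fun_prop)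

theorem measurable_apply_of_countable {Ω S : Type*} [MeasurableSpace Ω] [MeasurableSpace S]
    {f : Ω → ℤ} (hf : Measurable f) {g : Ω → ℤ → S} (hg : Measurable g) :
    Measurable fun ω => g ω (f ω) := by
  have h : Measurable fun p : Ω × ℤ => g p.1 p.2 :=
    measurable_from_prod_countable_left fun k => (measurable_pi_apply k).comp hg
  exact h.comp (measurable_id.prodMk hf)

theorem measurableSet_shiftSet : MeasurableSet (shiftSet m) := by
  have h : shiftSet m = {x | ∀ l n, Matched (pattern x) l n → typ (x l) = typ (x n)} := by
    ext x; exact mem_shiftSet_iff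
  have h1 (i : ℤ) : Measurable fun x : ℤ → Letter m => typ (x i) :=
    (Measurable.of_discrete (f := typ)).comp (measurable_pi_apply i)
  have h2 (l n : ℤ) : Measurable fun x : ℤ → Letter m => typ (x l) = typ (x n) :=
    (Measurable.of_discrete (f := fun p : Fin m × Fin m => p.1 = p.2)).comp
      ((h1 l).prodMk (h1 n))
  rw [h]
  exact Measurable.setOf (by fun_prop)

instance : StandardBorelSpace (X m) := measurableSet_shiftSet.standardBorel

/-! ### Operations on points, on holonomies and on invariant measures -/

theorem DoubleTail.symm {x y : X m} (h : DoubleTail x y) : DoubleTail y x := by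
  obtain ⟨n, hn⟩ := h; exact ⟨n, fun k hk => (hn k hk).symm⟩

theorem DoubleTail.LU {x y : X m} (h : DoubleTail x y) (hx : LU (pattern x.1)) :
    LU (pattern y.1) := by
  obtain ⟨n, hn⟩ := h
  exact hx.congr (n := -n) fun i hi => by
    simp only [pattern]; rw [hn i (by rw [abs_of_neg (by omega)]; omega)]

theorem DoubleTail.RU {x y : X m} (h : DoubleTail x y) (hx : RU (pattern x.1)) :
    RU (pattern y.1) := by
  obtain ⟨n, hn⟩ := h
  exact hx.congr (n := n) fun i hi => by
    simp only [pattern]; rw [hn i (by rw [abs_of_pos (by omega)]; omega)]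

variable {μ : Measure (X m)}

theorem IsInvariantProbability.measure_image (hμ : IsInvariantProbability μ) {A : Set (X m)}
    (hA : MeasurableSet A) {Φ : (ℤ → Letter m) → (ℤ → Letter m)} (hΦ : Measurable Φ)
    (maps : ∀ x ∈ A, Φ x.1 ∈ shiftSet m) (inj : ∀ x ∈ A, ∀ y ∈ A, Φ x.1 = Φ y.1 → x = y)
    (tail : ∀ x ∈ A, ∃ n : ℕ, ∀ k : ℤ, (n : ℤ) < |k| → Φ x.1 k = x.1 k) :
    μ {y | ∃ x ∈ A, y.1 = Φ x.1} = μ A := by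
  let g : A → X m := fun x => ⟨Φ x.1.1, maps x.1 x.2⟩
  have hg : IsHolonomy A g := by
    refine ⟨hA, (hΦ.comp (measurable_subtype_coe.comp measurable_subtype_coe)).subtype_mk,
      fun x y h => Subtype.ext (inj x x.2 y y.2 (congrArg Subtype.val h)), fun x => ?_⟩
    obtain ⟨n, hn⟩ := tail x x.2
    exact ⟨n, fun k hk => (hn k hk).symm⟩
  rw [← hμ.invariant A g hg]
  congr 1
  ext y
  constructor
  · rintro ⟨x, hx, h⟩
    exact ⟨⟨x, hx⟩, Subtype.ext h.symm⟩
  · rintro ⟨x, rfl⟩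
    exact ⟨x, x.2, rfl⟩

/-- The usual way of applying invariance: the image of A has the measure of A and lies in A'.
Letting Φ act on all sequences separates the measurability of the map from the admissibility of its
values. -/
theorem IsInvariantProbability.measure_le (hμ : IsInvariantProbability μ) {A A' : Set (X m)}
    (hA : MeasurableSet A) {Φ : (ℤ → Letter m) → (ℤ → Letter m)} (hΦ : Measurable Φ)
    (maps : ∀ x ∈ A, ∃ h : Φ x.1 ∈ shiftSet m, (⟨Φ x.1, h⟩ : X m) ∈ A')
    (inj : ∀ x ∈ A, ∀ y ∈ A, Φ x.1 = Φ y.1 → x = y)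
    (tail : ∀ x ∈ A, ∃ n : ℕ, ∀ k : ℤ, (n : ℤ) < |k| → Φ x.1 k = x.1 k) : μ A ≤ μ A' := by
  rw [← hμ.measure_image hA hΦ (fun x hx => (maps x hx).1) inj tail]
  refine measure_mono ?_
  rintro y ⟨x, hx, h⟩
  obtain ⟨h1, h2⟩ := maps x hx
  rwa [show y = ⟨Φ x.1, h1⟩ from Subtype.ext h]

theorem IsInvariantProbability.measure_eq (hμ : IsInvariantProbability μ) {A A' : Set (X m)}
    (hA : MeasurableSet A) (hA' : MeasurableSet A') {Φ Ψ : (ℤ → Letter m) → (ℤ → Letter m)}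
    (hΦ : Measurable Φ) (hΨ : Measurable Ψ)
    (maps : ∀ x ∈ A, ∃ h : Φ x.1 ∈ shiftSet m, (⟨Φ x.1, h⟩ : X m) ∈ A')
    (maps' : ∀ x ∈ A', ∃ h : Ψ x.1 ∈ shiftSet m, (⟨Ψ x.1, h⟩ : X m) ∈ A)
    (left : ∀ x ∈ A, Ψ (Φ x.1) = x.1) (right : ∀ x ∈ A', Φ (Ψ x.1) = x.1)
    (tail : ∀ x ∈ A, ∃ n : ℕ, ∀ k : ℤ, (n : ℤ) < |k| → Φ x.1 k = x.1 k) : μ A = μ A' := by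
  refine le_antisymm (hμ.measure_le hA hΦ maps (fun x hx y hy h => ?_) tail)
    (hμ.measure_le hA' hΨ maps' (fun x hx y hy h => ?_) fun x hx => ?_)
  · exact Subtype.ext (by rw [← left x hx, h, left y hy])
  · exact Subtype.ext (by rw [← right x hx, h, right y hy])
  · obtain ⟨h1, h2⟩ := maps' x hx
    obtain ⟨n, hn⟩ := tail _ h2
    refine ⟨n, fun k hk => ?_⟩
    have := hn k hk
    rw [show Φ (⟨Ψ x.1, h1⟩ : X m).1 = x.1 from right x hx] at this
    exact this.symm

theorem IsInvariantProbability.map_equiv (hμ : IsInvariantProbability μ) (e : X m ≃ᵐ X m)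
    (he : ∀ x y, DoubleTail x y → DoubleTail (e.symm x) (e.symm y)) :
    IsInvariantProbability (μ.map e) := by
  have := hμ.isProbabilityMeasure
  refine ⟨Measure.isProbabilityMeasure_map e.measurable.aemeasurable, fun A g hg => ?_⟩
  rw [e.map_apply, e.map_apply]
  have hg' : IsHolonomy (e ⁻¹' A) fun x => e.symm (g ⟨e x.1, x.2⟩) := by
    refine ⟨e.measurable hg.measurableSet, ?_, fun x y h => ?_, fun x => ?_⟩
    · exact e.symm.measurable.comp (hg.measurable.comp
        ((e.measurable.comp measurable_subtype_coe).subtype_mk))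
    · have := congrArg Subtype.val (hg.injective (e.symm.injective h))
      exact Subtype.ext (e.injective this)
    · have := he _ _ (hg.doubleTail ⟨e x.1, x.2⟩)
      rwa [show e.symm (e x.1) = x.1 from e.symm_apply_apply _] at this
  rw [← hμ.invariant _ _ hg']
  congr 1
  ext y
  constructor
  · rintro ⟨x, hx⟩
    exact ⟨⟨e.symm x.1, by simp⟩, by simp [hx]⟩
  · rintro ⟨x, rfl⟩
    exact ⟨⟨e x.1, x.2⟩, by simp⟩

/-- A set is saturated if it is a union of classes of the double-tail relation. -/
def Saturated (A : Set (X m)) : Prop := ∀ x y, DoubleTail x y → x ∈ A → y ∈ A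

/-- A holonomy does not leave a saturated set, so the part of its range inside A is the range of its
restriction to A. -/
theorem IsInvariantProbability.cond (hμ : IsInvariantProbability μ) {A : Set (X m)}
    (hA : MeasurableSet A) (hs : Saturated A) (h0 : μ A ≠ 0) :
    IsInvariantProbability (ProbabilityTheory.cond μ A) := by
  have := hμ.isProbabilityMeasure
  refine ⟨ProbabilityTheory.cond_isProbabilityMeasure h0, fun E g hg => ?_⟩
  rw [ProbabilityTheory.cond_apply hA, ProbabilityTheory.cond_apply hA]
  congr 1
  have hg' : IsHolonomy (A ∩ E) fun x => g ⟨x.1, x.2.2⟩ :=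
    ⟨hA.inter hg.measurableSet, hg.measurable.comp measurable_subtype_coe.subtype_mk,
      fun x y h => Subtype.ext (Subtype.mk.inj (hg.injective h)),
      fun x => hg.doubleTail ⟨x.1, x.2.2⟩⟩
  rw [← hμ.invariant _ _ hg']
  congr 1
  ext y
  constructor
  · rintro ⟨hy, x, rfl⟩
    exact ⟨⟨x.1, hs _ _ (hg.doubleTail x).symm hy, x.2⟩, rfl⟩
  · rintro ⟨x, rfl⟩
    exact ⟨hs _ _ (hg.doubleTail ⟨x.1, x.2.2⟩) x.2.1, _, rfl⟩

/-- Conditioning on a saturated set of positive measure gives an invariant probability that still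
charges Y fully. By uniqueness it is μ, so the set had measure one. -/
theorem IsInvariantProbability.ergodic_of_unique (hμ : IsInvariantProbability μ) {Y : Set (X m)}
    (hY : MeasurableSet Y) (hμY : μ Y = 1)
    (huniq : ∀ ν : Measure (X m), IsInvariantProbability ν → ν Y = 1 → ν = μ) :
    IsErgodicInvariantProbability μ := by
  refine { hμ with ergodic := fun A hA hs => ?_ }
  have := hμ.isProbabilityMeasure
  by_contra! h
  have hν := hμ.cond hA hs h.1
  have h1 : ProbabilityTheory.cond μ A Y = 1 := by
    rw [ProbabilityTheory.cond_apply hA, measure_inter_conull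
      ((prob_compl_eq_zero_iff hY).2 hμY)]
    exact ENNReal.inv_mul_cancel h.1 (measure_ne_top _ _)
  have h2 : ProbabilityTheory.cond μ A A = 1 := by
    rw [ProbabilityTheory.cond_apply hA, Set.inter_self]
    exact ENNReal.inv_mul_cancel h.1 (measure_ne_top _ _)
  rw [huniq _ hν h1] at h2
  exact h.2 h2

/-! ### The shift and the time reversal -/

theorem pattern_swap (x : ℤ → Letter m) :
    pattern (fun i => (x (-1 - i)).swap) = mirror (pattern x) := by
  funext i; simp only [pattern, mirror]; cases x (-1 - i) <;> rfl

theorem typ_swap (a : Letter m) : typ a.swap = typ a := by cases a <;> rfl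

theorem swap_mem_shiftSet {x : ℤ → Letter m} (hx : x ∈ shiftSet m) :
    (fun i => (x (-1 - i)).swap) ∈ shiftSet m := by
  rw [mem_shiftSet_iff] at hx ⊢
  intro l n h
  rw [pattern_swap] at h
  have h' := h.mirror
  rw [mirror_mirror] at h'
  rw [typ_swap, typ_swap, hx _ _ h']

/-- The involution of `X` which reverses time and exchanges opening and closing brackets. -/
def rev : X m ≃ᵐ X m where
  toFun x := ⟨fun i => (x.1 (-1 - i)).swap, swap_mem_shiftSet x.2⟩
  invFun x := ⟨fun i => (x.1 (-1 - i)).swap, swap_mem_shiftSet x.2⟩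
  left_inv x := by ext i; simp
  right_inv x := by ext i; simp
  measurable_toFun := by
    refine Measurable.subtype_mk (measurable_pi_lambda _ fun i => ?_)
    exact (Measurable.of_discrete (f := Sum.swap)).comp
      ((measurable_pi_apply _).comp measurable_subtype_coe)
  measurable_invFun := by
    refine Measurable.subtype_mk (measurable_pi_lambda _ fun i => ?_)
    exact (Measurable.of_discrete (f := Sum.swap)).comp
      ((measurable_pi_apply _).comp measurable_subtype_coe)

theorem rev_apply (x : X m) (i : ℤ) : (rev x).1 i = (x.1 (-1 - i)).swap := rfl

theorem rev_rev (x : X m) : rev (rev x) = x := rev.symm_apply_apply x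

theorem pattern_rev (x : X m) : pattern (rev x).1 = mirror (pattern x.1) := pattern_swap x.1

theorem DoubleTail.rev {x y : X m} (h : DoubleTail x y) : DoubleTail (rev x) (rev y) := by
  obtain ⟨n, hn⟩ := h
  refine ⟨n + 1, fun k hk => ?_⟩
  rw [rev_apply, rev_apply, hn]
  push_cast at hk
  rcases abs_cases k with ⟨h, _⟩ | ⟨h, _⟩ <;> rcases abs_cases (-1 - k) with ⟨h', _⟩ | ⟨h', _⟩ <;>
    omega

theorem IsInvariantProbability.map_rev (hμ : IsInvariantProbability μ) :
    IsInvariantProbability (μ.map rev) :=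
  hμ.map_equiv rev fun _ _ h => h.rev

theorem map_rev_rev (μ : Measure (X m)) : (μ.map rev).map rev = μ := by
  rw [Measure.map_map rev.measurable rev.measurable]
  have : (rev ∘ rev : X m → X m) = id := funext rev_rev
  rw [this, Measure.map_id]

/-- The shift as an automorphism of the measurable space `X`. -/
def shiftEquiv : X m ≃ᵐ X m where
  toFun := T
  invFun x := ⟨fun i => x.1 (i - 1), fun r n => by
    have h := x.2 (r - 1) n
    simpa only [block, add_sub_right_comm r] using h⟩
  left_inv x := by ext i; simp [T]
  right_inv x := by ext i; simp [T]
  measurable_toFun := by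
    refine Measurable.subtype_mk (measurable_pi_lambda _ fun i => ?_)
    exact (measurable_pi_apply (i + 1)).comp measurable_subtype_coe
  measurable_invFun := by
    refine Measurable.subtype_mk (measurable_pi_lambda _ fun i => ?_)
    exact (measurable_pi_apply (i - 1)).comp measurable_subtype_coe

theorem coe_shiftEquiv : (shiftEquiv : X m → X m) = T := rfl

theorem IsInvariantProbability.map_shift (hμ : IsInvariantProbability μ) :
    IsInvariantProbability (μ.map T) := by
  rw [← coe_shiftEquiv]
  refine hμ.map_equiv shiftEquiv fun x y h => ?_
  obtain ⟨n, hn⟩ := h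
  refine ⟨n + 1, fun k hk => hn (k - 1) ?_⟩
  push_cast at hk
  rcases abs_cases k with ⟨h, _⟩ | ⟨h, _⟩ <;> rcases abs_cases (k - 1) with ⟨h', _⟩ | ⟨h', _⟩ <;>
    omega

theorem zWalk_shift (z : ℤ → Bool) (i : ℤ) :
    zWalk (fun i => z (i + 1)) i = zWalk z (i + 1) - zWalk z 1 := by
  have step : ∀ i, zWalk (fun i => z (i + 1)) (i + 1) - zWalk (fun i => z (i + 1)) i
      = zWalk z (i + 1 + 1) - zWalk z (i + 1) := by
    intro i
    rw [zWalk_succ, zWalk_succ z (i + 1)]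
    ring
  induction i using Int.induction_on with
  | zero => simp [zWalk_zero]
  | succ n ih => have := step n; omega
  | pred n ih =>
    have := step (-n - 1)
    rw [sub_add_cancel] at this ⊢
    omega

theorem LU_shift {z : ℤ → Bool} : LU (fun i => z (i + 1)) ↔ LU z := by
  constructor
  · intro h b n
    obtain ⟨i, hi, hi'⟩ := h (b - zWalk z 1) (n - 1)
    rw [zWalk_shift] at hi'
    exact ⟨i + 1, by omega, by omega⟩
  · intro h b n
    obtain ⟨i, hi, hi'⟩ := h (b + zWalk z 1) (n + 1)
    exact ⟨i - 1, by omega, by rw [zWalk_shift, sub_add_cancel]; omega⟩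

theorem RU_shift {z : ℤ → Bool} : RU (fun i => z (i + 1)) ↔ RU z := by
  constructor
  · intro h b n
    obtain ⟨i, hi, hi'⟩ := h (b - zWalk z 1) n
    rw [zWalk_shift] at hi'
    exact ⟨i + 1, by omega, by omega⟩
  · intro h b n
    obtain ⟨i, hi, hi'⟩ := h (b + zWalk z 1) (n + 1)
    exact ⟨i - 1, by omega, by rw [zWalk_shift, sub_add_cancel]; omega⟩

/-! ### The sets `B` -/

/-- The finite and the +∞ case of the lower limit need not be told apart: nonexistence uses only
that the walk is bounded below. -/
theorem liminf_atTop_ne_bot_iff {z : ℤ → Bool} :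
    liminf (fun i : ℤ => ((zWalk z i : ℝ) : EReal)) atTop ≠ ⊥ ↔ ¬ RU z := by
  constructor
  · intro h hz
    refine h (eq_bot_iff.2 (EReal.le_of_forall_lt_iff_le.1 fun c hc => ?_))
    refine liminf_le_of_frequently_le (frequently_atTop.2 fun n => ?_)
    obtain ⟨i, hi, hi'⟩ := hz ⌊c⌋ n
    exact ⟨i, hi.le, EReal.coe_le_coe_iff.2 ((Int.cast_le.2 hi'.le).trans (Int.floor_le c))⟩
  · rw [not_RU_iff]
    rintro ⟨b, hb⟩ h
    have : ((b : ℝ) : EReal) ≤ liminf (fun i : ℤ => ((zWalk z i : ℝ) : EReal)) atTop :=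
      le_liminf_of_le (h := (eventually_ge_atTop 0).mono fun i hi =>
        EReal.coe_le_coe_iff.2 (Int.cast_le.2 (hb i hi)))
    rw [h] at this
    exact absurd this (by simp)

theorem liminf_atBot_ne_bot_iff {z : ℤ → Bool} :
    liminf (fun i : ℤ => ((zWalk z i : ℝ) : EReal)) atBot ≠ ⊥ ↔ ¬ LU z := by
  constructor
  · intro h hz
    refine h (eq_bot_iff.2 (EReal.le_of_forall_lt_iff_le.1 fun c hc => ?_))
    refine liminf_le_of_frequently_le (frequently_atBot.2 fun n => ?_)
    obtain ⟨i, hi, hi'⟩ := hz ⌊c⌋ n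
    exact ⟨i, hi.le, EReal.coe_le_coe_iff.2 ((Int.cast_le.2 hi'.le).trans (Int.floor_le c))⟩
  · rw [not_LU_iff]
    rintro ⟨b, hb⟩ h
    have : ((b : ℝ) : EReal) ≤ liminf (fun i : ℤ => ((zWalk z i : ℝ) : EReal)) atBot :=
      le_liminf_of_le (h := (eventually_le_atBot 0).mono fun i hi =>
        EReal.coe_le_coe_iff.2 (Int.cast_le.2 (hb i hi)))
    rw [h] at this
    exact absurd this (by simp)

end Dyck

namespace Dyck

/-! ### A criterion for invariance -/

/-- The sequences which agree with `x` on `[-N, N]`. -/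
def centralCylinder {S : Type*} (N : ℕ) (x : ℤ → S) : Set (ℤ → S) :=
  {y | ∀ k, |k| ≤ (N : ℤ) → y k = x k}

theorem measurableSet_centralCylinder {S : Type*} [MeasurableSpace S] [DiscreteMeasurableSpace S]
    (N : ℕ) (x : ℤ → S) : MeasurableSet (centralCylinder N x) := by
  have : centralCylinder N x = ⋂ k : ℤ, ⋂ _ : |k| ≤ (N : ℤ), (fun y => y k) ⁻¹' {x k} := by
    ext y; simp [centralCylinder]
  rw [this]
  exact .iInter fun k => .iInter fun _ => measurable_pi_apply k (.of_discrete)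

theorem centralCylinder_anti {S : Type*} {N N' : ℕ} (h : N ≤ N') (x : ℤ → S) :
    centralCylinder N' x ⊆ centralCylinder N x :=
  fun _ hy k hk => hy k (hk.trans (Int.ofNat_le.2 h))

/-- Outer regularity: take an open U around the image of f. For large N the cylinder around `f i`
lies in U and outweighs the one around `f' i`. One representative for each block on [-N, N] gives
disjoint cylinders inside U, and the matching cylinders cover the image of f'. Two maps on an index
set, instead of one map between sequences, let both directions come from the same statement; E need
not be measurable. -/
theorem measure_image_le_of_centralCylinder {S I : Type*} [Finite S] [MeasurableSpace S]
    [DiscreteMeasurableSpace S] {P P' : Measure (ℤ → S)} [IsFiniteMeasure P] {f f' : I → ℤ → S}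
    {E : Set I} {Z : Set (ℤ → S)} (hZ : P' Z = 0) {n : ℕ}
    (h₁ : ∀ i ∈ E, ∀ k, (n : ℤ) < |k| → f' i k = f i k)
    (h₂ : ∀ i ∈ E, ∀ j ∈ E, (∀ k, |k| ≤ (n : ℤ) → f i k = f j k) →
      ∀ k, |k| ≤ (n : ℤ) → f' i k = f' j k)
    (h₃ : ∀ i ∈ E, f' i ∈ Z ∨
      ∃ n₀, ∀ N ≥ n₀, P' (centralCylinder N (f' i)) ≤ P (centralCylinder N (f i))) :
    P' (f' '' E) ≤ P (f '' E) := by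
  classical
  let _ : TopologicalSpace S := ⊥
  have : DiscreteTopology S := ⟨rfl⟩
  have : Countable S := Finite.to_countable
  rw [Set.measure_eq_iInf_isOpen (f '' E) P]
  refine le_iInf₂ fun U hEU => le_iInf fun hU => ?_
  have hcyl : ∀ x ∈ U, ∃ N, centralCylinder N x ⊆ U := by
    intro x hx
    obtain ⟨J, u, hu, hJ⟩ := isOpen_pi_iff.1 hU x hx
    refine ⟨J.sup Int.natAbs, fun y hy => hJ fun k hk => ?_⟩
    rw [hy k (by rw [Int.abs_eq_natAbs]; exact_mod_cast Finset.le_sup (f := Int.natAbs) hk)]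
    exact (hu k hk).2
  -- The indices for which N is already large enough; their f'-images increase to all of `f' '' E`
  -- outside Z.
  let F : ℕ → Set I := fun N => {i | i ∈ E ∧ n ≤ N ∧ centralCylinder N (f i) ⊆ U ∧
    ∀ N' ≥ N, P' (centralCylinder N' (f' i)) ≤ P (centralCylinder N' (f i))}
  have hmono : Monotone fun N => f' '' F N := by
    intro N N' h
    refine Set.image_mono fun i hi => ⟨hi.1, hi.2.1.trans h,
      (centralCylinder_anti h _).trans hi.2.2.1, fun M hM => hi.2.2.2 M (h.trans hM)⟩
  have hsub : f' '' E ⊆ Z ∪ ⋃ N, f' '' F N := by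
    rintro _ ⟨i, hi, rfl⟩
    rcases h₃ i hi with h | ⟨n₀, h⟩
    · exact .inl h
    · obtain ⟨N, hN⟩ := hcyl _ (hEU ⟨i, hi, rfl⟩)
      refine .inr (Set.mem_iUnion.2 ⟨max n (max n₀ N), i, ⟨hi, le_max_left _ _,
        (centralCylinder_anti (by omega) _).trans hN, fun M hM => h M (by omega)⟩, rfl⟩)
  refine (measure_mono hsub).trans ((measure_union_le _ _).trans ?_)
  rw [hZ, zero_add, hmono.measure_iUnion]
  refine iSup_le fun N => ?_
  let ρ : I → (Finset.Icc (-N : ℤ) N → S) := fun i k => f i k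
  have hρ {i j : I} (h : ρ i = ρ j) {k : ℤ} (hk : |k| ≤ (N : ℤ)) : f i k = f j k :=
    congrFun h ⟨k, Finset.mem_Icc.2 (abs_le.1 hk)⟩
  have hex : ∀ v : ρ '' F N, ∃ i ∈ F N, ρ i = v := fun v => v.2
  choose r hr hr' using hex
  have h1 : f' '' F N ⊆ ⋃ v : ρ '' F N, centralCylinder N (f' (r v)) := by
    rintro _ ⟨i, hi, rfl⟩
    refine Set.mem_iUnion.2 ⟨⟨ρ i, i, hi, rfl⟩, fun k hk => ?_⟩
    set v : ρ '' F N := ⟨ρ i, i, hi, rfl⟩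
    rcases le_or_gt |k| (n : ℤ) with h | h
    · exact h₂ _ hi.1 _ (hr v).1 (fun k hk => (hρ (hr' v) (hk.trans
        (Int.ofNat_le.2 hi.2.1))).symm) k h
    · rw [h₁ _ hi.1 k h, h₁ _ (hr v).1 k h]
      exact (hρ (hr' v) hk).symm
  have h2 : ⋃ v : ρ '' F N, centralCylinder N (f (r v)) ⊆ U :=
    Set.iUnion_subset fun v => (hr v).2.2.1
  refine (measure_mono h1).trans ((measure_iUnion_le _).trans (le_trans ?_ (measure_mono h2)))
  rw [measure_iUnion ?_ fun v => measurableSet_centralCylinder _ _]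
  · exact ENNReal.tsum_le_tsum fun v => (hr v).2.2.2 N le_rfl
  · intro v w hvw
    refine Set.disjoint_left.2 fun y hy hy' => hvw (Subtype.ext ?_)
    rw [← hr' v, ← hr' w]
    funext k
    have hk := abs_le.2 (Finset.mem_Icc.1 k.2)
    exact (hy k hk).symm.trans (hy' k hk)

theorem ext_of_centralCylinder {S : Type*} [Finite S] [MeasurableSpace S]
    [DiscreteMeasurableSpace S] {P Q : Measure (ℤ → S)} [IsFiniteMeasure P] [IsFiniteMeasure Q]
    {Z : Set (ℤ → S)} (hP : P Z = 0) (hQ : Q Z = 0)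
    (h : ∀ x ∉ Z, ∀ N, P (centralCylinder N x) = Q (centralCylinder N x)) : P = Q := by
  refine Measure.ext fun E _ => ?_
  rw [← Set.image_id E]
  refine le_antisymm
    (measure_image_le_of_centralCylinder hP (n := 0) (fun _ _ _ _ => rfl)
      (fun _ _ _ _ h => h) fun x _ => ?_)
    (measure_image_le_of_centralCylinder hQ (n := 0) (fun _ _ _ _ => rfl)
      (fun _ _ _ _ h => h) fun x _ => ?_)
  · by_cases hx : x ∈ Z
    · exact .inl hx
    · exact .inr ⟨0, fun N _ => (h x hx N).le⟩
  · by_cases hx : x ∈ Z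
    · exact .inl hx
    · exact .inr ⟨0, fun N _ => (h x hx N).ge⟩

/-- A holonomy is, on countably many pieces, the replacement of one fixed central block by another.
On such a piece the cylinder comparison applies to g and to its inverse. -/
theorem measure_range_eq_of_centralCylinder {S Ω : Type*} [Finite S] [MeasurableSpace S]
    [DiscreteMeasurableSpace S] [MeasurableSpace Ω] [StandardBorelSpace Ω] {μ : Measure Ω}
    [IsFiniteMeasure μ] {c : Ω → ℤ → S} (hc : MeasurableEmbedding c) {A : Set Ω}
    (hA : MeasurableSet A) {g : A → Ω} (hg : Measurable g) (hinj : Function.Injective g)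
    {Z : Set Ω} (hZ : μ Z = 0)
    (htail : ∀ x : A, ∃ n : ℕ, ∀ k, (n : ℤ) < |k| → c (g x) k = c x k)
    (hwt : ∀ x : A, ((x : Ω) ∈ Z ∧ g x ∈ Z) ∨ ∃ n₀, ∀ N ≥ n₀,
      μ (c ⁻¹' centralCylinder N (c (g x))) = μ (c ⁻¹' centralCylinder N (c x))) :
    μ (Set.range g) = μ A := by
  have := hA.standardBorel
  have : Countable S := Finite.to_countable
  have hge : MeasurableEmbedding g := hg.measurableEmbedding hinj
  have hve : MeasurableEmbedding (Subtype.val : A → Ω) := .subtype_coe hA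
  -- A radius with a block on it. A piece is given by the blocks of g x and of x, with equal radii.
  let ι := Σ n : ℕ, (Finset.Icc (-n : ℤ) n → S)
  let s' : ι × ι → Set A := fun p => {x | ((∀ k, (p.1.1 : ℤ) < |k| → c (g x) k = c x k) ∧
    ∀ k : Finset.Icc (-p.1.1 : ℤ) p.1.1, c (g x) k = p.1.2 k) ∧
    ∀ k : Finset.Icc (-p.2.1 : ℤ) p.2.1, c x k = p.2.2 k}
  -- As an equality of measures on A, the claim can be checked on the members of a countable cover,
  -- which need not be disjoint.
  have key : μ.comap g = μ.comap (Subtype.val : A → Ω) := by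
    refine Measure.ext_of_iUnion_eq_univ (s := fun p : {p : ι × ι // p.1.1 = p.2.1} => s' p) ?_
      fun p => ?_
    · refine Set.eq_univ_of_forall fun x => ?_
      obtain ⟨n, hn⟩ := htail x
      exact Set.mem_iUnion.2 ⟨⟨(⟨n, fun k => c (g x) k⟩, ⟨n, fun k => c x k⟩), rfl⟩,
        ⟨hn, fun k => rfl⟩, fun k => rfl⟩
    · obtain ⟨⟨⟨n, u⟩, ⟨n', w⟩⟩, hp⟩ := p
      obtain rfl : n = n' := hp
      refine Measure.ext fun t ht => ?_
      have hm (k : ℤ) : Measurable fun x : A => c x k :=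
        (measurable_pi_apply k).comp (hc.measurable.comp measurable_subtype_coe)
      have hm' (k : ℤ) : Measurable fun x : A => c (g x) k :=
        (measurable_pi_apply k).comp (hc.measurable.comp hg)
      have e1 (k : ℤ) : Measurable fun x : A => c (g x) k = c x k :=
        (Measurable.of_discrete (f := fun q : S × S => q.1 = q.2)).comp ((hm' k).prodMk (hm k))
      have e2 (k : ℤ) (a : S) : Measurable fun x : A => c (g x) k = a :=
        (Measurable.of_discrete (f := fun q : S => q = a)).comp (hm' k)
      have e3 (k : ℤ) (a : S) : Measurable fun x : A => c x k = a :=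
        (Measurable.of_discrete (f := fun q : S => q = a)).comp (hm k)
      have hs : MeasurableSet (s' (⟨n, u⟩, ⟨n, w⟩)) := Measurable.setOf (by fun_prop)
      rw [Measure.restrict_apply ht, Measure.restrict_apply ht, hge.comap_apply, hve.comap_apply]
      generalize hE : t ∩ s' (⟨n, u⟩, ⟨n, w⟩) = E
      have hEs : ∀ x ∈ E, x ∈ s' (⟨n, u⟩, ⟨n, w⟩) := fun x hx => by rw [← hE] at hx; exact hx.2
      have hP (s : Set Ω) : μ.map c (c '' s) = μ s := by
        rw [hc.map_apply, hc.injective.preimage_image]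
      have hP' (s : Set (ℤ → S)) : μ.map c s = μ (c ⁻¹' s) := hc.map_apply μ s
      have : IsFiniteMeasure (μ.map c) := Measure.isFiniteMeasure_map μ c
      have hZ' : μ.map c (c '' Z) = 0 := by rw [hP, hZ]
      rw [← hP, ← hP (Subtype.val '' E), ← Set.image_comp, ← Set.image_comp]
      refine le_antisymm (measure_image_le_of_centralCylinder hZ' (n := n) ?_ ?_ ?_)
        (measure_image_le_of_centralCylinder hZ' (n := n) ?_ ?_ ?_)
      · exact fun x hx k hk => (hEs x hx).1.1 k hk
      · intro x hx y hy _ k hk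
        have hk' : k ∈ Finset.Icc (-n : ℤ) n := Finset.mem_Icc.2 (abs_le.1 hk)
        exact ((hEs x hx).1.2 ⟨k, hk'⟩).trans ((hEs y hy).1.2 ⟨k, hk'⟩).symm
      · intro x hx
        rcases hwt x with h | ⟨n₀, h⟩
        · exact .inl ⟨_, h.2, rfl⟩
        · exact .inr ⟨n₀, fun N hN => by rw [hP', hP']; exact (h N hN).le⟩
      · exact fun x hx k hk => ((hEs x hx).1.1 k hk).symm
      · intro x hx y hy _ k hk
        have hk' : k ∈ Finset.Icc (-n : ℤ) n := Finset.mem_Icc.2 (abs_le.1 hk)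
        exact ((hEs x hx).2 ⟨k, hk'⟩).trans ((hEs y hy).2 ⟨k, hk'⟩).symm
      · intro x hx
        rcases hwt x with h | ⟨n₀, h⟩
        · exact .inl ⟨_, h.1, rfl⟩
        · exact .inr ⟨n₀, fun N hN => by rw [hP', hP']; exact (h N hN).ge⟩
  have := congrArg (fun ν => ν Set.univ) key
  simp only [hge.comap_apply, hve.comap_apply, Set.image_univ, Subtype.range_coe] at this
  exact this

end Dyck

namespace Dyck

variable {m : ℕ} {μ : Measure (X m)}

/-! ### Walks which attain their minimum -/

/-- The walk attains its minimum at `i`. -/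
def IsMin (z : ℤ → Bool) (i : ℤ) : Prop := ∀ k, zWalk z i ≤ zWalk z k

/-- The walk attains its minimum at `i` for the first time. -/
def FirstMin (z : ℤ → Bool) (i : ℤ) : Prop := IsMin z i ∧ ∀ k < i, zWalk z i < zWalk z k

/-- The walk attains its minimum at `i` for the last time. -/
def LastMin (z : ℤ → Bool) (i : ℤ) : Prop := IsMin z i ∧ ∀ k > i, zWalk z i < zWalk z k

/-- The walk attains its minimum at `i` and at `j`, but not in between. -/
def NextMin (z : ℤ → Bool) (i j : ℤ) : Prop :=
  i < j ∧ IsMin z i ∧ IsMin z j ∧ ∀ k, i < k → k < j → zWalk z i < zWalk z k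

@[fun_prop]
theorem measurable_isMin (i : ℤ) : Measurable fun z => IsMin z i := by unfold IsMin; fun_prop

@[fun_prop]
theorem measurable_firstMin (i : ℤ) : Measurable fun z => FirstMin z i := by
  unfold FirstMin; fun_prop

@[fun_prop]
theorem measurable_lastMin (i : ℤ) : Measurable fun z => LastMin z i := by
  unfold LastMin; fun_prop

@[fun_prop]
theorem measurable_nextMin (i j : ℤ) : Measurable fun z => NextMin z i j := by
  unfold NextMin; fun_prop

theorem exists_isMin {z : ℤ → Bool} (h : ¬ LU z) (h' : ¬ RU z) : ∃ i, IsMin z i := by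
  obtain ⟨b, hb⟩ := not_LU_iff.1 h
  obtain ⟨c, hc⟩ := not_RU_iff.1 h'
  obtain ⟨v, ⟨i, hi⟩, hv⟩ := Int.exists_least_of_bdd (P := fun v => ∃ i, zWalk z i = v)
    ⟨min b c, by
      rintro _ ⟨i, rfl⟩
      rcases le_total i 0 with h | h
      · exact (min_le_left _ _).trans (hb i h)
      · exact (min_le_right _ _).trans (hc i h)⟩ ⟨_, 0, rfl⟩
  exact ⟨i, fun k => hi ▸ hv _ ⟨k, rfl⟩⟩

theorem FirstMin.unique {z : ℤ → Bool} {i j : ℤ} (h : FirstMin z i) (h' : FirstMin z j) :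
    i = j := by
  by_contra hne
  rcases lt_or_gt_of_ne hne with hlt | hlt
  · have := h'.2 i hlt; have := h.1 j; omega
  · have := h.2 j hlt; have := h'.1 i; omega

theorem LastMin.unique {z : ℤ → Bool} {i j : ℤ} (h : LastMin z i) (h' : LastMin z j) :
    i = j := by
  by_contra hne
  rcases lt_or_gt_of_ne hne with hlt | hlt
  · have := h.2 j hlt; have := h'.1 i; omega
  · have := h'.2 i hlt; have := h.1 j; omega

/-- Every minimum except the last begins a pair of consecutive minima, so finitely many such pairs
mean finitely many minima. -/
theorem exists_firstMin_lastMin {z : ℤ → Bool} (h : ∃ i, IsMin z i)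
    (hfin : {p : ℤ × ℤ | NextMin z p.1 p.2}.Finite) :
    ∃ i j, i ≤ j ∧ FirstMin z i ∧ LastMin z j := by
  have hS : {i | IsMin z i}.Finite := by
    refine ((hfin.image Prod.fst).union (s := _) (t := {i | LastMin z i})
      (Set.Subsingleton.finite fun i hi j hj => LastMin.unique hi hj)).subset fun i hi => ?_
    have hi : IsMin z i := hi
    by_cases hl : LastMin z i
    · exact .inr hl
    · refine .inl ?_
      have hex : ∃ k > i, IsMin z k := by
        by_contra! hcon
        refine hl ⟨hi, fun k hk => lt_of_le_of_ne (hi k) fun he => hcon k hk fun j => ?_⟩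
        rw [← he]; exact hi j
      obtain ⟨j, ⟨hj, hj'⟩, hmin⟩ := Int.exists_least_of_bdd
        (P := fun k => i < k ∧ IsMin z k) ⟨i, fun k hk => hk.1.le⟩ hex
      refine ⟨(i, j), ⟨hj, hi, hj', fun k hk hk' => lt_of_le_of_ne (hi k) fun he => ?_⟩, rfl⟩
      have := hmin k ⟨hk, fun n => by rw [← he]; exact hi n⟩
      omega
  obtain ⟨i, hi, hi'⟩ := hS.exists_minimal h
  obtain ⟨j, hj, hj'⟩ := hS.exists_maximal h
  have hi : IsMin z i := hi
  have hj : IsMin z j := hj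
  refine ⟨i, j, ?_, ⟨hi, fun k hk => lt_of_le_of_ne (hi k) fun he => ?_⟩,
    ⟨hj, fun k hk => lt_of_le_of_ne (hj k) fun he => ?_⟩⟩
  · rcases le_total i j with h | h
    · exact h
    · exact hi' hj h
  · have := hi' (show IsMin z k from fun n => by rw [← he]; exact hi n) hk.le
    omega
  · have := hj' (show IsMin z k from fun n => by rw [← he]; exact hj n) hk.le
    omega

/-! ### Bracket flips that move the minima -/

open Classical in
/-- Exchange opening and closing brackets at the positions in `s`, keeping the types. -/
def flipAt (s : Set ℤ) (x : ℤ → Letter m) : ℤ → Letter m := fun k =>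
  if k ∈ s then (x k).swap else x k

theorem measurable_flipAt (s : Set ℤ) : Measurable (flipAt s : (ℤ → Letter m) → _) := by
  refine measurable_pi_lambda _ fun k => ?_
  by_cases h : k ∈ s
  · simp only [flipAt, h, if_true]
    exact (Measurable.of_discrete (f := Sum.swap)).comp (measurable_pi_apply k)
  · simp only [flipAt, h, if_false]
    exact measurable_pi_apply k

theorem flipAt_flipAt (s : Set ℤ) (x : ℤ → Letter m) : flipAt s (flipAt s x) = x := by
  funext k; by_cases h : k ∈ s <;> simp [flipAt, h]

theorem flipAt_of_notMem {s : Set ℤ} {k : ℤ} (h : k ∉ s) (x : ℤ → Letter m) :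
    flipAt s x k = x k := by simp [flipAt, h]

theorem typ_flipAt (s : Set ℤ) (x : ℤ → Letter m) (k : ℤ) : typ (flipAt s x k) = typ (x k) := by
  by_cases h : k ∈ s <;> simp [flipAt, h, typ_swap]

theorem pattern_flipAt_of_mem {s : Set ℤ} {k : ℤ} (h : k ∈ s) (x : ℤ → Letter m) :
    pattern (flipAt s x) k = !pattern x k := by
  simp only [pattern, flipAt, h, if_true]; cases x k <;> rfl

theorem pattern_flipAt_of_notMem {s : Set ℤ} {k : ℤ} (h : k ∉ s) (x : ℤ → Letter m) :
    pattern (flipAt s x) k = pattern x k := by simp [pattern, flipAt, h]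

theorem flipAt_tail {s : Set ℤ} (hs : s.Finite) (x : ℤ → Letter m) :
    ∃ n : ℕ, ∀ k : ℤ, (n : ℤ) < |k| → flipAt s x k = x k := by
  obtain ⟨b, hb⟩ := (hs.image fun k => |k|).bddAbove
  refine ⟨b.toNat, fun k hk => flipAt_of_notMem (fun h => ?_) x⟩
  have := hb ⟨k, h, rfl⟩
  simp only at this
  omega

/-- A change of pattern that keeps the types is admissible if no new pair is created. -/
theorem flipAt_mem_shiftSet {s : Set ℤ} {x : ℤ → Letter m} (hx : x ∈ shiftSet m)
    (h : ∀ l n, Matched (pattern (flipAt s x)) l n → ∀ k, l ≤ k → k ≤ n → k ∉ s) :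
    flipAt s x ∈ shiftSet m := by
  rw [mem_shiftSet_iff] at hx ⊢
  intro l n hln
  rw [typ_flipAt, typ_flipAt]
  exact hx l n (hln.congr fun k hk hk' => pattern_flipAt_of_notMem (h l n hln k hk hk') x)

theorem zWalk_flip_single {z z' : ℤ → Bool} {n : ℤ} (h : ∀ k, k ≠ n → z' k = z k)
    (hn : z' n = !z n) : ∃ c, (∀ k ≤ n, zWalk z' k = zWalk z k + c) ∧
      ∀ k > n, zWalk z' k = zWalk z k + c + if z n then -2 else 2 := by
  refine ⟨zWalk z' n - zWalk z n, fun k hk => ?_, fun k hk => ?_⟩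
  · have := zWalk_sub_congr (z := z') (z' := z) hk fun i _ hi => h i (by omega)
    omega
  · have := zWalk_sub_congr (z := z') (z' := z) (a := n + 1) (b := k) (by omega)
      fun i hi _ => h i (by omega)
    rw [zWalk_succ, zWalk_succ z, hn] at this
    cases hz : z n <;> simp [hz] at this ⊢ <;> omega

/-- The step at n descends to the first minimum. Making it ascend lifts everything to its right by
two, so that n is the last minimum; then no matched pair spans n and no constraint on types arises.
-/
theorem FirstMin.flip {x : X m} {n : ℤ} (h : FirstMin (pattern x.1) (n + 1)) :
    ∃ _ : flipAt {n} x.1 ∈ shiftSet m, LastMin (pattern (flipAt {n} x.1)) n := by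
  have hzn : pattern x.1 n = false := by
    cases hz : pattern x.1 n
    · rfl
    · have := h.2 n (by omega); have := zWalk_succ_true hz; omega
  have hW := zWalk_succ_false hzn
  obtain ⟨c, h1, h2⟩ := zWalk_flip_single (z := pattern x.1) (z' := pattern (flipAt {n} x.1))
    (n := n) (fun k hk => pattern_flipAt_of_notMem (by simpa using hk) _)
    (pattern_flipAt_of_mem rfl _)
  simp only [hzn, Bool.false_eq_true, if_false] at h2
  have hn := h1 n le_rfl
  have hlow : ∀ k ≤ n, zWalk (pattern (flipAt {n} x.1)) n ≤ zWalk (pattern (flipAt {n} x.1)) k := by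
    intro k hk; have := h1 k hk; have := h.2 k (by omega); omega
  have hhigh : ∀ k > n, zWalk (pattern (flipAt {n} x.1)) n < zWalk (pattern (flipAt {n} x.1)) k := by
    intro k hk; have := h2 k hk; have := h.1 k; omega
  refine ⟨flipAt_mem_shiftSet x.2 fun l q hlq k hk hk' hks => ?_, fun k => ?_, hhigh⟩
  · obtain rfl : k = n := hks
    rcases hk.lt_or_eq with hlt | rfl
    · have := hlq.2.2 k hlt hk'; have := hlow l hk; omega
    · have := hhigh (q + 1) (by omega); have := hlq.2.1; omega
  · rcases le_or_gt k n with hk | hk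
    · exact hlow k hk
    · exact (hhigh k hk).le

theorem LastMin.flip {x : X m} {n : ℤ} (h : LastMin (pattern x.1) n) :
    ∃ _ : flipAt {n} x.1 ∈ shiftSet m, FirstMin (pattern (flipAt {n} x.1)) (n + 1) := by
  have hzn : pattern x.1 n = true := by
    cases hz : pattern x.1 n
    · have := h.2 (n + 1) (by omega); have := zWalk_succ_false hz; omega
    · rfl
  have hW := zWalk_succ_true hzn
  obtain ⟨c, h1, h2⟩ := zWalk_flip_single (z := pattern x.1) (z' := pattern (flipAt {n} x.1))
    (n := n) (fun k hk => pattern_flipAt_of_notMem (by simpa using hk) _)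
    (pattern_flipAt_of_mem rfl _)
  simp only [hzn, if_true] at h2
  have hn := h2 (n + 1) (by omega)
  have hlow : ∀ k ≤ n,
      zWalk (pattern (flipAt {n} x.1)) (n + 1) < zWalk (pattern (flipAt {n} x.1)) k := by
    intro k hk; have := h1 k hk; have := h.1 k; omega
  have hhigh : ∀ k > n,
      zWalk (pattern (flipAt {n} x.1)) (n + 1) ≤ zWalk (pattern (flipAt {n} x.1)) k := by
    intro k hk; have := h2 k hk; have := h.2 k hk; omega
  refine ⟨flipAt_mem_shiftSet x.2 fun l q hlq k hk hk' hks => ?_, fun k => ?_,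
    fun k hk => hlow k (by omega)⟩
  · obtain rfl : k = n := hks
    rcases hk'.lt_or_eq with hlt | rfl
    · have := hlq.2.2 (k + 1) (by omega) (by omega); have := hlow l hk; omega
    · have := hlow l hk; have := hlq.2.1; omega
  · rcases le_or_gt k n with hk | hk
    · exact (hlow k hk).le
    · exact hhigh k hk

/-- Flipping the first and last step of an excursion between consecutive minima pushes its interior
two units down. The new first and last minima then reveal i and j, and this makes the images for
different pairs disjoint. -/
theorem NextMin.flip {x : X m} {i j : ℤ} (h : NextMin (pattern x.1) i j) :
    ∃ _ : flipAt {i, j - 1} x.1 ∈ shiftSet m,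
      FirstMin (pattern (flipAt {i, j - 1} x.1)) (i + 1) ∧
      LastMin (pattern (flipAt {i, j - 1} x.1)) (j - 1) := by
  obtain ⟨hij, hi, hj, hbet⟩ := h
  have hijW : zWalk (pattern x.1) j = zWalk (pattern x.1) i := le_antisymm (hj i) (hi j)
  have hzi : pattern x.1 i = true := by
    cases hz : pattern x.1 i
    · have := hi (i + 1); have := zWalk_succ_false hz; omega
    · rfl
  have hzj : pattern x.1 (j - 1) = false := by
    cases hz : pattern x.1 (j - 1)
    · rfl
    · have := hj (j - 1); have := zWalk_succ_true hz; rw [sub_add_cancel] at this; omega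
  have hne : i < j - 1 := by
    rcases (show i ≤ j - 1 by omega).lt_or_eq with h | h
    · exact h
    · rw [← h, hzi] at hzj; cases hzj
  have hWi := zWalk_succ_true hzi
  have hWj := zWalk_succ_false hzj
  rw [sub_add_cancel] at hWj
  obtain ⟨z', hz'⟩ : ∃ z', z' = pattern (flipAt {i, j - 1} x.1) := ⟨_, rfl⟩
  have ho : ∀ k, k ≠ i → k ≠ j - 1 → pattern x.1 k = z' k := fun k hk hk' => by
    rw [hz', pattern_flipAt_of_notMem (by simp [hk, hk'])]
  have hzi' : z' i = false := by rw [hz', pattern_flipAt_of_mem (by simp), hzi]; rfl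
  have hzj' : z' (j - 1) = true := by rw [hz', pattern_flipAt_of_mem (by simp), hzj]; rfl
  have hWi' := zWalk_succ_false hzi'
  have hWj' := zWalk_succ_true hzj'
  rw [sub_add_cancel] at hWj'
  have a1 : ∀ k ≤ i, zWalk z' k - zWalk z' i = zWalk (pattern x.1) k - zWalk (pattern x.1) i := by
    intro k hk
    have := zWalk_sub_congr (z := pattern x.1) (z' := z') hk fun n _ hn => ho n (by omega) (by omega)
    omega
  have a2 : ∀ k > i, k ≤ j - 1 →
      zWalk z' k - zWalk z' i = zWalk (pattern x.1) k - zWalk (pattern x.1) i - 2 := by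
    intro k hk hk'
    have := zWalk_sub_congr (z := pattern x.1) (z' := z') (a := i + 1) (b := k) (by omega)
      fun n hn hn' => ho n (by omega) (by omega)
    omega
  have a3 : ∀ k ≥ j, zWalk z' k - zWalk z' i = zWalk (pattern x.1) k - zWalk (pattern x.1) i := by
    intro k hk
    have := zWalk_sub_congr (z := pattern x.1) (z' := z') hk fun n hn _ => ho n (by omega) (by omega)
    have := a2 (j - 1) (by omega) le_rfl
    omega
  have b1 : ∀ k ≤ i, zWalk z' (i + 1) < zWalk z' k := fun k hk => by
    have := a1 k hk; have := hi k; omega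
  have b2 : ∀ k > i, k ≤ j - 1 → zWalk z' (i + 1) ≤ zWalk z' k := fun k hk hk' => by
    have := a2 k hk hk'; have := hbet k hk (by omega); omega
  have b3 : ∀ k ≥ j, zWalk z' (i + 1) < zWalk z' k := fun k hk => by
    have := a3 k hk; have := hi k; omega
  have b0 : ∀ k, zWalk z' (i + 1) ≤ zWalk z' k := fun k => by
    rcases le_or_gt k i with h | h
    · exact (b1 k h).le
    rcases le_or_gt k (j - 1) with h' | h'
    · exact b2 k h h'
    · exact (b3 k (by omega)).le
  have bj : zWalk z' (j - 1) = zWalk z' (i + 1) := by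
    have := a2 (j - 1) (by omega) le_rfl; omega
  refine ⟨flipAt_mem_shiftSet x.2 fun l q hlq k hk hk' hks => ?_, ?_⟩
  · rw [← hz'] at hlq
    have e := hlq.2.1
    rcases hks with rfl | hks
    · rcases hk'.lt_or_eq with hlt | rfl
      · have := hlq.2.2 (k + 1) (by omega) (by omega); have := b0 l; omega
      · have := b1 l hk; omega
    · obtain rfl : k = j - 1 := hks
      rcases hk.lt_or_eq with hlt | rfl
      · have := hlq.2.2 (j - 1) hlt hk'; have := b0 l; omega
      · have := b3 (q + 1) (by omega); omega
  · rw [← hz']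
    refine ⟨⟨b0, fun k hk => b1 k (by omega)⟩, fun k => bj ▸ b0 k, fun k hk => ?_⟩
    rw [bj]
    exact b3 k (by omega)

/-! ### No invariant probability has its walk bounded below on both sides -/

theorem measure_firstMin_eq (hμ : IsInvariantProbability μ) (n : ℤ) :
    μ {x | FirstMin (pattern x.1) (n + 1)} = μ {x | LastMin (pattern x.1) n} :=
  hμ.measure_eq (Measurable.setOf (by fun_prop)) (Measurable.setOf (by fun_prop))
    (measurable_flipAt {n}) (measurable_flipAt {n})
    (fun _ hx => FirstMin.flip hx) (fun _ hx => LastMin.flip hx)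
    (fun _ _ => flipAt_flipAt _ _) (fun _ _ => flipAt_flipAt _ _)
    fun _ _ => flipAt_tail (Set.finite_singleton n) _

/-- The flips embed the events for different pairs into disjoint events, so their measures sum to at
most one and Borel–Cantelli applies. -/
theorem ae_finite_nextMin (hμ : IsInvariantProbability μ) :
    ∀ᵐ x ∂μ, {p : ℤ × ℤ | NextMin (pattern x.1) p.1 p.2}.Finite := by
  have := hμ.isProbabilityMeasure
  let D : ℤ × ℤ → Set (X m) := fun p =>
    {x | FirstMin (pattern x.1) (p.1 + 1) ∧ LastMin (pattern x.1) (p.2 - 1)}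
  have hD : Pairwise (Function.onFun Disjoint D) := by
    refine fun p q hpq => Set.disjoint_left.2 fun x hx hx' => hpq ?_
    have h1 := FirstMin.unique hx.1 hx'.1
    have h2 := LastMin.unique hx.2 hx'.2
    exact Prod.ext (by omega) (by omega)
  refine ae_finite_setOfPred_mem (s := fun p : ℤ × ℤ => {x : X m | NextMin (pattern x.1) p.1 p.2})
    (ne_top_of_le_ne_top ENNReal.one_ne_top ?_)
  calc ∑' p : ℤ × ℤ, μ {x : X m | NextMin (pattern x.1) p.1 p.2}
      ≤ ∑' p, μ (D p) := by
        refine ENNReal.tsum_le_tsum fun p => ?_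
        refine hμ.measure_le (Measurable.setOf (by fun_prop))
          (measurable_flipAt {p.1, p.2 - 1}) (fun x hx => NextMin.flip hx)
          (fun x _ y _ h => Subtype.ext ?_)
          fun x _ => flipAt_tail (Set.toFinite _) _
        rw [← flipAt_flipAt {p.1, p.2 - 1} x.1, h, flipAt_flipAt]
    _ = μ (⋃ p, D p) := (measure_iUnion hD fun p => Measurable.setOf (by fun_prop)).symm
    _ ≤ 1 := prob_le_one

/-- With f and l the places of the first and last minimum, P(f ≤ n + 1) = P(l ≤ n) ≤ P(f ≤ n),
because f ≤ l. Hence P(f = n + 1) = 0 for every n, although f exists almost surely. -/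
theorem not_invariant_of_bounded_below (hμ : IsInvariantProbability μ)
    (h : ∀ᵐ x ∂μ, ¬ LU (pattern x.1) ∧ ¬ RU (pattern x.1)) : False := by
  have := hμ.isProbabilityMeasure
  have hae : ∀ᵐ x ∂μ, ∃ i j, i ≤ j ∧ FirstMin (pattern x.1) i ∧ LastMin (pattern x.1) j := by
    filter_upwards [h, ae_finite_nextMin hμ] with x hx hx'
    exact exists_firstMin_lastMin (exists_isMin hx.1 hx.2) hx'
  let f : ℤ → Set (X m) := fun n => {x | FirstMin (pattern x.1) n}
  let l : ℤ → Set (X m) := fun n => {x | LastMin (pattern x.1) n}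
  have hf (n) : MeasurableSet (f n) := Measurable.setOf (by fun_prop)
  have hl (n) : MeasurableSet (l n) := Measurable.setOf (by fun_prop)
  have key : ∀ n, μ (⋃ k : ℕ, f (n + 1 - k)) = μ (⋃ k : ℕ, l (n - k)) := by
    intro n
    rw [measure_iUnion _ fun k => hf _, measure_iUnion _ fun k => hl _]
    · refine tsum_congr fun k => ?_
      rw [show n + 1 - (k : ℤ) = n - k + 1 by ring]
      exact measure_firstMin_eq hμ _
    · refine fun j k hjk => Set.disjoint_left.2 fun x hx hx' => hjk ?_
      have := LastMin.unique hx hx'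
      omega
    · refine fun j k hjk => Set.disjoint_left.2 fun x hx hx' => hjk ?_
      have := FirstMin.unique hx hx'
      omega
  have hnull : ∀ n, μ (f n) = 0 := by
    intro n
    obtain ⟨n, rfl⟩ : ∃ k, n = k + 1 := ⟨n - 1, by ring⟩
    have h1 : μ (⋃ k : ℕ, l (n - k)) ≤ μ (⋃ k : ℕ, f (n - k)) := by
      refine measure_mono_ae ?_
      filter_upwards [hae] with x hx hx'
      obtain ⟨i, j, hij, hi, hj⟩ := hx
      obtain ⟨k, hk⟩ := Set.mem_iUnion.1 hx'
      have := LastMin.unique hj hk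
      exact Set.mem_iUnion.2 ⟨(n - i).toNat, by
        rw [show n - ((n - i).toNat : ℤ) = i by omega]; exact hi⟩
    have h2 : (⋃ k : ℕ, f (n + 1 - k)) = f (n + 1) ∪ ⋃ k : ℕ, f (n - k) := by
      ext x
      simp only [Set.mem_iUnion, Set.mem_union]
      constructor
      · rintro ⟨_ | k, hk⟩
        · exact .inl (by simpa using hk)
        · exact .inr ⟨k, by rwa [show n + 1 - ((k + 1 : ℕ) : ℤ) = n - k by push_cast; ring] at hk⟩
      · rintro (hk | ⟨k, hk⟩)
        · exact ⟨0, by simpa using hk⟩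
        · exact ⟨k + 1, by rwa [show n + 1 - ((k + 1 : ℕ) : ℤ) = n - k by push_cast; ring]⟩
    rw [← key, h2, measure_union _ (.iUnion fun k => hf _)] at h1
    · refine le_antisymm ?_ zero_le
      refine (ENNReal.add_le_add_iff_right (measure_ne_top μ (⋃ k : ℕ, f (n - k)))).1 ?_
      rwa [zero_add]
    · refine Set.disjoint_left.2 fun x hx hx' => ?_
      obtain ⟨k, hk⟩ := Set.mem_iUnion.1 hx'
      have := FirstMin.unique hx hk
      omega
  have hfalse : ∀ᵐ x ∂μ, False := by
    filter_upwards [hae, ae_all_iff.2 fun n => measure_eq_zero_iff_ae_notMem.1 (hnull n)]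
      with x hx hx'
    obtain ⟨i, j, hij, hi, hj⟩ := hx
    exact hx' i hi
  have := (ae_iff.1 hfalse)
  simp at this

end Dyck

namespace Dyck

/-! ### Symmetric product measures -/

theorem uniformOn_singleton_eq {S : Type*} [Finite S] [MeasurableSpace S]
    [DiscreteMeasurableSpace S] (a : S) :
    ProbabilityTheory.uniformOn (Set.univ : Set S) {a} = (Nat.card S : ENNReal)⁻¹ := by
  cases nonempty_fintype S
  rw [ProbabilityTheory.uniformOn_univ, Measure.count_singleton, Nat.card_eq_fintype_card, one_div]

theorem measurableSet_apply_eq {S : Type*} [MeasurableSpace S] [DiscreteMeasurableSpace S]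
    (k : ℤ) (a : S) : MeasurableSet {y : ℤ → S | y k = a} := by
  have : MeasurableSet ((fun y : ℤ → S => y k) ⁻¹' {a}) := measurable_pi_apply k .of_discrete
  exact this

theorem measurableSet_coords {S ι : Type*} [MeasurableSpace S] [DiscreteMeasurableSpace S]
    (s : Finset ι) (e : ι → ℤ) (w : ι → S) :
    MeasurableSet {y : ℤ → S | ∀ i ∈ s, y (e i) = w i} := by
  have h (i : ι) : MeasurableSet {y : ℤ → S | y (e i) = w i} := measurableSet_apply_eq _ _
  have : {y : ℤ → S | ∀ i ∈ s, y (e i) = w i} = ⋂ i ∈ s, {y : ℤ → S | y (e i) = w i} := by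
    ext y; simp
  rw [this]
  exact s.measurableSet_biInter fun i _ => h i

section Bernoulli

variable {S : Type} [Finite S] [Nonempty S] [MeasurableSpace S] [DiscreteMeasurableSpace S]

instance : IsProbabilityMeasure (ProbabilityTheory.uniformOn (Set.univ : Set S)) :=
  ProbabilityTheory.isProbabilityMeasure_uniformOn Set.finite_univ Set.univ_nonempty

instance : IsProbabilityMeasure (bernoulli S) :=
  inferInstanceAs (IsProbabilityMeasure (Measure.infinitePi _))

theorem bernoulli_coords {ι : Type*} (s : Finset ι) {e : ι → ℤ} (he : Set.InjOn e s)
    (w : ι → S) :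
    bernoulli S {y | ∀ i ∈ s, y (e i) = w i} = ((Nat.card S : ENNReal)⁻¹) ^ s.card := by
  classical
  rcases isEmpty_or_nonempty ι with hι | hι
  · obtain rfl : s = ∅ := Finset.eq_empty_of_isEmpty s
    simp
  have h : {y : ℤ → S | ∀ i ∈ s, y (e i) = w i}
      = (↑(s.image e) : Set ℤ).pi fun k => {w (Function.invFunOn e s k)} := by
    ext y
    simp only [Set.mem_ofPred_eq, Set.mem_pi, Finset.coe_image, Set.mem_image,
      forall_exists_index, and_imp, forall_apply_eq_imp_iff₂, Set.mem_singleton_iff]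
    refine forall₂_congr fun i hi => ?_
    rw [he.leftInvOn_invFunOn hi]
  rw [h, bernoulli, Measure.infinitePi_pi _ fun _ _ => .of_discrete]
  simp only [uniformOn_singleton_eq, Finset.prod_const, Finset.card_image_of_injOn he]

theorem eq_bernoulli {ν : Measure (ℤ → S)} [IsFiniteMeasure ν]
    (h : ∀ (s : Finset ℤ) (w : ℤ → S), ν {y | ∀ i ∈ s, y i = w i}
      = ((Nat.card S : ENNReal)⁻¹) ^ s.card) : ν = bernoulli S := by
  refine ext_of_centralCylinder (Z := ∅) measure_empty measure_empty fun x _ N => ?_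
  have : centralCylinder N x = {y | ∀ i ∈ Finset.Icc (-N : ℤ) N, y i = x i} := by
    ext y; simp only [centralCylinder, Set.mem_ofPred_eq, Finset.mem_Icc, abs_le]
  rw [this, h]
  exact (bernoulli_coords _ Function.injective_id.injOn x).symm

/-- The inequality for all pairs a, b makes the letters at k equally likely given any finite set of
other coordinates; cylinder measures follow one coordinate at a time. -/
theorem eq_bernoulli_of_exchange {ν : Measure (ℤ → S)} [IsProbabilityMeasure ν]
    (h : ∀ (s : Finset ℤ) (k : ℤ), k ∉ s → ∀ (w : ℤ → S) (a b : S),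
      ν ({y | ∀ i ∈ s, y i = w i} ∩ {y | y k = a}) ≤
        ν ({y | ∀ i ∈ s, y i = w i} ∩ {y | y k = b})) : ν = bernoulli S := by
  classical
  cases nonempty_fintype S
  refine eq_bernoulli fun s w => ?_
  induction s using Finset.induction_on with
  | empty => simp
  | insert k s hk ih =>
    have h := h s k hk w
    set C := {y : ℤ → S | ∀ i ∈ s, y i = w i} with hC
    have hCm : MeasurableSet C := measurableSet_coords s id w
    have hk' (a : S) : MeasurableSet {y : ℤ → S | y k = a} := measurableSet_apply_eq _ _
    have h1 : ν C = ∑ a : S, ν (C ∩ {y | y k = a}) := by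
      rw [← measure_biUnion_finset _ fun a _ => hCm.inter (hk' a)]
      · congr 1; ext y; simp
      · intro a _ b _ hab
        exact Set.disjoint_left.2 fun y hy hy' => hab (hy.2.symm.trans hy'.2)
    have h2 : ν C = Nat.card S * ν (C ∩ {y | y k = w k}) := by
      rw [h1, Finset.sum_congr rfl fun a _ => le_antisymm (h a (w k)) (h (w k) a)]
      simp [Nat.card_eq_fintype_card]
    have h3 : {y : ℤ → S | ∀ i ∈ insert k s, y i = w i} = C ∩ {y | y k = w k} := by
      ext y; simp [hC, and_comm]
    have hcard : (Nat.card S : ENNReal) ≠ 0 := by simp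
    rw [h3, Finset.card_insert_of_notMem hk, pow_succ, ← ih, h2, mul_right_comm,
      ENNReal.mul_inv_cancel hcard (ENNReal.natCast_ne_top _), one_mul]

theorem bernoulli_map_comp (σ : ℤ ≃ ℤ) :
    (bernoulli S).map (fun y : ℤ → S => y ∘ σ) = bernoulli S := by
  have hm : Measurable fun y : ℤ → S => y ∘ σ :=
    measurable_pi_lambda _ fun i => measurable_pi_apply _
  have := Measure.isProbabilityMeasure_map (μ := bernoulli S) hm.aemeasurable
  refine eq_bernoulli fun s w => ?_
  refine (Measure.map_apply hm (measurableSet_coords s id w)).trans ?_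
  exact bernoulli_coords s σ.injective.injOn w

end Bernoulli

/-! ### Points determined by their merged sequences -/

variable {m : ℕ}

/-- Forget the type of a closing bracket. -/
def merge : Letter m → Merged m
  | Sum.inl j => Sum.inl j
  | Sum.inr _ => Sum.inr ()

theorem gPlus_apply (x : X m) (i : ℤ) : gPlus x i = merge (x.1 i) := by
  cases h : x.1 i <;> simp [gPlus, merge, h]

/-- The positions of the opening brackets of a merged sequence. -/
def mergedPattern (y : ℤ → Merged m) : ℤ → Bool := fun i => (y i).isLeft

theorem mergedPattern_gPlus (x : X m) : mergedPattern (gPlus x) = pattern x.1 := by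
  funext i; simp only [mergedPattern, gPlus_apply, pattern]; cases x.1 i <;> rfl

theorem mergedPattern_congr {y y' : ℤ → Merged m} {i : ℤ} (h : y i = y' i) :
    mergedPattern y i = mergedPattern y' i := congrArg Sum.isLeft h

@[fun_prop]
theorem measurable_mergedPattern : Measurable (mergedPattern : (ℤ → Merged m) → ℤ → Bool) :=
  measurable_pi_lambda _ fun i =>
    (Measurable.of_discrete (f := fun a : Merged m => a.isLeft)).comp (measurable_pi_apply i)

@[fun_prop]
theorem measurable_gPlus : Measurable (gPlus : X m → ℤ → Merged m) := by
  refine measurable_pi_lambda _ fun i => ?_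
  simp only [gPlus_apply]
  exact (Measurable.of_discrete (f := merge)).comp
    ((measurable_pi_apply i).comp measurable_subtype_coe)

variable [NeZero m]

/-- The type of an opening bracket of a merged sequence. -/
def mergedTyp : Merged m → Fin m
  | Sum.inl j => j
  -- In `lift` this value is reached only from a closing bracket without a partner, where any type
  -- is admissible.
  | Sum.inr _ => 0

/-- Give each closing bracket the type of the opening bracket which it matches. -/
def lift (y : ℤ → Merged m) : ℤ → Letter m := fun n =>
  if mergedPattern y n then α (mergedTyp (y n)) else β (mergedTyp (y (eps (mergedPattern y) n)))

theorem pattern_lift (y : ℤ → Merged m) : pattern (lift y) = mergedPattern y := by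
  funext n; simp only [pattern, lift]; cases h : mergedPattern y n <;> simp

theorem merge_lift (y : ℤ → Merged m) (n : ℤ) : merge (lift y n) = y n := by
  simp only [lift]
  cases h : y n <;> simp [mergedPattern, h, merge, mergedTyp]

theorem lift_mem_shiftSet (y : ℤ → Merged m) : lift y ∈ shiftSet m := by
  rw [mem_shiftSet_iff, pattern_lift]
  intro l n h
  simp [lift, h.left, h.right, h.eps_eq, typ]

/-- The point of `X` obtained by typing the closing brackets. -/
def liftX (y : ℤ → Merged m) : X m := ⟨lift y, lift_mem_shiftSet y⟩

theorem gPlus_liftX (y : ℤ → Merged m) : gPlus (liftX y) = y := by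
  funext n; rw [gPlus_apply]; exact merge_lift y n

theorem pattern_liftX (y : ℤ → Merged m) : pattern (liftX y).1 = mergedPattern y := pattern_lift y

theorem mergedTyp_merge {a : Letter m} (h : a.isLeft = true) : mergedTyp (merge a) = typ a := by
  cases a with
  | inl j => rfl
  | inr j => cases h

theorem liftX_gPlus {x : X m} (h : LU (pattern x.1)) : liftX (gPlus x) = x := by
  refine Subtype.ext (funext fun n => ?_)
  show lift (gPlus x) n = x.1 n
  simp only [lift, mergedPattern_gPlus, gPlus_apply]
  cases hn : pattern x.1 n
  · have hM := h.matched hn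
    rw [mergedTyp_merge hM.left]
    simp only [Bool.false_eq_true, if_false]
    rw [eq_β_of_isLeft hn, typ_eq_of_matched x.2 hM]
  · simp only [if_true]
    rw [mergedTyp_merge hn, ← eq_α_of_isLeft hn]

theorem measurable_lift : Measurable (lift : (ℤ → Merged m) → ℤ → Letter m) := by
  refine measurable_pi_lambda _ fun n => ?_
  have h1 : Measurable fun y : ℤ → Merged m => mergedPattern y n := by fun_prop
  have h2 : Measurable fun y : ℤ → Merged m => α (mergedTyp (y n)) :=
    (Measurable.of_discrete (f := fun a : Merged m => α (mergedTyp a))).comp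
      (measurable_pi_apply n)
  have h3 : Measurable fun y : ℤ → Merged m => β (mergedTyp (y (eps (mergedPattern y) n))) :=
    (Measurable.of_discrete (f := fun a : Merged m => β (mergedTyp a))).comp
      (measurable_apply_of_countable ((measurable_eps n).comp measurable_mergedPattern)
        measurable_id)
  exact Measurable.ite (h1 (.of_discrete (s := {true}))) h2 h3

theorem measurable_liftX : Measurable (liftX : (ℤ → Merged m) → X m) :=
  measurable_lift.subtype_mk

/-- If the walk is bounded below at `+∞`, changing a single letter of the merged sequence changes
only finitely many types. -/
theorem lift_tail {y y' : ℤ → Merged m} {k : ℤ} (h : ∀ i ≠ k, y i = y' i)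
    (hL : LU (mergedPattern y)) (hR : ¬ RU (mergedPattern y)) :
    ∃ n : ℕ, ∀ j : ℤ, (n : ℤ) < |j| → lift y' j = lift y j := by
  have hz : ∀ i ≠ k, mergedPattern y i = mergedPattern y' i :=
    fun i hi => mergedPattern_congr (h i hi)
  obtain ⟨b, hb⟩ := not_RU_iff.1 hR
  obtain ⟨c, hc⟩ := exists_bound_Icc (zWalk (mergedPattern y)) (k + 1) 0
  obtain ⟨v, ⟨i, hi, hi'⟩, hv⟩ := Int.exists_least_of_bdd
    (P := fun v => ∃ i, k < i ∧ zWalk (mergedPattern y) i = v)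
    ⟨min b c, by
      rintro _ ⟨i, hki, rfl⟩
      rcases le_total i 0 with h | h
      · exact (min_le_right _ _).trans (hc i (by omega) h)
      · exact (min_le_left _ _).trans (hb i h)⟩ ⟨_, k + 1, by omega, rfl⟩
  refine ⟨(max |k| |i|).toNat, fun j hj => ?_⟩
  have hj1 : |k| < |j| := by have := le_max_left |k| |i|; omega
  have hj2 : |i| < |j| := by have := le_max_right |k| |i|; omega
  have hjk : j ≠ k := by rintro rfl; omega
  simp only [lift]
  rw [← hz j hjk, ← h j hjk]
  cases hjz : mergedPattern y j
  swap
  · rfl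
  have hM := hL.matched hjz
  -- After k the walk is lowest at i, with height v. A pair that opens at or before k and closes
  -- after i would have to stay strictly above a height of at least v at time i.
  have hside : j < k ∨ k < eps (mergedPattern y) j := by
    rcases le_or_gt 0 j with h0 | h0
    · right
      rw [abs_of_nonneg h0] at hj1 hj2
      by_contra hcon
      have h1 := hM.2.2 i (by omega) (by have := le_abs_self i; omega)
      have h2 := hv _ ⟨j + 1, by have := le_abs_self k; omega, rfl⟩
      have := hM.2.1
      omega
    · left
      rw [abs_of_neg h0] at hj1
      have := neg_abs_le k
      omega
  have hM' : Matched (mergedPattern y') (eps (mergedPattern y) j) j :=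
    hM.congr fun i hi hi' => hz i (by have := hM.lt; omega)
  simp only [Bool.false_eq_true, if_false]
  rw [hM'.eps_eq, h _ (by have := hM.lt; omega)]

/-! ### The first Krieger measure -/

/-- The image of the symmetric product measure under the typing of the closing brackets. -/
def krieger (m : ℕ) [NeZero m] : Measure (X m) := (bernoulli (Merged m)).map liftX

instance : IsProbabilityMeasure (krieger m) :=
  Measure.isProbabilityMeasure_map measurable_liftX.aemeasurable

/-- Closing brackets inherit their types, so `gPlus` is almost surely invertible. Since the walk is
bounded below on the right, overwriting one merged letter is a holonomy (`lift_tail`), and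
`eq_bernoulli_of_exchange` identifies the law. -/
theorem eq_krieger {μ : Measure (X m)} (hμ : IsInvariantProbability μ)
    (h : ∀ᵐ x ∂μ, LU (pattern x.1) ∧ ¬ RU (pattern x.1)) : μ = krieger m := by
  classical
  have := hμ.isProbabilityMeasure
  have hν : μ.map gPlus = bernoulli (Merged m) := by
    have := Measure.isProbabilityMeasure_map (μ := μ) measurable_gPlus.aemeasurable
    refine eq_bernoulli_of_exchange fun s k hks w => ?_
    set C := {y : ℤ → Merged m | ∀ i ∈ s, y i = w i} with hCdef
    have hC : MeasurableSet C := measurableSet_coords s id w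
    have hCk : ∀ y y' : ℤ → Merged m, (∀ i ≠ k, y i = y' i) → y ∈ C → y' ∈ C :=
      fun y y' hy hyC i hi => by
        rw [← hy i (by rintro rfl; exact hks hi)]; exact hyC i hi
    have hk (a : Merged m) : MeasurableSet {y : ℤ → Merged m | y k = a} :=
      measurableSet_apply_eq _ _
    let A : Merged m → Set (X m) := fun a =>
      {x | LU (pattern x.1) ∧ ¬ RU (pattern x.1)} ∩ gPlus ⁻¹' (C ∩ {y | y k = a})
    have hA (a) : MeasurableSet (A a) :=
      (Measurable.setOf (by fun_prop)).inter (measurable_gPlus (hC.inter (hk a)))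
    have hAν (a) : μ.map gPlus (C ∩ {y | y k = a}) = μ (A a) := by
      rw [Measure.map_apply measurable_gPlus (hC.inter (hk a))]
      refine measure_congr ?_
      filter_upwards [h] with x hx
      exact propext ⟨fun h' => ⟨hx, h'⟩, fun h' => h'.2⟩
    intro a b
    rw [hAν, hAν]
    -- Forget the closing types, write b at k, and restore the types. The letter at k is a on all of
    -- `A a`, so nothing is lost.
    let Φ : (ℤ → Letter m) → (ℤ → Letter m) := fun x =>
      lift (Function.update (fun i => merge (x i)) k b)
    have hmerge (x : X m) : (fun i => merge (x.1 i)) = gPlus x :=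
      funext fun i => (gPlus_apply x i).symm
    have hΦ : Measurable Φ := by
      refine measurable_lift.comp (measurable_pi_lambda _ fun i => ?_)
      by_cases hi : i = k
      · subst hi; simp
      · simp only [Function.update_of_ne hi]
        exact (Measurable.of_discrete (f := merge)).comp (measurable_pi_apply i)
    have hΦx (x : X m) : Φ x.1 = (liftX (Function.update (gPlus x) k b)).1 := by
      simp only [Φ, hmerge]; rfl
    refine hμ.measure_le (hA a) hΦ (fun x hx => ⟨?_, ?_⟩) (fun x hx x' hx' he => ?_)
      fun x hx => ?_
    · rw [hΦx]; exact (liftX _).2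
    · rw [show (⟨Φ x.1, _⟩ : X m) = liftX (Function.update (gPlus x) k b) from
        Subtype.ext (hΦx x)]
      obtain ⟨⟨hL, hR⟩, hxC, hxa⟩ := hx
      have hz : ∀ i ≠ k, pattern x.1 i = mergedPattern (Function.update (gPlus x) k b) i := by
        intro i hi
        rw [← mergedPattern_gPlus]
        exact mergedPattern_congr (Function.update_of_ne hi _ _).symm
      refine ⟨⟨?_, fun hcon => hR ?_⟩, ?_, ?_⟩
      · rw [pattern_liftX]
        exact hL.congr (n := k) fun i hi => hz i (by omega)
      · rw [pattern_liftX] at hcon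
        exact hcon.congr (n := k) fun i hi => (hz i (by omega)).symm
      · show gPlus (liftX _) ∈ C
        rw [gPlus_liftX]
        exact hCk _ _ (fun i hi => (Function.update_of_ne hi _ _).symm) hxC
      · show gPlus (liftX _) k = b
        rw [gPlus_liftX, Function.update_self]
    · rw [hΦx, hΦx] at he
      have he := congrArg gPlus (Subtype.ext he)
      rw [gPlus_liftX, gPlus_liftX] at he
      have : gPlus x = gPlus x' := by
        funext i
        by_cases hi : i = k
        · subst hi; exact hx.2.2.trans hx'.2.2.symm
        · simpa [hi] using congrFun he i
      rw [← liftX_gPlus hx.1.1, this, liftX_gPlus hx'.1.1]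
    · obtain ⟨⟨hL, hR⟩, -⟩ := hx
      obtain ⟨n, hn⟩ := lift_tail (y := gPlus x) (y' := Function.update (gPlus x) k b) (k := k)
        (fun i hi => (Function.update_of_ne hi _ _).symm)
        (by rwa [mergedPattern_gPlus]) (by rwa [mergedPattern_gPlus])
      refine ⟨n, fun j hj => ?_⟩
      rw [hΦx]
      refine (hn j hj).trans ?_
      exact congrFun (congrArg Subtype.val (liftX_gPlus hL)) j
  rw [krieger, ← hν, Measure.map_map measurable_liftX measurable_gPlus]
  conv_lhs => rw [← Measure.map_id (μ := μ)]
  refine Measure.map_congr ?_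
  filter_upwards [h] with x hx
  exact (liftX_gPlus hx.1).symm

/-- Under `LU` a holonomy of X becomes a holonomy of the full shift on merged letters, where all
central cylinders of a given length have the same measure. -/
theorem krieger_invariant
    (hLU : ∀ᵐ y ∂bernoulli (Merged m), LU (mergedPattern y)) :
    IsInvariantProbability (krieger m) := by
  refine ⟨inferInstance, fun A g hg => ?_⟩
  have hA := hg.measurableSet
  have hrange : MeasurableSet (Set.range g) := by
    have := hA.standardBorel
    exact (hg.measurable.measurableEmbedding hg.injective).measurableSet_range
  rw [krieger, Measure.map_apply measurable_liftX hrange, Measure.map_apply measurable_liftX hA]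
  let G : Set (ℤ → Merged m) := {y | LU (mergedPattern y)}
  have hG : MeasurableSet G := Measurable.setOf (by fun_prop)
  have hGae (E : Set (ℤ → Merged m)) : bernoulli (Merged m) E = bernoulli (Merged m) (E ∩ G) := by
    refine measure_congr ?_
    filter_upwards [hLU] with x hx
    exact propext ⟨fun h' => ⟨h', hx⟩, fun h' => h'.1⟩
  have hA' : MeasurableSet (liftX ⁻¹' A ∩ G) := (measurable_liftX hA).inter hG
  have hgL (x : A) (h : LU (pattern x.1.1)) : LU (pattern (g x).1) := (hg.doubleTail x).LU h
  have hgG (x : A) (h : LU (pattern x.1.1)) : liftX (gPlus (g x)) = g x := liftX_gPlus (hgL x h)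
  let ex : (liftX ⁻¹' A ∩ G : Set (ℤ → Merged m)) → A := fun y => ⟨liftX y.1, y.2.1⟩
  have hex (y) : gPlus (ex y).1 = y.1 := gPlus_liftX y.1
  have hyG (y) : LU (pattern (ex y).1.1) := by
    show LU (pattern (liftX y.1).1)
    rw [pattern_liftX]; exact y.2.2
  let g' : (liftX ⁻¹' A ∩ G : Set (ℤ → Merged m)) → (ℤ → Merged m) := fun y => gPlus (g (ex y))
  have hg' (y) : liftX (g' y) = g (ex y) := hgG _ (hyG y)
  have hg'm : Measurable g' := measurable_gPlus.comp (hg.measurable.comp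
    ((measurable_liftX.comp measurable_subtype_coe).subtype_mk))
  have hinj : Function.Injective g' := by
    intro y y' h
    have h1 := congrArg liftX h
    rw [hg', hg'] at h1
    have h2 := hg.injective h1
    exact Subtype.ext (by rw [← hex y, ← hex y', h2])
  have htail (y) : ∃ n : ℕ, ∀ k : ℤ, (n : ℤ) < |k| → g' y k = y.1 k := by
    obtain ⟨n, hn⟩ := hg.doubleTail (ex y)
    refine ⟨n, fun k hk => ?_⟩
    show gPlus (g (ex y)) k = y.1 k
    rw [← hex y, gPlus_apply, gPlus_apply, hn k hk]
  have hcyl (N : ℕ) (x : ℤ → Merged m) : bernoulli (Merged m) (centralCylinder N x)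
      = ((Nat.card (Merged m) : ENNReal)⁻¹) ^ (Finset.Icc (-N : ℤ) N).card := by
    have h : centralCylinder N x = {y | ∀ i ∈ Finset.Icc (-N : ℤ) N, y i = x i} := by
      ext y; simp only [centralCylinder, Set.mem_ofPred_eq, Finset.mem_Icc, abs_le]
    rw [h]
    exact bernoulli_coords _ Function.injective_id.injOn _
  have hmain := measure_range_eq_of_centralCylinder (μ := bernoulli (Merged m)) (c := id) .id hA'
    hg'm hinj (Z := ∅) measure_empty htail
    fun y => .inr ⟨0, fun N _ => by rw [Set.preimage_id, Set.preimage_id, hcyl, hcyl]⟩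
  rw [hGae, hGae (liftX ⁻¹' A), ← hmain]
  congr 1
  ext y'
  constructor
  · rintro ⟨⟨x, hx⟩, hy'⟩
    have h1 : LU (pattern x.1.1) := (hg.doubleTail x).symm.LU (by
      rw [hx, pattern_liftX]; exact hy')
    have h2 := liftX_gPlus h1
    have h3 : gPlus x.1 ∈ liftX ⁻¹' A ∩ G := by
      refine ⟨?_, ?_⟩
      · rw [Set.mem_preimage, h2]; exact x.2
      · show LU _
        rwa [mergedPattern_gPlus]
    have h4 : ex ⟨gPlus x.1, h3⟩ = x := Subtype.ext h2
    refine ⟨⟨gPlus x.1, h3⟩, ?_⟩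
    show gPlus (g (ex _)) = y'
    rw [h4, hx, gPlus_liftX]
  · rintro ⟨y, rfl⟩
    refine ⟨⟨_, (hg' y).symm⟩, ?_⟩
    show LU (mergedPattern (gPlus (g (ex y))))
    rw [mergedPattern_gPlus]
    exact hgL _ (hyG y)

/-- A word prescribes in particular its merged word. Arbitrary positions e are allowed so that the
reversed coordinates of μ_- are covered too. -/
theorem krieger_cylinder_le {n : ℕ} {e : Fin n → ℤ} (he : Function.Injective e)
    (w : Fin n → Letter m) :
    krieger m {x | ∀ k, x.1 (e k) = w k} ≤ ((m + 1 : ℕ) : ENNReal)⁻¹ ^ n := by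
  have hm : MeasurableSet {x : X m | ∀ k, x.1 (e k) = w k} := by
    have := measurableSet_coords Finset.univ e w
    simpa using measurable_subtype_coe (p := (· ∈ shiftSet m)) this
  rw [krieger, Measure.map_apply measurable_liftX hm]
  have h := bernoulli_coords (S := Merged m) Finset.univ he.injOn fun k => merge (w k)
  rw [Finset.card_univ, Fintype.card_fin, Nat.card_eq_fintype_card, Fintype.card_sum,
    Fintype.card_fin, Fintype.card_unit] at h
  rw [← h]
  refine measure_mono fun y hy k _ => ?_
  have h1 : lift y (e k) = w k := hy k
  rw [← h1, merge_lift]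

end Dyck

namespace Dyck

/-! ### Almost sure behaviour of random walks -/

section RandomWalk

variable {S : Type} [Finite S] [Nonempty S] [MeasurableSpace S] [DiscreteMeasurableSpace S]

theorem iIndepFun_bernoulli (φ : S → ℝ) {e : ℕ → ℤ} (he : Function.Injective e) :
    ProbabilityTheory.iIndepFun (fun (n : ℕ) (y : ℤ → S) => φ (y (e n))) (bernoulli S) :=
  ProbabilityTheory.iIndepFun.precomp he
    (ProbabilityTheory.iIndepFun_infinitePi (X := fun _ : ℤ => φ) fun _ => .of_discrete)

omit [Finite S] [Nonempty S] in
theorem measurable_comp_apply (φ : S → ℝ) (k : ℤ) : Measurable fun y : ℤ → S => φ (y k) :=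
  (Measurable.of_discrete (f := φ)).comp (measurable_pi_apply k)

theorem map_comp_apply (φ : S → ℝ) (k : ℤ) :
    (bernoulli S).map (fun y : ℤ → S => φ (y k))
      = (ProbabilityTheory.uniformOn (Set.univ : Set S)).map φ := by
  rw [← (measurePreserving_eval_infinitePi
    (fun _ : ℤ => ProbabilityTheory.uniformOn (Set.univ : Set S)) k).map_eq]
  exact (Measure.map_map .of_discrete (measurable_pi_apply k)).symm

theorem integrable_comp_apply (φ : S → ℝ) (k : ℤ) :
    Integrable (fun y : ℤ → S => φ (y k)) (bernoulli S) := by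
  obtain ⟨C, hC⟩ := (Set.finite_range fun a => ‖φ a‖).bddAbove
  exact .of_bound (measurable_comp_apply φ k).aestronglyMeasurable C
    (.of_forall fun y => hC ⟨y k, rfl⟩)

theorem integral_comp_apply [Fintype S] (φ : S → ℝ) (k : ℤ) :
    ∫ y, φ (y k) ∂bernoulli S = (Fintype.card S : ℝ)⁻¹ * ∑ a, φ a := by
  have h1 := measurePreserving_eval_infinitePi
    (fun _ : ℤ => ProbabilityTheory.uniformOn (Set.univ : Set S)) k
  have h2 := integral_map (μ := bernoulli S) h1.measurable.aemeasurable (f := φ)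
    (Measurable.of_discrete.aestronglyMeasurable)
  rw [show Measure.map (Function.eval k) (bernoulli S) = _ from h1.map_eq] at h2
  rw [show (∫ y, φ (y k) ∂bernoulli S) = _ from h2.symm, integral_fintype (.of_finite)]
  simp [Measure.real, uniformOn_singleton_eq, Finset.mul_sum]

theorem ae_tendsto_sum_atTop [Fintype S] (φ : S → ℝ) (hφ : 0 < ∑ a, φ a) {e : ℕ → ℤ}
    (he : Function.Injective e) : ∀ᵐ y ∂bernoulli S,
      Tendsto (fun n => ∑ i ∈ Finset.range n, φ (y (e i))) atTop atTop := by
  have h := ProbabilityTheory.strong_law_ae_real (μ := bernoulli S)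
    (fun (n : ℕ) (y : ℤ → S) => φ (y (e n))) (integrable_comp_apply φ _)
    (fun i j hij => (iIndepFun_bernoulli φ he).indepFun hij)
    (fun i => ⟨(measurable_comp_apply φ _).aemeasurable, (measurable_comp_apply φ _).aemeasurable,
      by rw [map_comp_apply, map_comp_apply]⟩)
  filter_upwards [h] with y hy
  rw [integral_comp_apply] at hy
  have hpos : 0 < (Fintype.card S : ℝ)⁻¹ * ∑ a, φ a :=
    mul_pos (inv_pos.2 (by exact_mod_cast Fintype.card_pos)) hφ
  refine (Tendsto.atTop_mul_pos hpos tendsto_natCast_atTop_atTop hy).congr' ?_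
  filter_upwards [eventually_gt_atTop 0] with n hn
  have : (n : ℝ) ≠ 0 := by positivity
  field_simp

/-- The partial sums form a martingale with bounded steps. Were they bounded below, they would also
be bounded above and would converge, which steps of absolute value one exclude. -/
theorem ae_not_bddBelow_sum [Fintype S] (φ : S → ℝ) (hφ : ∑ a, φ a = 0) (hφ' : ∀ a, |φ a| = 1)
    {e : ℕ → ℤ} (he : Function.Injective e) : ∀ᵐ y ∂bernoulli S,
      ¬ BddBelow (Set.range fun n => ∑ i ∈ Finset.range (n + 1), φ (y (e i))) := by
  let Y : ℕ → (ℤ → S) → ℝ := fun n y => φ (y (e n))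
  have hY (n : ℕ) : StronglyMeasurable (Y n) := (measurable_comp_apply φ _).stronglyMeasurable
  let G := Filtration.natural Y hY
  let M : ℕ → (ℤ → S) → ℝ := fun n y => ∑ i ∈ Finset.range (n + 1), Y i y
  have hstep (n : ℕ) : M (n + 1) - M n = Y (n + 1) := by
    funext y; simp [M, Finset.sum_range_succ _ (n + 1)]
  have hM : Martingale M G (bernoulli S) := by
    refine martingale_of_condExp_sub_eq_zero_nat (fun n => ?_)
      (fun n => integrable_finsetSum _ fun i _ => integrable_comp_apply φ _) fun n => ?_
    · have hA := Filtration.stronglyAdapted_natural hY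
      refine Finset.stronglyMeasurable_fun_sum _ fun i hi => ?_
      exact (hA i).mono (G.mono (by simpa [Nat.lt_succ_iff] using hi))
    · rw [hstep]
      refine (ProbabilityTheory.iIndepFun.condExp_natural_ae_eq_of_lt hY
        (iIndepFun_bernoulli φ he) n.lt_succ_self).trans (.of_forall fun y => ?_)
      show ∫ y, φ (y (e (n + 1))) ∂bernoulli S = 0
      rw [integral_comp_apply, hφ, mul_zero]
  have habs (n : ℕ) (y : ℤ → S) : |M (n + 1) y - M n y| = 1 := by
    have := congrFun (hstep n) y
    rw [Pi.sub_apply] at this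
    rw [this]; exact hφ' _
  have hb : ∀ᵐ y ∂bernoulli S, ∀ n, |M (n + 1) y - M n y| ≤ ((1 : NNReal) : ℝ) :=
    .of_forall fun y n => by rw [habs]; simp
  filter_upwards [hM.bddAbove_range_iff_bddBelow_range hb,
    hM.submartingale.bddAbove_iff_exists_tendsto hb] with y h1 h2 h3
  obtain ⟨c, hc⟩ := h2.1 (h1.2 h3)
  have h4 := ((hc.comp (tendsto_add_atTop_nat 1)).sub hc).abs
  simp only [Function.comp_def, habs, sub_self, abs_zero] at h4
  exact one_ne_zero (tendsto_nhds_unique tendsto_const_nhds h4)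

end RandomWalk

theorem zWalk_natCast (z : ℤ → Bool) (n : ℕ) :
    zWalk z n = ∑ i ∈ Finset.range n, if z i then 1 else -1 := by
  induction n with
  | zero => simp [zWalk_zero]
  | succ n ih => rw [Finset.sum_range_succ, ← ih, Nat.cast_succ, zWalk_succ]

theorem zWalk_neg_natCast (z : ℤ → Bool) (n : ℕ) :
    zWalk z (-n) = -∑ i ∈ Finset.range n, if z (-1 - i) then 1 else -1 := by
  rw [← zWalk_mirror, zWalk_natCast, ← Finset.sum_neg_distrib]
  refine Finset.sum_congr rfl fun i _ => ?_
  cases h : z (-1 - i) <;> simp [mirror, h]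

theorem injective_negSucc : Function.Injective fun n : ℕ => (-1 - n : ℤ) :=
  fun a b h => by simpa using h

theorem ae_LU_RU_bernoulli : ∀ᵐ z ∂bernoulli Bool, LU z ∧ RU z := by
  have hcast (b : Bool) : (((if b then 1 else -1 : ℤ) : ℤ) : ℝ) = if b then 1 else -1 := by
    cases b <;> simp
  have hcast' (b : Bool) : -(((if b then 1 else -1 : ℤ) : ℤ) : ℝ) = if b then -1 else 1 := by
    cases b <;> simp
  filter_upwards [
    ae_not_bddBelow_sum (fun b : Bool => if b then (1 : ℝ) else -1) (by simp)
      (fun b => by cases b <;> simp) Nat.cast_injective,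
    ae_not_bddBelow_sum (fun b : Bool => if b then (-1 : ℝ) else 1) (by simp)
      (fun b => by cases b <;> simp) injective_negSucc] with z h1 h2
  constructor
  · by_contra hcon
    obtain ⟨b, hb⟩ := not_LU_iff.1 hcon
    refine h2 ⟨b, ?_⟩
    rintro _ ⟨n, rfl⟩
    have := hb (-(n + 1 : ℕ)) (by omega)
    rw [zWalk_neg_natCast] at this
    have := (Int.cast_le (R := ℝ)).2 this
    rwa [← Finset.sum_neg_distrib, Int.cast_sum, Finset.sum_congr rfl fun i _ => by
      rw [Int.cast_neg, hcast']] at this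
  · by_contra hcon
    obtain ⟨b, hb⟩ := not_RU_iff.1 hcon
    refine h1 ⟨b, ?_⟩
    rintro _ ⟨n, rfl⟩
    have := hb (n + 1 : ℕ) (by omega)
    rw [zWalk_natCast] at this
    have := (Int.cast_le (R := ℝ)).2 this
    rwa [Int.cast_sum, Finset.sum_congr rfl fun i _ => hcast _] at this

variable {m : ℕ}

/-- Of the m + 1 equally likely letters, m go up and one goes down; the drift is positive because m
≥ 2. -/
theorem ae_drift (hm : 2 ≤ m) : ∀ᵐ y ∂bernoulli (Merged m),
    Tendsto (fun n : ℕ => zWalk (mergedPattern y) n) atTop atTop ∧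
    Tendsto (fun n : ℕ => zWalk (mergedPattern y) (-n)) atTop atBot := by
  let φ : Merged m → ℝ := fun a => if a.isLeft then 1 else -1
  have hφ : 0 < ∑ a, φ a := by
    simp only [φ, Fintype.sum_sum_type]
    simp
    omega
  have hcast (b : Bool) : (((if b then 1 else -1 : ℤ) : ℤ) : ℝ) = if b then 1 else -1 := by
    cases b <;> simp
  filter_upwards [ae_tendsto_sum_atTop φ hφ Nat.cast_injective,
    ae_tendsto_sum_atTop φ hφ injective_negSucc] with y h1 h2
  constructor
  · refine tendsto_intCast_atTop_iff.1 (h1.congr fun n => ?_)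
    rw [zWalk_natCast, Int.cast_sum]
    exact Finset.sum_congr rfl fun i _ => (hcast _).symm
  · refine tendsto_intCast_atBot_iff.1 ((tendsto_neg_atTop_atBot.comp h2).congr fun n => ?_)
    rw [zWalk_neg_natCast, Int.cast_neg, Int.cast_sum]
    exact congrArg Neg.neg (Finset.sum_congr rfl fun i _ => (hcast _).symm)

theorem LU_of_tendsto {z : ℤ → Bool} (h : Tendsto (fun n : ℕ => zWalk z (-n)) atTop atBot) :
    LU z := by
  by_contra hcon
  obtain ⟨b, hb⟩ := not_LU_iff.1 hcon
  obtain ⟨n, hn⟩ := (h.eventually_lt_atBot b).exists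
  have := hb (-n) (by omega)
  omega

theorem tendsto_intCast_of_natCast {z : ℤ → Bool}
    (h : Tendsto (fun n : ℕ => zWalk z n) atTop atTop) : Tendsto (zWalk z) atTop atTop := by
  refine tendsto_atTop.2 fun b => ?_
  obtain ⟨N, hN⟩ := eventually_atTop.1 (h.eventually_ge_atTop b)
  refine eventually_atTop.2 ⟨N, fun i hi => ?_⟩
  have := hN i.toNat (by omega)
  rwa [Int.toNat_of_nonneg (by omega)] at this

/-! ### The Krieger measures -/

theorem mem_B_top_bot {x : X m} : x ∈ B m {⊤} {⊥} ↔
    liminf (fun i : ℤ => ((zWalk (pattern x.1) i : ℝ) : EReal)) atTop = ⊤ ∧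
      LU (pattern x.1) := by
  have h := liminf_atBot_ne_bot_iff (z := pattern x.1)
  rw [ne_eq, not_iff_not] at h
  simp only [B, H_eq, Set.mem_ofPred_eq, Set.mem_singleton_iff, h]

theorem measurableSet_B_top_bot : MeasurableSet (B m {⊤} {⊥}) := by
  have h : B m {⊤} {⊥} = {x | (∀ b : ℕ, ∃ n : ℕ, ∀ k : ℕ,
      (b : ℤ) ≤ zWalk (pattern x.1) (n + k)) ∧ LU (pattern x.1)} := by
    ext x
    rw [mem_B_top_bot]
    refine and_congr_left fun _ => ⟨fun h b => ?_, fun h => ?_⟩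
    · have hlt : ((b : ℝ) : EReal) < liminf (fun i : ℤ => ((zWalk (pattern x.1) i : ℝ) : EReal))
          atTop := by rw [h]; exact EReal.coe_lt_top _
      obtain ⟨n, hn⟩ := eventually_atTop.1 (eventually_lt_of_lt_liminf hlt)
      refine ⟨n.toNat, fun k => ?_⟩
      have := hn (n.toNat + k) (by omega)
      rw [EReal.coe_lt_coe_iff] at this
      exact_mod_cast this.le
    · refine Tendsto.liminf_eq (EReal.tendsto_coe_nhds_top_iff.2
        (tendsto_intCast_atTop_atTop.comp (tendsto_atTop.2 fun b => ?_)))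
      obtain ⟨n, hn⟩ := h b.toNat
      refine eventually_atTop.2 ⟨n, fun i hi => ?_⟩
      have := hn (i - n).toNat
      rw [show (n : ℤ) + ((i - n).toNat : ℤ) = i by omega] at this
      omega
  rw [h]
  exact Measurable.setOf (by fun_prop)

theorem gMinus_eq (x : X m) : gMinus x = gPlus (rev x) ∘ fun i => -1 - i := by
  funext i
  simp only [gMinus, Function.comp, gPlus_apply, rev_apply, sub_sub_cancel]
  cases x.1 i <;> rfl

theorem mem_B_bot_top {x : X m} : x ∈ B m {⊥} {⊤} ↔ rev x ∈ B m {⊤} {⊥} := by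
  have h : ∀ i, H (rev x).1 i = H x.1 (-i) := fun i => by
    rw [H_eq, H_eq, pattern_rev, zWalk_mirror]
  have h1 : liminf (fun i : ℤ => ((H (rev x).1 i : ℝ) : EReal)) atTop
      = liminf (fun i : ℤ => ((H x.1 i : ℝ) : EReal)) atBot := by
    simp only [h]
    rw [← map_neg_atTop (G := ℤ)]
    rfl
  have h2 : liminf (fun i : ℤ => ((H (rev x).1 i : ℝ) : EReal)) atBot
      = liminf (fun i : ℤ => ((H x.1 i : ℝ) : EReal)) atTop := by
    simp only [h]
    rw [← map_neg_atBot (G := ℤ)]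
    rfl
  simp only [B, Set.mem_ofPred_eq, h1, h2]
  exact and_comm

variable [NeZero m]

theorem ae_mem_B (hm : 2 ≤ m) : ∀ᵐ y ∂bernoulli (Merged m), liftX y ∈ B m {⊤} {⊥} := by
  filter_upwards [ae_drift hm] with y hy
  rw [mem_B_top_bot, pattern_liftX]
  refine ⟨Tendsto.liminf_eq ?_, LU_of_tendsto hy.2⟩
  exact EReal.tendsto_coe_nhds_top_iff.2
    (tendsto_intCast_atTop_atTop.comp (tendsto_intCast_of_natCast hy.1))

/-- On B^{+∞}_{-∞} the maps `gPlus` and `liftX` are mutually inverse, and almost every merged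
sequence lifts into that set. -/
theorem muPlus_eq (hm : 2 ≤ m) : muPlus m = krieger m := by
  refine Measure.ext fun A hA => ?_
  have hB := measurableSet_B_top_bot (m := m)
  have himg (E : Set (B m {⊤} {⊥})) :
      (fun x : B m {⊤} {⊥} => gPlus (x : X m)) '' E = liftX ⁻¹' (Subtype.val '' E) := by
    ext y
    constructor
    · rintro ⟨x, hx, rfl⟩
      exact ⟨x, hx, (liftX_gPlus (mem_B_top_bot.1 x.2).2).symm⟩
    · rintro ⟨x, hx, h⟩
      exact ⟨x, hx, by simp only [h, gPlus_liftX]⟩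
  have hinj : Function.Injective fun x : B m {⊤} {⊥} => gPlus (x : X m) := fun x y h => by
    refine Subtype.ext ?_
    rw [← liftX_gPlus (mem_B_top_bot.1 x.2).2, ← liftX_gPlus (mem_B_top_bot.1 y.2).2]
    exact congrArg liftX h
  rw [muPlus, Measure.map_apply measurable_subtype_coe hA, Measure.comap_apply _ hinj
    (fun E hE => by rw [himg]; exact measurable_liftX ((MeasurableEmbedding.subtype_coe hB).measurableSet_image.2 hE)) _
    (measurable_subtype_coe hA), himg, krieger, Measure.map_apply measurable_liftX hA,
    Subtype.image_preimage_coe]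
  refine measure_congr ?_
  filter_upwards [ae_mem_B hm] with y hy
  exact propext ⟨fun h => h.2, fun h => ⟨hy, h⟩⟩

/-- The map `gMinus` is `gPlus` seen through `rev`, up to the reflection σ of coordinates, under
which the product measure is invariant. -/
theorem muMinus_eq (hm : 2 ≤ m) : muMinus m = (krieger m).map rev := by
  refine Measure.ext fun A hA => ?_
  let σ : ℤ ≃ ℤ := ⟨fun i => -1 - i, fun i => -1 - i, fun i => by simp, fun i => by simp⟩
  have hσ (y : ℤ → Merged m) : (y ∘ σ) ∘ σ = y := by funext i; simp [σ]
  have hσm : Measurable fun y : ℤ → Merged m => y ∘ σ :=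
    measurable_pi_lambda _ fun i => measurable_pi_apply _
  have hB : MeasurableSet (B m {⊥} {⊤}) := by
    have : B m {⊥} {⊤} = rev ⁻¹' B m {⊤} {⊥} := by ext x; exact mem_B_bot_top
    rw [this]
    exact rev.measurable measurableSet_B_top_bot
  have hLU {x : X m} (hx : x ∈ B m {⊥} {⊤}) : liftX (gMinus x ∘ σ) = rev x := by
    rw [gMinus_eq]
    refine (congrArg liftX (hσ (gPlus (rev x)))).trans
      (liftX_gPlus (mem_B_top_bot.1 (mem_B_bot_top.1 hx)).2)
  have himg (E : Set (B m {⊥} {⊤})) : (fun x : B m {⊥} {⊤} => gMinus (x : X m)) '' E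
      = (fun y : ℤ → Merged m => rev (liftX (y ∘ σ))) ⁻¹' (Subtype.val '' E) := by
    ext y
    constructor
    · rintro ⟨x, hx, rfl⟩
      exact ⟨x, hx, by simp only [hLU x.2, rev_rev]⟩
    · rintro ⟨x, hx, h⟩
      refine ⟨x, hx, ?_⟩
      simp only [gMinus_eq, h, rev_rev, gPlus_liftX]
      exact hσ y
  have hinj : Function.Injective fun x : B m {⊥} {⊤} => gMinus (x : X m) := fun x y h => by
    refine Subtype.ext (rev.injective ?_)
    rw [← hLU x.2, ← hLU y.2]
    exact congrArg (fun w : ℤ → Merged m => liftX (w ∘ σ)) h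
  have hmeas : Measurable fun y : ℤ → Merged m => rev (liftX (y ∘ σ)) :=
    rev.measurable.comp (measurable_liftX.comp hσm)
  rw [muMinus, Measure.map_apply measurable_subtype_coe hA, Measure.comap_apply _ hinj
    (fun E hE => by
      rw [himg]; exact hmeas ((MeasurableEmbedding.subtype_coe hB).measurableSet_image.2 hE)) _
    (measurable_subtype_coe hA), himg, Measure.map_apply rev.measurable hA, krieger,
    Measure.map_apply measurable_liftX (rev.measurable hA), Subtype.image_preimage_coe]
  have h1 : bernoulli (Merged m) (liftX ⁻¹' (rev ⁻¹' A))
      = bernoulli (Merged m) ((fun y : ℤ → Merged m => y ∘ σ) ⁻¹' (liftX ⁻¹' (rev ⁻¹' A))) := by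
    rw [← Measure.map_apply hσm (measurable_liftX (rev.measurable hA)), bernoulli_map_comp]
  have h2 : ∀ᵐ y ∂bernoulli (Merged m), liftX (y ∘ σ) ∈ B m {⊤} {⊥} := by
    refine ae_of_ae_map (p := fun y => liftX y ∈ B m {⊤} {⊥}) hσm.aemeasurable ?_
    rw [bernoulli_map_comp]
    exact ae_mem_B hm
  rw [h1]
  refine measure_congr ?_
  filter_upwards [h2] with y hy
  refine propext ⟨fun h => h.2, fun h => ⟨?_, h⟩⟩
  rw [mem_B_bot_top, rev_rev]
  exact hy

end Dyck

namespace Dyck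

variable {m : ℕ}

/-! ### Entropy -/

theorem typ_eq_of_merge {a b : Letter m} (h : merge a = merge b) (ha : a.isLeft = true) :
    typ a = typ b := by
  cases a <;> cases b <;> simp_all [merge, typ]

theorem isLeft_eq_of_merge {a b : Letter m} (h : merge a = merge b) : a.isLeft = b.isLeft := by
  cases a <;> cases b <;> simp_all [merge]

theorem isLeft_swap (a : Letter m) : a.swap.isLeft = !a.isLeft := by cases a <;> rfl

/-- A word of `X` is determined by a position where its walk is minimal, the types of the closing
brackets before that position and the types of the opening brackets after it. -/
theorem eq_of_merge_eq {x y : X m} {a n : ℤ} (ha : 0 ≤ a) (han : a ≤ n)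
    (hmin : ∀ k, 0 ≤ k → k ≤ n → zWalk (pattern x.1) a ≤ zWalk (pattern x.1) k)
    (h₁ : ∀ i, 0 ≤ i → i < a → merge (x.1 i).swap = merge (y.1 i).swap)
    (h₂ : ∀ i, a ≤ i → i < n → merge (x.1 i) = merge (y.1 i)) (i : ℤ) (hi : 0 ≤ i) (hin : i < n) :
    x.1 i = y.1 i := by
  have hz : ∀ i, 0 ≤ i → i < n → pattern x.1 i = pattern y.1 i := by
    intro i hi hin
    rcases lt_or_ge i a with h | h
    · have := isLeft_eq_of_merge (h₁ i hi h)
      rw [isLeft_swap, isLeft_swap] at this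
      exact Bool.not_inj this
    · exact isLeft_eq_of_merge (h₂ i h hin)
  have ht₁ : ∀ i, 0 ≤ i → i < a → pattern x.1 i = false → typ (x.1 i) = typ (y.1 i) := by
    intro i hi h hb
    have := typ_eq_of_merge (h₁ i hi h) (by rw [isLeft_swap]; simpa [pattern] using hb)
    rwa [typ_swap, typ_swap] at this
  have ht₂ : ∀ i, a ≤ i → i < n → pattern x.1 i = true → typ (x.1 i) = typ (y.1 i) :=
    fun i h hin hb => typ_eq_of_merge (h₂ i h hin) hb
  refine letter_ext (hz i hi hin) ?_
  rcases lt_or_ge i a with h | h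
  · cases hb : pattern x.1 i
    · exact ht₁ i hi h hb
    -- An opening bracket before the minimum closes before it, so its type is that of a recorded
    -- closing bracket.
    · obtain ⟨k, hk⟩ := exists_matched_right hb ⟨a, h, hmin i hi hin.le⟩
      have hka : k < a := by
        by_contra hcon
        have := hk.2.2 a h (not_lt.1 hcon)
        have := hmin i hi hin.le
        omega
      have hk' : Matched (pattern y.1) i k := hk.congr fun j hj hj' => hz j (by omega) (by omega)
      rw [typ_eq_of_matched x.2 hk, typ_eq_of_matched y.2 hk']
      exact ht₁ k (by have := hk.1; omega) hka hk.right
  · cases hb : pattern x.1 i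
    · have hW := zWalk_succ_false hb
      have h1 := hmin (i + 1) (by omega) (by omega)
      have hai : a < i := by
        rcases h.lt_or_eq with h | rfl
        · exact h
        · omega
      -- Symmetrically, a closing bracket after the minimum was opened after it.
      have hk := matched_eps hb ⟨a, hai, h1⟩
      generalize eps (pattern x.1) i = l at hk
      have hla : a ≤ l := by
        by_contra hcon
        have := hk.2.2 a (not_le.1 hcon) h
        have := hk.2.1
        omega
      have hk' : Matched (pattern y.1) l i := hk.congr fun j hj hj' => hz j (by omega) (by omega)
      rw [← typ_eq_of_matched x.2 hk, ← typ_eq_of_matched y.2 hk']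
      exact ht₂ l hla (by have := hk.lt; omega) hk.left
    · exact ht₂ i h hin hb

/-- The words of length `n` which occur at the coordinates `0, …, n - 1` of points of `X`. -/
def words (m n : ℕ) : Set (Fin n → Letter m) := {w | ∃ x : X m, ∀ k : Fin n, x.1 (k : ℕ) = w k}

/-- A word is encoded by the place of a minimum (n + 1 choices) and n merged letters: closing types
are kept before that place and opening types after it. -/
theorem ncard_words_le (n : ℕ) : (words m n).ncard ≤ (n + 1) * (m + 1) ^ n := by
  classical
  have hx : ∀ w : words m n, ∃ x : X m, ∀ k : Fin n, x.1 (k : ℕ) = w.1 k := fun w => w.2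
  choose x hx using hx
  have ha : ∀ w : words m n, ∃ a : Fin (n + 1), ∀ k : Fin (n + 1),
      zWalk (pattern (x w).1) (a : ℕ) ≤ zWalk (pattern (x w).1) (k : ℕ) := fun w =>
    Finite.exists_min fun k : Fin (n + 1) => zWalk (pattern (x w).1) (k : ℕ)
  choose a ha using ha
  let f : words m n → Fin (n + 1) × (Fin n → Merged m) := fun w =>
    (a w, fun i => if (i : ℕ) < (a w : ℕ) then merge (w.1 i).swap else merge (w.1 i))
  have hf : Function.Injective f := by
    intro w w' h
    have h1 : a w = a w' := congrArg Prod.fst h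
    have h2 := congrFun (congrArg Prod.snd h)
    simp only [f] at h2
    refine Subtype.ext (funext fun i => ?_)
    rw [← hx w i, ← hx w' i]
    have han := (a w).2
    refine eq_of_merge_eq (a := (a w : ℕ)) (n := n) (by omega) (by omega) (fun k hk hkn => ?_)
      (fun k hk hka => ?_) (fun k hka hkn => ?_) _ (by omega) (by have := i.2; omega)
    · have := ha w ⟨k.toNat, by omega⟩
      simpa [Int.toNat_of_nonneg hk] using this
    · have hlt : k.toNat < (a w : ℕ) := by omega
      have := h2 ⟨k.toNat, by omega⟩
      rw [if_pos hlt, if_pos (by rw [← h1]; exact hlt), ← hx w, ← hx w'] at this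
      simpa [Int.toNat_of_nonneg hk] using this
    · have hlt : ¬ k.toNat < (a w : ℕ) := by omega
      have := h2 ⟨k.toNat, by omega⟩
      rw [if_neg hlt, if_neg (by rw [← h1]; exact hlt), ← hx w, ← hx w'] at this
      simpa [Int.toNat_of_nonneg (show 0 ≤ k by omega)] using this
  have := Nat.card_le_card_of_injective f hf
  rw [← Nat.card_coe_set_eq]
  refine this.trans_eq ?_
  simp [Nat.card_eq_fintype_card]

variable {μ : Measure (X m)}

theorem sum_cylinders [IsProbabilityMeasure μ] (n : ℕ) :
    ∑ w : Fin n → Letter m, μ.real {x : X m | ∀ k : Fin n, x.1 ((k : ℕ) : ℤ) = w k} = 1 := by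
  let f : X m → (Fin n → Letter m) := fun x k => x.1 (k : ℕ)
  have hf : Measurable f := measurable_pi_lambda _ fun k =>
    (measurable_pi_apply _).comp measurable_subtype_coe
  have h := sum_measureReal_preimage_singleton (μ := μ) (f := f) Finset.univ
    fun w _ => hf (measurableSet_singleton w)
  rw [Finset.coe_univ, Set.preimage_univ, probReal_univ] at h
  rw [← h]
  refine Finset.sum_congr rfl fun w _ => congrArg _ ?_
  ext x
  exact ⟨fun hx => funext hx, fun hx k => congrFun hx k⟩

/-- Gibbs' inequality against constant weight 1/K, termwise from log t ≤ t − 1. Summed over at most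
K words, the bracket contributes at most zero. -/
theorem negMulLog_le {p K : ℝ} (hp : 0 ≤ p) (hK : 0 < K) :
    Real.negMulLog p ≤ p * Real.log K + (K⁻¹ - p) := by
  rcases hp.lt_or_eq with hp | rfl
  · have h := Real.log_le_sub_one_of_pos (x := (p * K)⁻¹) (by positivity)
    rw [Real.log_inv, Real.log_mul hp.ne' hK.ne'] at h
    have h2 := mul_le_mul_of_nonneg_left h hp.le
    have h3 : p * ((p * K)⁻¹ - 1) = K⁻¹ - p := by field_simp
    rw [h3] at h2
    unfold Real.negMulLog
    linarith
  · simp [hK.le]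

theorem blockEntropy_le [IsProbabilityMeasure μ] (n : ℕ) :
    blockEntropy μ n ≤ Real.log ((n + 1) * (m + 1) ^ n) := by
  classical
  set K : ℝ := (n + 1) * (m + 1) ^ n with hKdef
  have hK : 0 < K := by positivity
  have h0 : ∀ w ∉ (words m n).toFinset,
      μ.real {x : X m | ∀ k : Fin n, x.1 ((k : ℕ) : ℤ) = w k} = 0 := by
    intro w hw
    have : {x : X m | ∀ k : Fin n, x.1 ((k : ℕ) : ℤ) = w k} = ∅ :=
      Set.eq_empty_iff_forall_notMem.2 fun x hx => hw (Set.mem_toFinset.2 ⟨x, hx⟩)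
    rw [this, measureReal_empty]
  have hs := sum_cylinders (μ := μ) n
  rw [← Finset.sum_subset (Finset.subset_univ (words m n).toFinset) fun w _ hw => h0 w hw] at hs
  rw [blockEntropy, ← Finset.sum_subset (Finset.subset_univ (words m n).toFinset)
    fun w _ hw => by rw [h0 w hw, Real.negMulLog_zero]]
  refine (Finset.sum_le_sum fun w _ => negMulLog_le measureReal_nonneg hK).trans ?_
  rw [Finset.sum_add_distrib, ← Finset.sum_mul, Finset.sum_sub_distrib, hs, Finset.sum_const,
    one_mul, nsmul_eq_mul]
  have hcard : ((words m n).toFinset.card : ℝ) ≤ K := by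
    rw [← Set.ncard_eq_toFinset_card']
    have := ncard_words_le (m := m) n
    rw [hKdef]
    exact_mod_cast this
  have : ((words m n).toFinset.card : ℝ) * K⁻¹ ≤ 1 := by
    rw [← div_eq_mul_inv]; exact (div_le_one hK).2 hcard
  linarith

theorem blockEntropy_div_le [IsProbabilityMeasure μ] {n : ℕ} (hn : 0 < n) :
    blockEntropy μ n / n ≤ Real.log (n + 1) / n + Real.log (m + 1) := by
  have h := blockEntropy_le (μ := μ) n
  have hn' : (0 : ℝ) < n := by exact_mod_cast hn
  rw [Real.log_mul (by positivity) (by positivity), Real.log_pow] at h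
  rw [div_add' _ _ _ hn'.ne', div_le_div_iff_of_pos_right hn']
  linarith

theorem tendsto_log_div : Tendsto (fun n : ℕ => Real.log (n + 1) / n + Real.log (m + 1)) atTop
    (nhds (Real.log (m + 1))) := by
  have h1 : Tendsto (fun x : ℝ => Real.log x / x) atTop (nhds 0) := by
    have := Real.isLittleO_log_id_atTop.tendsto_div_nhds_zero
    exact this
  have h2 : Tendsto (fun n : ℕ => (n : ℝ) + 1) atTop atTop :=
    tendsto_atTop_add_const_right _ _ tendsto_natCast_atTop_atTop
  have h3 : Tendsto (fun n : ℕ => ((n : ℝ) + 1) / n) atTop (nhds 1) := by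
    have h4 : Tendsto (fun n : ℕ => 1 + 1 / (n : ℝ)) atTop (nhds (1 + 0)) :=
      tendsto_const_nhds.add tendsto_one_div_atTop_nhds_zero_nat
    rw [add_zero] at h4
    refine h4.congr' ?_
    filter_upwards [eventually_gt_atTop 0] with n hn
    have : (n : ℝ) ≠ 0 := by positivity
    field_simp
  have h5 := ((h1.comp h2).mul h3).add_const (Real.log (m + 1))
  rw [zero_mul, zero_add] at h5
  refine h5.congr' ?_
  filter_upwards [eventually_gt_atTop 0] with n hn
  have : (n : ℝ) + 1 ≠ 0 := by positivity
  simp only [Function.comp]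
  field_simp

theorem blockEntropy_nonneg [IsProbabilityMeasure μ] (n : ℕ) : 0 ≤ blockEntropy μ n :=
  Finset.sum_nonneg fun _ _ => Real.negMulLog_nonneg measureReal_nonneg measureReal_le_one

theorem entropy_le [IsProbabilityMeasure μ] : entropy μ ≤ Real.log (m + 1) := by
  have hT := tendsto_log_div (m := m)
  rw [← hT.limsup_eq]
  refine limsup_le_limsup ?_ ?_ hT.isBoundedUnder_le
  · filter_upwards [eventually_gt_atTop 0] with n hn using blockEntropy_div_le hn
  · exact isCoboundedUnder_le_of_le atTop fun n => div_nonneg (blockEntropy_nonneg n) n.cast_nonneg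

/-- The entropy is the mean of −log of the cylinder measure, which is at least n log(m + 1) on every
cylinder of positive measure. -/
theorem le_entropy [IsProbabilityMeasure μ] (h : ∀ (n : ℕ) (w : Fin n → Letter m),
    μ {x | ∀ k : Fin n, x.1 ((k : ℕ) : ℤ) = w k} ≤ ((m + 1 : ℕ) : ENNReal)⁻¹ ^ n) :
    Real.log (m + 1) ≤ entropy μ := by
  have hlow : ∀ n : ℕ, n * Real.log (m + 1) ≤ blockEntropy μ n := by
    intro n
    have hs := sum_cylinders (μ := μ) n
    have h1 : n * Real.log (m + 1) = (∑ w : Fin n → Letter m,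
        μ.real {x : X m | ∀ k : Fin n, x.1 ((k : ℕ) : ℤ) = w k}) * (n * Real.log (m + 1)) := by
      rw [hs, one_mul]
    rw [h1, Finset.sum_mul]
    refine Finset.sum_le_sum fun w _ => ?_
    have hp : μ.real {x : X m | ∀ k : Fin n, x.1 ((k : ℕ) : ℤ) = w k} ≤ ((m + 1 : ℝ)⁻¹) ^ n := by
      have := ENNReal.toReal_mono (by simp) (h n w)
      rw [ENNReal.toReal_pow, ENNReal.toReal_inv, ENNReal.toReal_natCast] at this
      exact_mod_cast this
    have hp0 := measureReal_nonneg (μ := μ) (s := {x : X m | ∀ k : Fin n, x.1 ((k : ℕ) : ℤ) = w k})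
    rcases hp0.lt_or_eq with hpos | h0
    · have hl := Real.log_le_log hpos hp
      rw [Real.log_pow, Real.log_inv] at hl
      rw [Real.negMulLog, neg_mul, ← mul_neg]
      exact mul_le_mul_of_nonneg_left (by linarith) hp0
    · rw [← h0]; simp
  have hT := tendsto_log_div (m := m)
  -- A real `limsup` is meaningful only for a sequence bounded above, which is why the upper bound
  -- reappears.
  refine le_limsup_of_frequently_le (Eventually.frequently ?_) ?_
  · filter_upwards [eventually_gt_atTop 0] with n hn
    have hn' : (0 : ℝ) < n := by exact_mod_cast hn
    rw [le_div_iff₀ hn', mul_comm]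
    exact hlow n
  · refine hT.isBoundedUnder_le.mono_le ?_
    filter_upwards [eventually_gt_atTop 0] with n hn using blockEntropy_div_le hn

theorem isMaximalEntropy_of_cylinder_le [IsProbabilityMeasure μ] (hT : μ.map T = μ)
    (h : ∀ (n : ℕ) (w : Fin n → Letter m),
      μ {x | ∀ k : Fin n, x.1 ((k : ℕ) : ℤ) = w k} ≤ ((m + 1 : ℕ) : ENNReal)⁻¹ ^ n) :
    IsMaximalEntropy μ :=
  ⟨inferInstance, ⟨shiftEquiv.measurable, hT⟩, fun _ _ _ => entropy_le.trans (le_entropy h)⟩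

end Dyck

namespace Dyck

variable {m : ℕ}

/-! ### Changing the type of a pair of brackets -/

/-- The positions `n` and `i` are equal or matched. -/
def Partner (z : ℤ → Bool) (n i : ℤ) : Prop := i = n ∨ Matched z i n ∨ Matched z n i

@[fun_prop]
theorem measurable_partner (n i : ℤ) : Measurable fun z => Partner z n i := by
  unfold Partner; fun_prop

theorem finite_partner (z : ℤ → Bool) (n : ℤ) : {i | Partner z n i}.Finite := by
  have h : {i | Partner z n i} = {n} ∪ ({i | Matched z i n} ∪ {i | Matched z n i}) := by
    ext i; simp [Partner]
  rw [h]
  refine (Set.finite_singleton n).union (.union ?_ ?_)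
  · exact Set.Subsingleton.finite fun i hi j hj => Matched.eq_left hi hj
  · exact Set.Subsingleton.finite fun i hi j hj => Matched.eq_right hi hj

theorem Matched.partner_iff {z : ℤ → Bool} {l k n : ℤ} (h : Matched z l k) :
    Partner z n l ↔ Partner z n k := by
  constructor
  · rintro (rfl | h' | h')
    · exact .inr (.inr h)
    · exact .inl (h.eq_right h')
    · exact absurd h.left (by rw [h'.right]; simp)
  · rintro (rfl | h' | h')
    · exact .inr (.inl h)
    · exact absurd h'.left (by rw [h.right]; simp)
    · exact .inl (h.eq_left h')

/-- Change the type of a letter. -/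
def mapTyp (π : Equiv.Perm (Fin m)) (a : Letter m) : Letter m := Sum.map π π a

theorem typ_mapTyp (π : Equiv.Perm (Fin m)) (a : Letter m) : typ (mapTyp π a) = π (typ a) := by
  cases a <;> rfl

theorem isLeft_mapTyp (π : Equiv.Perm (Fin m)) (a : Letter m) :
    (mapTyp π a).isLeft = a.isLeft := by
  cases a <;> rfl

open Classical in
/-- Apply a permutation to the type of the letter at `n` and of the letter matched with it. -/
def retype (n : ℤ) (π : Equiv.Perm (Fin m)) (x : ℤ → Letter m) : ℤ → Letter m := fun i =>
  if Partner (pattern x) n i then mapTyp π (x i) else x i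

theorem pattern_retype (n : ℤ) (π : Equiv.Perm (Fin m)) (x : ℤ → Letter m) :
    pattern (retype n π x) = pattern x := by
  funext i
  simp only [pattern, retype]
  split_ifs
  · exact isLeft_mapTyp _ _
  · rfl

theorem retype_of_partner {n i : ℤ} (π : Equiv.Perm (Fin m)) {x : ℤ → Letter m}
    (h : Partner (pattern x) n i) : retype n π x i = mapTyp π (x i) := if_pos h

theorem retype_of_not_partner {n i : ℤ} (π : Equiv.Perm (Fin m)) {x : ℤ → Letter m}
    (h : ¬ Partner (pattern x) n i) : retype n π x i = x i := if_neg h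

theorem typ_retype_self (n : ℤ) (π : Equiv.Perm (Fin m)) (x : ℤ → Letter m) :
    typ (retype n π x n) = π (typ (x n)) := by
  rw [retype_of_partner π (.inl rfl), typ_mapTyp]

theorem retype_mem_shiftSet {x : ℤ → Letter m} (hx : x ∈ shiftSet m) (n : ℤ)
    (π : Equiv.Perm (Fin m)) : retype n π x ∈ shiftSet m := by
  rw [mem_shiftSet_iff] at hx ⊢
  intro l k h
  rw [pattern_retype] at h
  by_cases hp : Partner (pattern x) n l
  · rw [retype_of_partner π hp, retype_of_partner π (h.partner_iff.1 hp), typ_mapTyp, typ_mapTyp,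
      hx l k h]
  · rw [retype_of_not_partner π hp, retype_of_not_partner π (mt h.partner_iff.2 hp), hx l k h]

theorem retype_symm_retype (n : ℤ) (π : Equiv.Perm (Fin m)) (x : ℤ → Letter m) :
    retype n π.symm (retype n π x) = x := by
  funext i
  by_cases hp : Partner (pattern x) n i
  · rw [retype_of_partner _ (by rwa [pattern_retype]), retype_of_partner _ hp]
    cases x i <;> simp [mapTyp]
  · rw [retype_of_not_partner _ (by rwa [pattern_retype]), retype_of_not_partner _ hp]

theorem retype_retype_symm (n : ℤ) (π : Equiv.Perm (Fin m)) (x : ℤ → Letter m) :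
    retype n π (retype n π.symm x) = x := retype_symm_retype n π.symm x

theorem measurable_retype (n : ℤ) (π : Equiv.Perm (Fin m)) :
    Measurable (retype n π : (ℤ → Letter m) → _) := by
  refine measurable_pi_lambda _ fun i => ?_
  refine Measurable.ite (Measurable.setOf (by fun_prop)) ?_ (measurable_pi_apply i)
  exact (Measurable.of_discrete (f := mapTyp π)).comp (measurable_pi_apply i)

/-- `retype` as a transformation of `X`. -/
def retypeX (n : ℤ) (π : Equiv.Perm (Fin m)) (x : X m) : X m :=
  ⟨retype n π x.1, retype_mem_shiftSet x.2 n π⟩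

theorem measurable_retypeX (n : ℤ) (π : Equiv.Perm (Fin m)) : Measurable (retypeX n π) :=
  ((measurable_retype n π).comp measurable_subtype_coe).subtype_mk

theorem pattern_retypeX (n : ℤ) (π : Equiv.Perm (Fin m)) (x : X m) :
    pattern (retypeX n π x).1 = pattern x.1 := pattern_retype n π x.1

/-- The measure does not see the types of the brackets. -/
def TypeSymmetric (μ : Measure (X m)) : Prop := ∀ n π, MeasurePreserving (retypeX n π) μ μ

variable {μ : Measure (X m)}

theorem IsInvariantProbability.typeSymmetric (hμ : IsInvariantProbability μ) :
    TypeSymmetric μ := by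
  refine fun n π => ⟨measurable_retypeX n π, Measure.ext fun A hA => ?_⟩
  rw [Measure.map_apply (measurable_retypeX n π) hA]
  refine hμ.measure_eq (measurable_retypeX n π hA) hA (measurable_retype n π)
    (measurable_retype n π.symm) (fun x hx => ⟨retype_mem_shiftSet x.2 n π, hx⟩)
    (fun x hx => ⟨retype_mem_shiftSet x.2 n π.symm, ?_⟩) (fun x _ => retype_symm_retype n π _)
    (fun x _ => retype_retype_symm n π _) fun x _ => ?_
  · show retypeX n π ⟨retype n π.symm x.1, _⟩ ∈ A
    rwa [show retypeX n π ⟨retype n π.symm x.1, _⟩ = x from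
      Subtype.ext (retype_retype_symm n π x.1)]
  · obtain ⟨b, hb⟩ := ((finite_partner (pattern x.1) n).image fun k => |k|).bddAbove
    refine ⟨b.toNat, fun k hk => retype_of_not_partner _ fun h => ?_⟩
    have := hb ⟨k, h, rfl⟩
    simp only at this
    omega

theorem measurable_typ_apply (n : ℤ) : Measurable fun x : X m => typ (x.1 n) :=
  (Measurable.of_discrete (f := typ)).comp
    ((measurable_pi_apply n).comp measurable_subtype_coe)

theorem measurableSet_typ_eq (n : ℤ) (j : Fin m) : MeasurableSet {x : X m | typ (x.1 n) = j} := by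
  have : MeasurableSet ((fun x : X m => typ (x.1 n)) ⁻¹' {j}) :=
    measurable_typ_apply n .of_discrete
  exact this

/-- Transposing two types at n exchanges the corresponding parts of A, so its m parts have equal
measure. -/
theorem TypeSymmetric.mul_measure_typ (hμ : TypeSymmetric μ) {n : ℤ} {A : Set (X m)}
    (hA : MeasurableSet A) (hn : ∀ π, ∀ x ∈ A, retypeX n π x ∈ A) (j : Fin m) :
    m * μ (A ∩ {x | typ (x.1 n) = j}) = μ A := by
  have hle : ∀ i j, μ (A ∩ {x | typ (x.1 n) = i}) ≤ μ (A ∩ {x | typ (x.1 n) = j}) := by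
    intro i j
    rw [← (hμ n (Equiv.swap i j)).measure_preimage
      (hA.inter (measurableSet_typ_eq n j)).nullMeasurableSet]
    refine measure_mono fun x hx => ⟨hn _ x hx.1, ?_⟩
    have h : typ (x.1 n) = i := hx.2
    show typ (retype n (Equiv.swap i j) x.1 n) = j
    rw [typ_retype_self, h, Equiv.swap_apply_left]
  have h1 : μ A = ∑ i : Fin m, μ (A ∩ {x | typ (x.1 n) = i}) := by
    rw [← measure_biUnion_finset _ fun a _ => hA.inter (measurableSet_typ_eq n a)]
    · congr 1; ext y; simp
    · intro a _ b _ hab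
      exact Set.disjoint_left.2 fun y hy hy' => hab (hy.2.symm.trans hy'.2)
  rw [h1, Finset.sum_congr rfl fun i _ => le_antisymm (hle i j) (hle j i)]
  simp

/-! ### Cylinders under a measure that does not see types -/

/-- The number of independent types in the window `[r, r + N)`. -/
def freeTypes (z : ℤ → Bool) (r : ℤ) : ℕ → ℕ
  | 0 => 0
  | N + 1 => freeTypes z r N + open Classical in if ∃ l ≥ r, Matched z l (r + N) then 0 else 1

/-- With v the least height in the window, W(r) − v closing and W(r + N) − v opening brackets have
no partner inside it. The rest form pairs, each with one free type. So the count depends only on the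
end heights and the minimum. -/
theorem two_mul_freeTypes {z : ℤ → Bool} {r : ℤ} {N : ℕ} {v : ℤ}
    (h : ∀ k, r ≤ k → k ≤ r + N → v ≤ zWalk z k) (h' : ∃ k, r ≤ k ∧ k ≤ r + N ∧ zWalk z k = v) :
    2 * (freeTypes z r N : ℤ) = N + zWalk z (r + N) + zWalk z r - 2 * v := by
  classical
  induction N generalizing v with
  | zero =>
    obtain ⟨k, hk, hk', rfl⟩ := h'
    obtain rfl : k = r := by push_cast at hk'; omega
    simp [freeTypes]; ring
  | succ N ih =>
    obtain ⟨k, hk, hk', hkv⟩ := h'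
    simp only [freeTypes]
    obtain ⟨n, hn⟩ : ∃ n, n = r + N := ⟨_, rfl⟩
    rw [← hn] at ih ⊢
    rw [show r + ((N + 1 : ℕ) : ℤ) = n + 1 by rw [hn]; push_cast; ring] at hk' h ⊢
    by_cases hex : ∃ l ≥ r, Matched z l n
    · rw [if_pos hex]
      obtain ⟨l, hl, hM⟩ := hex
      have hW := zWalk_succ_false hM.right
      have := ih (v := v) (fun j hj hj' => h j hj (by omega)) (by
        rcases hk'.lt_or_eq with hlt | rfl
        · exact ⟨k, hk, by omega, hkv⟩
        · exact ⟨l, hl, hM.1, by rw [← hM.2.1, hkv]⟩)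
      push_cast
      omega
    · rw [if_neg hex]
      cases hz : z n
      · have hW := zWalk_succ_false hz
        -- A closing bracket with no partner in the window reaches a new strict minimum.
        have hlow : ∀ j, r ≤ j → j ≤ n → zWalk z (n + 1) < zWalk z j := by
          intro j hj hj'
          by_contra hcon
          have hjn : j < n := by
            rcases hj'.lt_or_eq with h | rfl
            · exact h
            · omega
          have hE := eps_isGreatest (z := z) (n := n) ⟨j, hjn, not_lt.1 hcon⟩
          exact hex ⟨eps z n, hj.trans (hE.2 ⟨hjn, not_lt.1 hcon⟩),
            matched_eps hz ⟨j, hjn, not_lt.1 hcon⟩⟩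
        have hkn : k = n + 1 := by
          by_contra hne
          have := hlow k hk (by omega)
          have := h (n + 1) (by omega) le_rfl
          omega
        have := ih (v := zWalk z n) (fun j hj hj' => by have := hlow j hj hj'; omega)
          ⟨n, by omega, le_rfl, rfl⟩
        rw [← hkv, hkn]
        push_cast
        omega
      · have hW := zWalk_succ_true hz
        have hkn : k ≤ n := by
          by_contra hne
          obtain rfl : k = n + 1 := by omega
          have := h n (by omega) (by omega)
          omega
        have := ih (v := v) (fun j hj hj' => h j hj (by omega)) ⟨k, hk, hkn, hkv⟩
        push_cast
        omega

/-- The sequences which agree with `x` on `[r, r + N)`. -/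
def window {S : Type*} (r : ℤ) (N : ℕ) (x : ℤ → S) : Set (ℤ → S) :=
  {y | ∀ i, r ≤ i → i < r + N → y i = x i}

theorem measurableSet_window {S : Type*} [MeasurableSpace S] [DiscreteMeasurableSpace S]
    (r : ℤ) (N : ℕ) (x : ℤ → S) : MeasurableSet (window r N x) := by
  have h : window r N x = {y | ∀ i ∈ Finset.Ico r (r + N), y (id i) = x i} := by
    ext y; simp [window]
  rw [h]
  exact measurableSet_coords _ _ _

theorem centralCylinder_eq_window {S : Type*} (N : ℕ) (x : ℤ → S) :
    centralCylinder N x = window (-N) (2 * N + 1) x := by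
  ext y
  simp only [centralCylinder, window, Set.mem_ofPred_eq, abs_le]
  refine forall_congr' fun k => ⟨fun h hk hk' => h ⟨hk, by push_cast at hk'; omega⟩, fun h hk =>
    h hk.1 (by push_cast; omega)⟩

theorem window_succ {S : Type*} (r : ℤ) (N : ℕ) (x : ℤ → S) :
    window r (N + 1) x = window r N x ∩ {y | y (r + N) = x (r + N)} := by
  ext y
  constructor
  · intro h
    exact ⟨fun i hi hi' => h i hi (by push_cast; omega), h _ (by omega) (by push_cast; omega)⟩
  · rintro ⟨h, h'⟩ i hi hi'
    rcases (show i ≤ r + N by push_cast at hi'; omega).lt_or_eq with hlt | rfl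
    · exact h i hi hlt
    · exact h'

/-- Letters are revealed from left to right. A letter whose partner was already seen has a forced
type; any other one can be retyped without touching the revealed letters, so its type is uniform. -/
theorem TypeSymmetric.pow_mul_measure_window (hμ : TypeSymmetric μ) (x : X m) (r : ℤ) (N : ℕ)
    {E : Set (ℤ → Bool)} (hE : MeasurableSet E) :
    (m : ENNReal) ^ freeTypes (pattern x.1) r N *
      μ {y | y.1 ∈ window r N x.1 ∧ pattern y.1 ∈ E} =
      μ {y | pattern y.1 ∈ window r N (pattern x.1) ∩ E} := by
  classical
  have hpm : Measurable fun y : X m => pattern y.1 :=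
    measurable_pattern.comp measurable_subtype_coe
  induction N generalizing E with
  | zero =>
    simp only [freeTypes, pow_zero, one_mul]
    congr 1
    ext y
    simp only [window, Set.mem_ofPred_eq, Set.mem_inter_iff]
    refine and_congr_left fun _ => ⟨fun _ i hi hi' => ?_, fun _ i hi hi' => ?_⟩ <;>
    · push_cast at hi'; omega
  | succ N ih =>
    obtain ⟨n, hn⟩ : ∃ n, n = r + N := ⟨_, rfl⟩
    -- The free set E in the statement is there for this step: it carries the pattern at n while the
    -- induction treats the shorter window.
    let E' : Set (ℤ → Bool) := E ∩ {z | z n = pattern x.1 n}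
    have hE' : MeasurableSet E' := hE.inter (measurableSet_apply_eq _ _)
    have hR : {y : X m | pattern y.1 ∈ window r (N + 1) (pattern x.1) ∩ E}
        = {y | pattern y.1 ∈ window r N (pattern x.1) ∩ E'} := by
      ext y
      simp only [window_succ, Set.mem_ofPred_eq, Set.mem_inter_iff, E', hn]
      tauto
    rw [hR, ← ih hE']
    simp only [freeTypes, ← hn]
    set A : Set (X m) := {y | y.1 ∈ window r N x.1 ∧ pattern y.1 ∈ E'} with hAdef
    have hA : MeasurableSet A :=
      (measurable_subtype_coe (measurableSet_window r N x.1)).inter (hpm hE')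
    have hagree : ∀ y ∈ A, ∀ i, r ≤ i → i ≤ n → pattern y.1 i = pattern x.1 i := by
      intro y hy i hi hi'
      rcases hi'.lt_or_eq with h | rfl
      · exact congrArg Sum.isLeft (hy.1 i hi (by omega))
      · exact hy.2.2
    have hL : {y : X m | y.1 ∈ window r (N + 1) x.1 ∧ pattern y.1 ∈ E}
        = A ∩ {y | typ (y.1 n) = typ (x.1 n)} := by
      ext y
      simp only [window_succ, ← hn, Set.mem_ofPred_eq, Set.mem_inter_iff, E', hAdef]
      constructor
      · rintro ⟨⟨h1, h2⟩, h3⟩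
        exact ⟨⟨h1, h3, congrArg Sum.isLeft h2⟩, congrArg typ h2⟩
      · rintro ⟨⟨h1, h3, h4⟩, h5⟩
        exact ⟨⟨h1, letter_ext h4 h5⟩, h3⟩
    rw [hL]
    by_cases hex : ∃ l ≥ r, Matched (pattern x.1) l n
    · rw [if_pos hex, add_zero]
      obtain ⟨l, hl, hM⟩ := hex
      congr 2
      refine Set.inter_eq_left.2 fun y hy => ?_
      have hM' : Matched (pattern y.1) l n :=
        hM.congr fun i hi hi' => (hagree y hy i (by omega) hi').symm
      show typ (y.1 n) = typ (x.1 n)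
      rw [← typ_eq_of_matched y.2 hM', ← typ_eq_of_matched x.2 hM,
        hy.1 l hl (by have := hM.lt; omega)]
    · rw [if_neg hex, pow_succ, mul_assoc]
      congr 1
      refine hμ.mul_measure_typ hA (fun π y hy => ⟨fun i hi hi' => ?_, ?_⟩) _
      · have hnp : ¬ Partner (pattern y.1) n i := by
          rintro (h | h | h)
          · omega
          · exact hex ⟨i, hi, h.congr fun j hj hj' => hagree y hy j (by omega) hj'⟩
          · have := h.lt; omega
        exact (retype_of_not_partner π hnp).trans (hy.1 i hi hi')
      · rw [pattern_retypeX]; exact hy.2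

/-- By `pow_mul_measure_window`, the measure of a cylinder is a function of the law of the pattern.
-/
theorem TypeSymmetric.ext [NeZero m] {ν : Measure (X m)} [IsProbabilityMeasure μ]
    [IsProbabilityMeasure ν] (hμ : TypeSymmetric μ) (hν : TypeSymmetric ν)
    (h : μ.map (fun x => pattern x.1) = ν.map fun x => pattern x.1) : μ = ν := by
  have hpm : Measurable fun y : X m => pattern y.1 :=
    measurable_pattern.comp measurable_subtype_coe
  have hval : MeasurableEmbedding (Subtype.val : X m → ℤ → Letter m) :=
    .subtype_coe measurableSet_shiftSet
  have hZ (ρ : Measure (X m)) : ρ.map Subtype.val (shiftSet m)ᶜ = 0 := by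
    rw [hval.map_apply]
    convert measure_empty (μ := ρ)
    ext y; simp
  have hmap : μ.map (Subtype.val : X m → ℤ → Letter m) = ν.map Subtype.val := by
    have := Measure.isProbabilityMeasure_map (μ := μ) hval.measurable.aemeasurable
    have := Measure.isProbabilityMeasure_map (μ := ν) hval.measurable.aemeasurable
    refine ext_of_centralCylinder (hZ μ) (hZ ν) fun x hx N => ?_
    have hx : x ∈ shiftSet m := not_not.1 hx
    rw [hval.map_apply, hval.map_apply, centralCylinder_eq_window]
    have h1 := hμ.pow_mul_measure_window ⟨x, hx⟩ (-N) (2 * N + 1) MeasurableSet.univ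
    have h2 := hν.pow_mul_measure_window ⟨x, hx⟩ (-N) (2 * N + 1) MeasurableSet.univ
    have h3 := congrArg (fun ρ => ρ (window (-N) (2 * N + 1) (pattern x))) h
    simp only [Measure.map_apply hpm (measurableSet_window _ _ _)] at h3
    simp only [Set.mem_univ, and_true, Set.inter_univ] at h1 h2
    have h4 := (h1.trans h3).trans h2.symm
    refine (ENNReal.mul_right_inj ?_ ?_).1 h4
    · exact pow_ne_zero _ (by exact_mod_cast NeZero.ne m)
    · exact ENNReal.pow_ne_top (ENNReal.natCast_ne_top m)
  refine Measure.ext fun A _ => ?_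
  have := congrArg (fun ρ => ρ (Subtype.val '' A)) hmap
  simpa only [hval.map_apply, Set.preimage_image_eq _ Subtype.val_injective] using this

end Dyck

namespace Dyck

variable {m : ℕ}

/-! ### Exchange of two neighbouring brackets -/

/-- The patterns agree except that `z` has `10` and `z'` has `01` at the positions `k, k + 1`. -/
structure Exchange (k : ℤ) (z z' : ℤ → Bool) : Prop where
  left : z k = true
  right : z (k + 1) = false
  left' : z' k = false
  right' : z' (k + 1) = true
  agree : ∀ i, i ≠ k → i ≠ k + 1 → z i = z' i

namespace Exchange

variable {k : ℤ} {z z' : ℤ → Bool}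

theorem heights (h : Exchange k z z') : ∃ C, (∀ i, i ≠ k + 1 → zWalk z' i = zWalk z i + C) ∧
    zWalk z' (k + 1) = zWalk z k - 1 + C ∧ zWalk z (k + 1) = zWalk z k + 1 := by
  have h1 := zWalk_succ_true h.left
  have h2 := zWalk_succ_false h.right
  have h3 := zWalk_succ_false h.left'
  have h4 := zWalk_succ_true h.right'
  refine ⟨zWalk z' k - zWalk z k, fun i hi => ?_, by omega, h1⟩
  rcases lt_or_gt_of_ne hi with hlt | hlt
  · have := zWalk_sub_congr (z := z) (z' := z') (a := i) (b := k) (by omega)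
      fun j hj hj' => h.agree j (by omega) (by omega)
    omega
  · have := zWalk_sub_congr (z := z) (z' := z') (a := k + 1 + 1) (b := i) (by omega)
      fun j hj hj' => h.agree j (by omega) (by omega)
    omega

theorem matched_self (h : Exchange k z z') : Matched z k (k + 1) := by
  have h1 := zWalk_succ_true h.left
  have h2 := zWalk_succ_false h.right
  refine ⟨by omega, by omega, fun j hj hj' => ?_⟩
  obtain rfl : j = k + 1 := by omega
  omega

theorem matched_of (h : Exchange k z z') {i j : ℤ} (hM : Matched z' i j) (hi : i ≠ k + 1)
    (hik : i ≠ k) (hj : j ≠ k) : Matched z i j := by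
  obtain ⟨C, h1, h2, h3⟩ := h.heights
  have hij := hM.lt
  have e1 := h1 i hi
  have e2 := h1 (j + 1) (by omega)
  have e3 := hM.2.1
  refine ⟨hM.1, by omega, fun p hp hp' => ?_⟩
  by_cases hpk : p = k + 1
  · subst hpk
    have := hM.2.2 k (by omega) (by omega)
    have := h1 k (by omega)
    omega
  · have := hM.2.2 p hp hp'
    have := h1 p hpk
    omega

/-- Only the height at k + 1 differs, up to an additive constant. Turning the valley into a peak
fuses the pairs that meet there. -/
theorem matched_trans (h : Exchange k z z') {i j : ℤ} (hM : Matched z' i k)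
    (hM' : Matched z' (k + 1) j) : Matched z i j := by
  obtain ⟨C, h1, h2, h3⟩ := h.heights
  have hij := hM.lt
  have hij' := hM'.lt
  have e1 := h1 i (by omega)
  have e2 := h1 (j + 1) (by omega)
  have e3 := hM.2.1
  have e4 := hM'.2.1
  refine ⟨by omega, by omega, fun p hp hp' => ?_⟩
  rcases lt_trichotomy p (k + 1) with hlt | rfl | hlt
  · have := hM.2.2 p hp (by omega)
    have := h1 p (by omega)
    omega
  · have := hM.2.2 k (by omega) (by omega)
    have := h1 k (by omega)
    omega
  · have := hM'.2.2 p hlt hp'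
    have := h1 p (by omega)
    omega

/-- A pair survives the exchange unless the new valley reaches down to its height, and then it
splits in two at the valley. -/
theorem matched_or (h : Exchange k z z') {i j : ℤ} (hM : Matched z i j) (hi : i ≠ k + 1)
    (hik : i ≠ k) (hj : j ≠ k) :
    Matched z' i j ∨ (Matched z' i k ∧ Matched z' (k + 1) j) := by
  obtain ⟨C, h1, h2, h3⟩ := h.heights
  have hij := hM.lt
  have e1 := h1 i hi
  have e2 := h1 (j + 1) (by omega)
  have e3 := hM.2.1
  by_cases hin : i < k + 1 ∧ k + 1 ≤ j ∧ zWalk z k - 1 ≤ zWalk z i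
  · obtain ⟨ha, hb, hc⟩ := hin
    have hd := hM.2.2 k (by omega) (by omega)
    right
    refine ⟨⟨by omega, by omega, fun p hp hp' => ?_⟩, hb, by omega, fun p hp hp' => ?_⟩
    · have := hM.2.2 p hp (by omega)
      have := h1 p (by omega)
      omega
    · have := hM.2.2 p (by omega) hp'
      have := h1 p (by omega)
      omega
  · left
    refine ⟨hM.1, by omega, fun p hp hp' => ?_⟩
    by_cases hpk : p = k + 1
    · subst hpk
      omega
    · have := hM.2.2 p hp hp'
      have := h1 p hpk
      omega

end Exchange

/-- Replace the letters at the positions `k, k + 1`. -/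
def put (k : ℤ) (a b : Letter m) (x : ℤ → Letter m) : ℤ → Letter m :=
  Function.update (Function.update x k a) (k + 1) b

theorem put_left (k : ℤ) (a b : Letter m) (x : ℤ → Letter m) : put k a b x k = a := by
  simp [put]

theorem put_right (k : ℤ) (a b : Letter m) (x : ℤ → Letter m) : put k a b x (k + 1) = b := by
  simp [put]

theorem put_of_ne {k i : ℤ} (a b : Letter m) (x : ℤ → Letter m) (h : i ≠ k) (h' : i ≠ k + 1) :
    put k a b x i = x i := by
  simp [put, h, h']

theorem eq_put {k : ℤ} {a b : Letter m} {x y : ℤ → Letter m} (h : y k = a) (h' : y (k + 1) = b)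
    (hxy : ∀ i, i ≠ k → i ≠ k + 1 → x i = y i) : put k a b x = y := by
  funext i
  by_cases hi : i = k
  · subst hi; rw [put_left, h]
  by_cases hi' : i = k + 1
  · subst hi'; rw [put_right, h']
  rw [put_of_ne _ _ _ hi hi', hxy i hi hi']

theorem put_put (k : ℤ) (a b a' b' : Letter m) (x : ℤ → Letter m) :
    put k a b (put k a' b' x) = put k a b x :=
  eq_put (put_left ..) (put_right ..) fun i hi hi' => by
    rw [put_of_ne _ _ _ hi hi', put_of_ne _ _ _ hi hi']

/-- The pattern `x` after `01` has been put at `k, k + 1`. -/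
def valley (k : ℤ) (z : ℤ → Bool) : ℤ → Bool :=
  Function.update (Function.update z k false) (k + 1) true

/-- Replace `αβ` at `k, k + 1` by `βα`, with the type forced by the prefix. -/
def toValley (k : ℤ) (x : ℤ → Letter m) : ℤ → Letter m :=
  put k (β (typ (x (eps (valley k (pattern x)) k)))) (α (typ (x (eps (valley k (pattern x)) k)))) x

theorem pattern_put_valley (k : ℤ) (a b : Fin m) (x : ℤ → Letter m) :
    pattern (put k (β a) (α b) x) = valley k (pattern x) := by
  funext i
  by_cases hi' : i = k + 1
  · subst hi'; simp [pattern, put_right, valley]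
  by_cases hi : i = k
  · subst hi; simp [pattern, put_left, valley]
  simp [pattern, put_of_ne _ _ _ hi hi', valley, hi, hi']

theorem exchange_valley {k : ℤ} {z : ℤ → Bool} (h : z k = true) (h' : z (k + 1) = false) :
    Exchange k z (valley k z) where
  left := h
  right := h'
  left' := by simp [valley]
  right' := by simp [valley]
  agree i hi hi' := by simp [valley, hi, hi']

theorem exchange_put_peak (k : ℤ) (a b : Fin m) {x : ℤ → Letter m} (h : pattern x k = false)
    (h' : pattern x (k + 1) = true) :
    Exchange k (pattern (put k (α a) (β b) x)) (pattern x) where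
  left := by simp [pattern, put_left]
  right := by simp [pattern, put_right]
  left' := h
  right' := h'
  agree i hi hi' := by simp [pattern, put_of_ne _ _ _ hi hi']

theorem Exchange.valley_eq {k : ℤ} {z z' : ℤ → Bool} (h : Exchange k z z') :
    valley k z = z' := by
  funext i
  by_cases hi' : i = k + 1
  · subst hi'; simp [valley, h.right']
  by_cases hi : i = k
  · subst hi; simp [valley, h.left']
  simp [valley, hi, hi', h.agree]

theorem Exchange.LU_iff {k : ℤ} {z z' : ℤ → Bool} (h : Exchange k z z') : LU z ↔ LU z' :=
  ⟨fun hz => hz.congr (n := k) fun i hi => h.agree i (by omega) (by omega),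
    fun hz => hz.congr (n := k) fun i hi => (h.agree i (by omega) (by omega)).symm⟩

/-- Under `LU` the new closing bracket at k has a partner e. If the new opening bracket at k + 1
closes at j, then e and j were matched in x, so giving both new letters the type at e is consistent.
-/
theorem toValley_mem {k : ℤ} {x : ℤ → Letter m} (hx : x ∈ shiftSet m) (hLU : LU (pattern x))
    (h : pattern x k = true) (h' : pattern x (k + 1) = false) : toValley k x ∈ shiftSet m := by
  have hE := exchange_valley h h'
  have hk := (hE.LU_iff.1 hLU).matched hE.left'
  rw [mem_shiftSet_iff]
  intro i j hM
  have hM : Matched (valley k (pattern x)) i j := by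
    rwa [toValley, pattern_put_valley] at hM
  unfold toValley
  generalize eps (valley k (pattern x)) k = e at hk
  have hlt := hM.lt
  by_cases hjk : j = k
  · subst hjk
    obtain rfl := hM.eq_left hk
    rw [put_left, put_of_ne _ _ _ (by omega) (by omega)]; rfl
  have hik : i ≠ k := by
    rintro rfl
    exact absurd hM.left (by rw [hE.left']; simp)
  have hjk' : j ≠ k + 1 := by
    rintro rfl
    exact absurd hM.right (by rw [hE.right']; simp)
  rw [put_of_ne _ _ _ hjk hjk']
  by_cases hik' : i = k + 1
  · subst hik'
    rw [put_right, ← typ_eq_of_matched hx (hE.matched_trans hk hM)]; rfl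
  · rw [put_of_ne _ _ _ hik hik', typ_eq_of_matched hx (hE.matched_of hM hik' hik hjk)]

/-- The pairs meeting at the valley are fused into one; equality of the two types at k and k + 1 is
what makes the fused pair admissible. -/
theorem put_peak_mem {k : ℤ} {x : ℤ → Letter m} (hx : x ∈ shiftSet m) (a : Fin m)
    (h : pattern x k = false) (h' : pattern x (k + 1) = true)
    (ht : typ (x k) = typ (x (k + 1))) : put k (α a) (β a) x ∈ shiftSet m := by
  have hE := exchange_put_peak k a a h h'
  rw [mem_shiftSet_iff]
  intro i j hM
  by_cases hik : i = k
  · subst hik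
    obtain rfl := hM.eq_right hE.matched_self
    rw [put_left, put_right]; rfl
  have hjk' : j ≠ k + 1 := by
    rintro rfl
    exact hik (hM.eq_left hE.matched_self)
  have hjk : j ≠ k := by
    rintro rfl
    exact absurd hM.right (by rw [hE.left]; simp)
  have hik' : i ≠ k + 1 := by
    rintro rfl
    exact absurd hM.left (by rw [hE.right]; simp)
  rw [put_of_ne _ _ _ hik hik', put_of_ne _ _ _ hjk hjk']
  rcases hE.matched_or hM hik' hik hjk with h1 | ⟨h1, h2⟩
  · exact typ_eq_of_matched hx h1
  · rw [typ_eq_of_matched hx h1, ht, typ_eq_of_matched hx h2]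

theorem measurable_put {k : ℤ} {Ω : Type*} [MeasurableSpace Ω] {a b : Ω → Letter m}
    {x : Ω → ℤ → Letter m} (ha : Measurable a) (hb : Measurable b) (hx : Measurable x) :
    Measurable fun ω => put k (a ω) (b ω) (x ω) := by
  refine measurable_pi_lambda _ fun i => ?_
  by_cases hi : i = k
  · subst hi; simpa only [put_left]
  by_cases hi' : i = k + 1
  · subst hi'; simpa only [put_right]
  simp only [put_of_ne _ _ _ hi hi']
  exact (measurable_pi_apply i).comp hx

theorem measurable_valley (k : ℤ) : Measurable (valley k) := by
  refine measurable_pi_lambda _ fun i => ?_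
  by_cases hi' : i = k + 1
  · subst hi'; simp [valley]
  by_cases hi : i = k
  · subst hi; simp [valley]
  simp only [valley, Function.update_of_ne hi', Function.update_of_ne hi]
  exact measurable_pi_apply i

theorem measurable_toValley (k : ℤ) : Measurable (toValley k : (ℤ → Letter m) → _) := by
  have h : Measurable fun x : ℤ → Letter m => typ (x (eps (valley k (pattern x)) k)) :=
    (Measurable.of_discrete (f := typ)).comp (measurable_apply_of_countable
      ((measurable_eps k).comp ((measurable_valley k).comp measurable_pattern)) measurable_id)
  exact measurable_put ((Measurable.of_discrete (f := β)).comp h)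
    ((Measurable.of_discrete (f := α)).comp h) measurable_id

variable {μ : Measure (X m)}

/-- Peaks and valleys do not correspond directly: a peak has a free type of its own, while a valley
may have two unequal types. Fixing the type of the peak and requiring equal types in the valley
leaves a bijection, and each restriction keeps the fraction 1/m of the measure. -/
theorem IsInvariantProbability.measure_exchange [NeZero m] (hμ : IsInvariantProbability μ)
    (hLU : ∀ᵐ x ∂μ, LU (pattern x.1)) (k : ℤ) {E : Set (ℤ → Bool)} (hE : MeasurableSet E)
    (hEk : ∀ z z', Exchange k z z' → (z ∈ E ↔ z' ∈ E)) :
    μ {x | pattern x.1 ∈ E ∧ pattern x.1 k = true ∧ pattern x.1 (k + 1) = false} =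
      μ {x | pattern x.1 ∈ E ∧ pattern x.1 k = false ∧ pattern x.1 (k + 1) = true} := by
  have := hμ.isProbabilityMeasure
  have hpm : Measurable fun y : X m => pattern y.1 :=
    measurable_pattern.comp measurable_subtype_coe
  have hms (a b : Bool) : MeasurableSet
      {x : X m | (pattern x.1 ∈ E ∧ pattern x.1 k = a ∧ pattern x.1 (k + 1) = b) ∧
        LU (pattern x.1)} :=
    (((hpm hE).inter ((hpm (measurableSet_apply_eq k a)).inter
      (hpm (measurableSet_apply_eq (k + 1) b)))).inter (hpm (Measurable.setOf measurable_LU)))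
  have hae (a b : Bool) : μ {x | pattern x.1 ∈ E ∧ pattern x.1 k = a ∧ pattern x.1 (k + 1) = b}
      = μ {x : X m | (pattern x.1 ∈ E ∧ pattern x.1 k = a ∧ pattern x.1 (k + 1) = b) ∧
        LU (pattern x.1)} := by
    refine measure_congr ?_
    filter_upwards [hLU] with x hx
    exact propext ⟨fun h => ⟨h, hx⟩, fun h => h.1⟩
  rw [hae, hae]
  set P : Set (X m) := {x : X m | (pattern x.1 ∈ E ∧ pattern x.1 k = true ∧
    pattern x.1 (k + 1) = false) ∧ LU (pattern x.1)} with hP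
  set V : Set (X m) := {x : X m | (pattern x.1 ∈ E ∧ pattern x.1 k = false ∧
    pattern x.1 (k + 1) = true) ∧ LU (pattern x.1)} with hV
  let a : Fin m := 0
  let V' : Set (X m) := V ∩ {x | typ (x.1 k) = typ (x.1 (k + 1))}
  have hV' : MeasurableSet V' :=
    (hms _ _).inter (measurableSet_eq_fun (measurable_typ_apply k) (measurable_typ_apply (k + 1)))
  have hPa : MeasurableSet (P ∩ {x | typ (x.1 k) = a}) :=
    (hms _ _).inter (measurableSet_typ_eq k a)
  have key : μ (P ∩ {x | typ (x.1 k) = a}) = μ V' := by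
    refine hμ.measure_eq hPa hV' (measurable_toValley k)
      (measurable_put (k := k) (measurable_const (a := α a)) (measurable_const (a := β a))
        measurable_id) ?_ ?_ ?_ ?_ ?_
    · rintro x ⟨⟨⟨h1, h2, h3⟩, h4⟩, -⟩
      have hx := exchange_valley h2 h3
      refine ⟨toValley_mem x.2 h4 h2 h3, ⟨⟨?_, ?_, ?_⟩, ?_⟩, ?_⟩
      · simp only [toValley, pattern_put_valley]
        exact (hEk _ _ hx).1 h1
      · simp only [toValley, pattern_put_valley]
        exact hx.left'
      · simp only [toValley, pattern_put_valley]
        exact hx.right'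
      · simp only [toValley, pattern_put_valley]
        exact hx.LU_iff.1 h4
      · simp only [toValley, put_left, put_right, Set.mem_ofPred_eq]; rfl
    · rintro x ⟨⟨⟨h1, h2, h3⟩, h4⟩, h5⟩
      have hx := exchange_put_peak k a a h2 h3
      exact ⟨put_peak_mem x.2 a h2 h3 h5, ⟨⟨(hEk _ _ hx).2 h1, hx.left, hx.right⟩,
        hx.LU_iff.2 h4⟩, by simp only [put_left, Set.mem_ofPred_eq, id]; rfl⟩
    · rintro x ⟨⟨⟨h1, h2, h3⟩, h4⟩, h5⟩
      have hM := (exchange_valley h2 h3).matched_self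
      have h6 := (typ_eq_of_matched x.2 hM).symm.trans h5
      have h5 : typ (x.1 k) = a := h5
      refine (put_put ..).trans (eq_put ?_ ?_ fun _ _ _ => rfl)
      · rw [eq_α_of_isLeft h2, h5]
      · rw [eq_β_of_isLeft h3, h6]
    · rintro x ⟨⟨⟨h1, h2, h3⟩, h4⟩, h5⟩
      have h5 : typ (x.1 k) = typ (x.1 (k + 1)) := h5
      have hx := exchange_put_peak k a a h2 h3
      have hM := h4.matched h2
      have hlt := hM.lt
      show toValley k (put k (α a) (β a) x.1) = x.1
      unfold toValley
      rw [hx.valley_eq, put_of_ne (i := eps _ _) _ _ _ (by omega) (by omega),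
        typ_eq_of_matched x.2 hM, put_put]
      refine eq_put ?_ ?_ fun _ _ _ => rfl
      · exact eq_β_of_isLeft h2
      · rw [h5]; exact eq_α_of_isLeft h3
    · intro x _
      refine ⟨(|k| + 1).toNat, fun j hj => put_of_ne _ _ _ ?_ ?_⟩ <;>
      · intro h
        rw [h] at hj
        have := abs_add_le k 1
        rw [abs_one] at this
        omega
  have hcl (n : ℤ) (π : Equiv.Perm (Fin m)) (x : X m) (hx : x ∈ V) : retypeX n π x ∈ V := by
    simpa only [hV, Set.mem_ofPred_eq, pattern_retypeX] using hx
  have h1 : m * μ (P ∩ {x | typ (x.1 k) = a}) = μ P :=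
    hμ.typeSymmetric.mul_measure_typ (hms _ _) (fun π x hx => by
      simpa only [hP, Set.mem_ofPred_eq, pattern_retypeX] using hx) a
  -- In a valley k and k + 1 are not partners, so the letter at k + 1 can be retyped with the one at
  -- k fixed.
  have h2 : ∀ b, m * μ (V' ∩ {x | typ (x.1 k) = b}) = μ (V ∩ {x | typ (x.1 k) = b}) := by
    intro b
    rw [← hμ.typeSymmetric.mul_measure_typ (n := k + 1) (j := b)
      ((hms _ _).inter (measurableSet_typ_eq k b)) ?_]
    · congr 2
      ext x
      simp only [V', Set.mem_inter_iff, Set.mem_ofPred_eq]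
      constructor
      · rintro ⟨⟨h, h'⟩, h''⟩
        exact ⟨⟨h, h''⟩, h' ▸ h''⟩
      · rintro ⟨⟨h, h'⟩, h''⟩
        exact ⟨⟨h, h'.trans h''.symm⟩, h'⟩
    · rintro π x ⟨hx, hx'⟩
      refine ⟨hcl _ _ _ hx, ?_⟩
      show typ (retype (k + 1) π x.1 k) = b
      rw [retype_of_not_partner]
      · exact hx'
      · rintro (h | h | h)
        · omega
        · exact absurd h.left (by rw [hx.1.2.1]; simp)
        · have := h.lt; omega
  have hsum (A : Set (X m)) (hA : MeasurableSet A) :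
      μ A = ∑ b : Fin m, μ (A ∩ {x | typ (x.1 k) = b}) := by
    rw [← measure_biUnion_finset _ fun b _ => hA.inter (measurableSet_typ_eq k b)]
    · congr 1; ext y; simp
    · intro b _ c _ hbc
      exact Set.disjoint_left.2 fun y hy hy' => hbc (hy.2.symm.trans hy'.2)
  rw [← h1, key, hsum V (hms _ _), hsum V' hV', Finset.mul_sum]
  exact Finset.sum_congr rfl fun b _ => h2 b

end Dyck

namespace Dyck

variable {m : ℕ}

/-! ### Exchangeable laws of patterns -/

theorem Exchange.valley_eq' {k : ℤ} {z z' : ℤ → Bool} (h : Exchange k z z') :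
    valley k z' = z' := by
  funext i
  by_cases hi' : i = k + 1
  · subst hi'; simp [valley, h.right']
  by_cases hi : i = k
  · subst hi; simp [valley, h.left']
  simp [valley, hi, hi']

/-- Invariance of a law of sequences under a permutation of the coordinates. -/
def Symm {S : Type*} [MeasurableSpace S] (ν : Measure (ℤ → S)) (σ : Equiv.Perm ℤ) : Prop :=
  MeasurePreserving (fun (z : ℤ → S) i => z (σ i)) ν ν

theorem measurable_comp_perm {S : Type*} [MeasurableSpace S] (σ : Equiv.Perm ℤ) :
    Measurable fun (z : ℤ → S) i => z (σ i) :=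
  measurable_pi_lambda _ fun i => measurable_pi_apply (σ i)

theorem Symm.mul {S : Type*} [MeasurableSpace S] {ν : Measure (ℤ → S)} {σ τ : Equiv.Perm ℤ}
    (h : Symm ν σ) (h' : Symm ν τ) : Symm ν (σ * τ) :=
  MeasurePreserving.comp (g := fun (z : ℤ → S) i => z (τ i)) h' h

theorem Symm.swap {S : Type*} [MeasurableSpace S] {ν : Measure (ℤ → S)}
    (h : ∀ k, Symm ν (Equiv.swap k (k + 1))) (k l : ℤ) : Symm ν (Equiv.swap k l) := by
  have key : ∀ (n : ℕ) (k : ℤ), Symm ν (Equiv.swap k (k + n)) := by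
    intro n
    induction n with
    | zero =>
      intro k
      rw [Nat.cast_zero, add_zero, Equiv.swap_self]
      exact MeasurePreserving.id ν
    | succ n ih =>
      intro k
      rcases n.eq_zero_or_pos with rfl | hn
      · simpa using h k
      · have := Equiv.swap_mul_swap_mul_swap (x := k) (y := k + n) (z := k + n + 1)
          (by omega) (by omega)
        rw [Equiv.swap_comm (k + n + 1) k] at this
        push_cast
        rw [← add_assoc, ← this]
        exact ((h _).mul (ih k)).mul (h _)
  rcases le_total k l with hkl | hkl
  · have := key (l - k).toNat k
    rwa [show k + ((l - k).toNat : ℤ) = l by omega] at this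
  · have := key (k - l).toNat l
    rw [show l + ((k - l).toNat : ℤ) = k by omega] at this
    rwa [Equiv.swap_comm]

/-- Permutations of finite support are products of transpositions, and these are built from
neighbouring ones by conjugation. -/
theorem Symm.of_finite {S : Type*} [MeasurableSpace S] {ν : Measure (ℤ → S)}
    (h : ∀ k, Symm ν (Equiv.swap k (k + 1))) {σ : Equiv.Perm ℤ} (hσ : {i | σ i ≠ i}.Finite) :
    Symm ν σ := by
  have h1 : σ ∈ Subgroup.closure {τ : Equiv.Perm ℤ | τ.IsSwap} := by
    rw [mem_closure_isSwap']
    exact hσ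
  clear hσ
  induction h1 using Subgroup.closure_induction with
  | mem τ hτ =>
    obtain ⟨k, l, -, rfl⟩ := hτ
    exact Symm.swap h k l
  | one => exact MeasurePreserving.id ν
  | mul a b _ _ ha hb => exact ha.mul hb
  | inv a _ ha =>
    refine ⟨measurable_comp_perm _, ?_⟩
    conv_lhs => rw [← ha.map_eq]
    rw [Measure.map_map (measurable_comp_perm _) (measurable_comp_perm _)]
    convert Measure.map_id
    funext z i
    simp

/-- Reversal of the interval `[k, n]`. -/
def flipInterval (k n : ℤ) : Equiv.Perm ℤ :=
  Function.Involutive.toPerm (fun i => if k ≤ i ∧ i ≤ n then k + n - i else i) fun i => by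
    by_cases h : k ≤ i ∧ i ≤ n
    · simp only [h, and_self, if_true]
      rw [if_pos (by omega)]; omega
    · simp only [h, if_false]

theorem flipInterval_of_mem {k n i : ℤ} (h : k ≤ i) (h' : i ≤ n) :
    flipInterval k n i = k + n - i := if_pos ⟨h, h'⟩

theorem flipInterval_of_lt {k n i : ℤ} (h : i < k) : flipInterval k n i = i :=
  if_neg (by omega)

theorem zWalk_flipInterval (z : ℤ → Bool) {k n j : ℤ} (hj : k ≤ j) (hj' : j ≤ n + 1) :
    zWalk (fun i => z (flipInterval k n i)) j - zWalk (fun i => z (flipInterval k n i)) k =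
      zWalk z (n + 1) - zWalk z (k + n + 1 - j) := by
  induction j, hj using Int.leInduction with
  | base => rw [show k + n + 1 - k = n + 1 by ring]; simp
  | succ j hj ih =>
    have h1 := ih (by omega)
    have h2 := zWalk_succ (fun i => z (flipInterval k n i)) j
    have h3 := zWalk_succ z (k + n - j)
    simp only [flipInterval_of_mem hj (show j ≤ n by omega)] at h2
    rw [show k + n - j + 1 = k + n + 1 - j by ring] at h3
    rw [show k + n + 1 - (j + 1) = k + n - j by ring]
    omega

/-- An opening bracket at k closes at some n. Reversing the word on [k, n] preserves the law and
turns the excursion upside down: it starts with a closing bracket and first returns to its initial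
height at n + 1. Since n is thus determined by the image, the images for different n are disjoint
parts of the right-hand event. -/
theorem measure_true_le_of_reversal {ν : Measure (ℤ → Bool)} (h : ∀ k n, Symm ν (flipInterval k n))
    (hRU : ∀ᵐ z ∂ν, RU z) (k : ℤ) {C : Set (ℤ → Bool)} (hC : MeasurableSet C)
    (hCk : ∀ z z' : ℤ → Bool, (∀ i < k, z i = z' i) → z ∈ C → z' ∈ C) :
    ν (C ∩ {z | z k = true}) ≤ ν (C ∩ {z | z k = false}) := by
  have hm (n : ℤ) : MeasurableSet (C ∩ {z | Matched z k n}) :=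
    hC.inter (Measurable.setOf (by fun_prop))
  let D (n : ℤ) : Set (ℤ → Bool) :=
    (fun z i => z (flipInterval k n i)) ⁻¹' (C ∩ {z | Matched z k n})
  have hD : ∀ n, ∀ z ∈ D n, k < n ∧ zWalk z (n + 1) = zWalk z k ∧
      ∀ j, k < j → j ≤ n → zWalk z j < zWalk z k := by
    rintro n z ⟨-, hM⟩
    have hM : Matched (fun i => z (flipInterval k n i)) k n := hM
    have hlt := hM.lt
    have h1 := zWalk_flipInterval z (k := k) (n := n) (j := n + 1) (by omega) le_rfl
    rw [show k + n + 1 - (n + 1) = k by ring, hM.2.1] at h1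
    refine ⟨hlt, by omega, fun j hj hj' => ?_⟩
    have h2 := zWalk_flipInterval z (k := k) (n := n) (j := k + n + 1 - j) (by omega) (by omega)
    rw [show k + n + 1 - (k + n + 1 - j) = j by ring] at h2
    have := hM.2.2 (k + n + 1 - j) (by omega) (by omega)
    omega
  calc ν (C ∩ {z | z k = true}) ≤ ν (⋃ n, C ∩ {z | Matched z k n}) := by
        refine measure_mono_ae ?_
        filter_upwards [hRU] with z hz hz'
        obtain ⟨n, hn⟩ := hz.matched hz'.2
        exact Set.mem_iUnion.2 ⟨n, hz'.1, hn⟩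
    _ ≤ ∑' n, ν (C ∩ {z | Matched z k n}) := measure_iUnion_le _
    _ = ∑' n, ν (D n) :=
        tsum_congr fun n => ((h k n).measure_preimage (hm n).nullMeasurableSet).symm
    _ = ν (⋃ n, D n) := by
        refine (measure_iUnion (fun n n' hne => ?_) fun n => measurable_comp_perm _ (hm n)).symm
        refine Set.disjoint_left.2 fun z hz hz' => ?_
        obtain ⟨h1, h2, h3⟩ := hD n z hz
        obtain ⟨h1', h2', h3'⟩ := hD n' z hz'
        rcases lt_or_gt_of_ne hne with hlt | hlt
        · have := h3' (n + 1) (by omega) (by omega); omega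
        · have := h3 (n' + 1) (by omega) (by omega); omega
    _ ≤ ν (C ∩ {z | z k = false}) := by
        refine measure_mono (Set.iUnion_subset fun n z hz => ⟨?_, ?_⟩)
        · exact hCk _ _ (fun i hi => congrArg z (flipInterval_of_lt hi)) hz.1
        · obtain ⟨h1, h2, h3⟩ := hD n z hz
          have := h3 (k + 1) (by omega) (by omega)
          show z k = false
          by_contra hcon
          rw [zWalk_succ_true (by simpa using hcon)] at this
          omega

/-- A transposition carries coordinate k beyond all of s, so that the conditioning concerns only the
past. -/
theorem measure_coords_true_le {ν : Measure (ℤ → Bool)}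
    (h : ∀ k, Symm ν (Equiv.swap k (k + 1))) (hRU : ∀ᵐ z ∂ν, RU z) {s : Finset ℤ} {k : ℤ}
    (hk : k ∉ s) (w : ℤ → Bool) :
    ν ({z | ∀ i ∈ s, z i = w i} ∩ {z | z k = true}) ≤
      ν ({z | ∀ i ∈ s, z i = w i} ∩ {z | z k = false}) := by
  obtain ⟨b, hb⟩ := s.bddAbove
  have hb : ∀ i ∈ s, i ≤ b := fun i hi => hb hi
  have hC : MeasurableSet {z : ℤ → Bool | ∀ i ∈ s, z i = w i} := measurableSet_coords s id w
  have hmove (a : Bool) : ν ({z | ∀ i ∈ s, z i = w i} ∩ {z | z k = a})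
      = ν ({z | ∀ i ∈ s, z i = w i} ∩ {z | z (b + 1) = a}) := by
    rw [← (Symm.swap h k (b + 1)).measure_preimage
      (hC.inter (measurableSet_apply_eq _ _)).nullMeasurableSet]
    congr 1
    ext z
    simp only [Set.mem_inter_iff, Set.mem_ofPred_eq, Set.mem_preimage, Equiv.swap_apply_left]
    refine and_congr_left fun _ => forall₂_congr fun i hi => ?_
    have := hb i hi
    rw [Equiv.swap_apply_of_ne_of_ne (a := k) (b := b + 1) (x := i)
      (by rintro rfl; exact hk hi) (by omega)]
  rw [hmove, hmove]
  refine measure_true_le_of_reversal (fun k n => Symm.of_finite h ?_) hRU _ hC fun z z' hz hzC i hi =>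
    ?_
  · refine (Set.finite_Icc k n).subset fun i hi => ?_
    by_contra hcon
    exact hi (if_neg hcon)
  · rw [← hz i (by have := hb i hi; omega), hzC i hi]

variable {μ : Measure (X m)}

/-- Patterns with equal values at k and k + 1 are fixed by the swap, and `measure_exchange`
interchanges the remaining two classes. -/
theorem IsInvariantProbability.symm_swap_succ [NeZero m] (hμ : IsInvariantProbability μ)
    (hLU : ∀ᵐ x ∂μ, LU (pattern x.1)) (k : ℤ) :
    Symm (μ.map fun x => pattern x.1) (Equiv.swap k (k + 1)) := by
  have hpm : Measurable fun y : X m => pattern y.1 :=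
    measurable_pattern.comp measurable_subtype_coe
  obtain ⟨f, hf⟩ : ∃ f : (ℤ → Bool) → (ℤ → Bool), f = fun z i => z (Equiv.swap k (k + 1) i) :=
    ⟨_, rfl⟩
  have hfm : Measurable f := hf ▸ measurable_comp_perm _
  have hfl : ∀ z, f z k = z (k + 1) := by simp [hf]
  have hfr : ∀ z, f z (k + 1) = z k := by simp [hf]
  have hfo : ∀ z i, i ≠ k → i ≠ k + 1 → f z i = z i := fun z i h h' => by
    simp [hf, Equiv.swap_apply_of_ne_of_ne h h']
  have hff : ∀ z, f (f z) = z := by intro z; funext i; simp [hf]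
  have hfE : ∀ z, z k = true → z (k + 1) = false → Exchange k z (f z) := fun z h h' =>
    ⟨h, h', by rw [hfl, h'], by rw [hfr, h], fun i hi hi' => (hfo z i hi hi').symm⟩
  have hex {A : Set (ℤ → Bool)} (hA : MeasurableSet A) :
      μ {x | f (pattern x.1) ∈ A ∧ pattern x.1 k = true ∧ pattern x.1 (k + 1) = false} =
        μ {x | pattern x.1 ∈ A ∧ pattern x.1 k = false ∧ pattern x.1 (k + 1) = true} := by
    -- The preimage of A under `valley k` depends only on the other coordinates, hence is stable
    -- under exchange; it means f z ∈ A on peaks and z ∈ A on valleys.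
    convert hμ.measure_exchange hLU k (measurable_valley k hA) (fun z z' h => ?_) using 2
    · ext x
      refine and_congr_left fun h => ?_
      rw [Set.mem_preimage, (hfE _ h.1 h.2).valley_eq]
    · ext x
      refine and_congr_left fun h => ?_
      have := (hfE (f (pattern x.1)) (by rw [hfl, h.2]) (by rw [hfr, h.1])).valley_eq'
      rw [hff] at this
      rw [Set.mem_preimage, this]
    · rw [Set.mem_preimage, Set.mem_preimage, h.valley_eq, h.valley_eq']
  have hsplit (A : Set (ℤ → Bool)) (hA : MeasurableSet A) : μ {x | pattern x.1 ∈ A} =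
      μ {x | pattern x.1 ∈ A ∧ pattern x.1 k = pattern x.1 (k + 1)} +
      (μ {x | pattern x.1 ∈ A ∧ pattern x.1 k = true ∧ pattern x.1 (k + 1) = false} +
        μ {x | pattern x.1 ∈ A ∧ pattern x.1 k = false ∧ pattern x.1 (k + 1) = true}) := by
    have hm (a b : Bool) : MeasurableSet
        {x : X m | pattern x.1 ∈ A ∧ pattern x.1 k = a ∧ pattern x.1 (k + 1) = b} :=
      (hpm hA).inter ((hpm (measurableSet_apply_eq k a)).inter
        (hpm (measurableSet_apply_eq (k + 1) b)))
    rw [← measure_union _ (hm _ _), ← measure_union _ ((hm _ _).union (hm _ _))]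
    · congr 1
      ext x
      simp only [Set.mem_union, Set.mem_ofPred_eq]
      cases pattern x.1 k <;> cases pattern x.1 (k + 1) <;> simp
    · refine Set.disjoint_left.2 fun x hx hx' => ?_
      have h1 := hx.2
      rcases hx' with h | h <;> rw [h.2.1, h.2.2] at h1 <;> simp at h1
    · refine Set.disjoint_left.2 fun x hx hx' => ?_
      have h1 := hx.2.1
      rw [hx'.2.1] at h1; simp at h1
  refine ⟨measurable_comp_perm _, ?_⟩
  rw [← hf]
  refine Measure.ext fun A hA => ?_
  rw [Measure.map_apply hfm hA, Measure.map_apply hpm (hfm hA), Measure.map_apply hpm hA]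
  show μ {x | pattern x.1 ∈ f ⁻¹' A} = μ {x | pattern x.1 ∈ A}
  rw [hsplit _ (hfm hA), hsplit _ hA]
  have h1 := hex hA
  have h2 := hex (hfm hA)
  simp only [Set.mem_preimage, hff] at h2 ⊢
  rw [h1, ← h2]
  congr 1
  · congr 1
    ext x
    refine and_congr_left fun h => ?_
    have : f (pattern x.1) = pattern x.1 := by
      funext i
      by_cases hi : i = k
      · subst hi; rw [hfl, h]
      by_cases hi' : i = k + 1
      · subst hi'; rw [hfr, h]
      exact hfo _ i hi hi'
    rw [this]
  · exact add_comm _ _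

theorem measurable_mirror : Measurable mirror :=
  measurable_pi_lambda _ fun i =>
    (Measurable.of_discrete (f := not)).comp (measurable_pi_apply (-1 - i))

theorem IsInvariantProbability.map_pattern_true_le [NeZero m] (hμ : IsInvariantProbability μ)
    (hL : ∀ᵐ x ∂μ, LU (pattern x.1)) (hR : ∀ᵐ x ∂μ, RU (pattern x.1)) {s : Finset ℤ} {k : ℤ}
    (hk : k ∉ s) (w : ℤ → Bool) : (μ.map fun x => pattern x.1)
      ({z | ∀ i ∈ s, z i = w i} ∩ {z | z k = true}) ≤ (μ.map fun x => pattern x.1)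
      ({z | ∀ i ∈ s, z i = w i} ∩ {z | z k = false}) := by
  have hpm : Measurable fun y : X m => pattern y.1 :=
    measurable_pattern.comp measurable_subtype_coe
  have hR' : ∀ᵐ z ∂(μ.map fun x => pattern x.1), RU z := by
    rw [ae_map_iff hpm.aemeasurable (Measurable.setOf measurable_RU)]
    exact hR
  exact measure_coords_true_le (fun k => hμ.symm_swap_succ hL k) hR' hk w

/-- The reversal argument gives only one inequality. Applied to the mirrored measure, where the two
brackets trade roles, it gives the opposite one. -/
theorem IsInvariantProbability.map_pattern_eq [NeZero m] (hμ : IsInvariantProbability μ)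
    (h : ∀ᵐ x ∂μ, LU (pattern x.1) ∧ RU (pattern x.1)) :
    μ.map (fun x => pattern x.1) = bernoulli Bool := by
  have := hμ.isProbabilityMeasure
  have hpm : Measurable fun y : X m => pattern y.1 :=
    measurable_pattern.comp measurable_subtype_coe
  have hlaw : (μ.map rev).map (fun x => pattern x.1) =
      (μ.map fun x => pattern x.1).map mirror := by
    rw [Measure.map_map hpm rev.measurable, Measure.map_map measurable_mirror hpm]
    congr 1
    funext x
    exact pattern_rev x
  have := Measure.isProbabilityMeasure_map (μ := μ) hpm.aemeasurable
  refine eq_bernoulli_of_exchange fun s k hk w a b => ?_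
  have h1 := hμ.map_pattern_true_le (h.mono fun _ hx => hx.1) (h.mono fun _ hx => hx.2) hk w
  have hrev {p : (ℤ → Bool) → Prop} (hp : Measurable p) (hpx : ∀ᵐ x ∂μ, p (mirror (pattern x.1))) :
      ∀ᵐ x ∂μ.map rev, p (pattern x.1) := by
    have hS : MeasurableSet {x : X m | p (pattern x.1)} := hpm (Measurable.setOf hp)
    rw [ae_map_iff rev.measurable.aemeasurable hS]
    simpa only [pattern_rev] using hpx
  have h2 := hμ.map_rev.map_pattern_true_le (hrev measurable_LU (h.mono fun _ hx => LU_mirror.2 hx.2))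
    (hrev measurable_RU (h.mono fun _ hx => RU_mirror.2 hx.1)) (s := s.image fun i => -1 - i)
    (k := -1 - k) (by simpa using hk) (mirror w)
  have hmir (a : Bool) : (μ.map rev).map (fun x => pattern x.1)
      ({z | ∀ i ∈ s.image fun i => -1 - i, z i = mirror w i} ∩ {z | z (-1 - k) = !a}) =
      (μ.map fun x => pattern x.1) ({z | ∀ i ∈ s, z i = w i} ∩ {z | z k = a}) := by
    have hS := measurableSet_coords (s.image fun i => -1 - i) id (mirror w)
    rw [hlaw]
    refine (Measure.map_apply measurable_mirror (hS.inter (measurableSet_apply_eq _ _))).trans ?_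
    congr 1
    ext z
    simp [mirror]
  have h2 := ((hmir false).symm.trans_le h2).trans_eq (hmir true)
  cases a <;> cases b
  · exact le_rfl
  · exact h2
  · exact h1
  · exact le_rfl

end Dyck

namespace Dyck

variable {m : ℕ}

/-! ### The map `F` -/

theorem gam_lt_gam {z : ℤ → Bool} {k l : ℤ} (hkl : k < l) (hk : z k = true) (hl : z l = true) :
    gam z k < gam z l := by
  have hnn (s : Finset ℤ) : 0 ≤ ∑ i ∈ s, (if z i then 1 else 0 : ℤ) :=
    Finset.sum_nonneg fun i _ => by split_ifs <;> simp
  have hins (s : Finset ℤ) {j : ℤ} (hj : j ∉ s) (hz : z j = true) :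
      ∑ i ∈ insert j s, (if z i then 1 else 0 : ℤ) = 1 + ∑ i ∈ s, (if z i then 1 else 0) := by
    rw [Finset.sum_insert hj, hz]; simp
  have hmono {s t : Finset ℤ} (hst : s ⊆ t) : ∑ i ∈ s, (if z i then 1 else 0 : ℤ) ≤
      ∑ i ∈ t, (if z i then 1 else 0) :=
    Finset.sum_le_sum_of_subset_of_nonneg hst fun i _ _ => by split_ifs <;> simp
  unfold gam
  by_cases hk0 : 0 ≤ k
  · rw [if_pos hk0, if_pos (by omega)]
    have h1 := hins (Finset.Icc 0 k) (j := l) (by simp; omega) hl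
    have h2 := hmono (s := insert l (Finset.Icc 0 k)) (t := Finset.Icc 0 l) fun i hi => by
      simp only [Finset.mem_insert, Finset.mem_Icc] at hi ⊢; omega
    omega
  · rw [if_neg hk0]
    by_cases hl0 : 0 ≤ l
    · rw [if_pos hl0]
      have h1 := hins (Finset.Ico (k + 1) 0) (j := k) (by simp) hk
      have h2 := hmono (s := insert k (Finset.Ico (k + 1) 0)) (t := Finset.Ico k 0) fun i hi => by
        simp only [Finset.mem_insert, Finset.mem_Ico] at hi ⊢; omega
      have h3 := hnn (Finset.Ico (k + 1) 0)
      have h4 := hnn (Finset.Icc 0 l)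
      omega
    · rw [if_neg hl0]
      have h1 := hins (Finset.Ico l 0) (j := k) (by simp; omega) hk
      have h2 := hmono (s := insert k (Finset.Ico l 0)) (t := Finset.Ico k 0) fun i hi => by
        simp only [Finset.mem_insert, Finset.mem_Ico] at hi ⊢; omega
      omega

theorem gam_injOn (z : ℤ → Bool) : Set.InjOn (gam z) {k | z k = true} := by
  intro k hk l hl h
  rcases lt_trichotomy k l with hlt | rfl | hlt
  · exact absurd h (gam_lt_gam hlt hk hl).ne
  · rfl
  · exact absurd h (gam_lt_gam hlt hl hk).ne'

@[fun_prop]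
theorem measurable_gam (k : ℤ) : Measurable fun z => gam z k := by
  have h (i : ℤ) : Measurable fun z : ℤ → Bool => (if z i then 1 else 0 : ℤ) :=
    (Measurable.of_discrete (f := fun b : Bool => (if b then 1 else 0 : ℤ))).comp
      (measurable_pi_apply i)
  unfold gam
  split_ifs
  · exact Finset.measurable_sum _ fun i _ => h i
  · exact (Finset.measurable_sum _ fun i _ => h i).neg

/-- The position of the opening bracket to which the bracket at `n` belongs. -/
def opener (z : ℤ → Bool) (n : ℤ) : ℤ := if z n then n else eps z n

theorem measurable_opener (n : ℤ) : Measurable fun z => opener z n :=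
  Measurable.ite (measurableSet_apply_eq n true) measurable_const (measurable_eps n)

theorem measurable_gam_opener (n : ℤ) : Measurable fun z => gam z (opener z n) :=
  measurable_apply_of_countable (measurable_opener n)
    (measurable_pi_lambda _ fun k => measurable_gam k)

theorem opener_of_matched {z : ℤ → Bool} {l n : ℤ} (h : Matched z l n) :
    opener z l = l ∧ opener z n = l := by
  simp [opener, h.left, h.right, h.eps_eq]

theorem LU.opener_eq_true {z : ℤ → Bool} (hz : LU z) (n : ℤ) : z (opener z n) = true := by
  unfold opener
  split_ifs with h
  · exact h
  · exact (hz.matched (by simpa using h)).left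

theorem LU.partner_iff {z : ℤ → Bool} (hz : LU z) {n i : ℤ} :
    Partner z n i ↔ opener z i = opener z n := by
  constructor
  · rintro (rfl | h | h)
    · rfl
    · obtain ⟨h1, h2⟩ := opener_of_matched h; rw [h1, h2]
    · obtain ⟨h1, h2⟩ := opener_of_matched h; rw [h1, h2]
  · intro h
    unfold opener at h
    split_ifs at h with h1 h2 h2
    · exact .inl h
    · rw [h]; exact .inr (.inl (hz.matched (by simpa using h2)))
    · rw [← h]; exact .inr (.inr (hz.matched (by simpa using h1)))
    · have h3 := hz.matched (n := i) (by simpa using h1)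
      rw [h] at h3
      exact .inl (h3.eq_right (hz.matched (by simpa using h2)))

theorem pattern_F (q : (ℤ → Bool) × (ℤ → Fin m)) : pattern (F q) = q.1 := by
  funext i
  cases h : q.1 i <;> simp [pattern, F, h]

theorem typ_F (q : (ℤ → Bool) × (ℤ → Fin m)) (i : ℤ) :
    typ (F q i) = q.2 (gam q.1 (opener q.1 i)) := by
  cases h : q.1 i <;> simp [typ, F, h, opener]

theorem F_mem_shiftSet (q : (ℤ → Bool) × (ℤ → Fin m)) : F q ∈ shiftSet m := by
  rw [mem_shiftSet_iff]
  intro l n h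
  rw [pattern_F] at h
  obtain ⟨h1, h2⟩ := opener_of_matched h
  rw [typ_F, typ_F, h1, h2]

theorem measurable_F : Measurable (F : (ℤ → Bool) × (ℤ → Fin m) → ℤ → Letter m) := by
  refine measurable_pi_lambda _ fun n => ?_
  have h1 : Measurable fun q : (ℤ → Bool) × (ℤ → Fin m) => q.2 (gam q.1 n) :=
    measurable_apply_of_countable ((measurable_gam n).comp measurable_fst) measurable_snd
  have h2 : Measurable fun q : (ℤ → Bool) × (ℤ → Fin m) => q.2 (gam q.1 (eps q.1 n)) :=
    measurable_apply_of_countable ((measurable_apply_of_countable (measurable_eps n)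
      (measurable_pi_lambda _ fun k => measurable_gam k)).comp measurable_fst) measurable_snd
  exact Measurable.ite (measurable_fst (measurableSet_apply_eq n true))
    ((Measurable.of_discrete (f := α)).comp h1) ((Measurable.of_discrete (f := β)).comp h2)

/-- `F` as a map into `X`. -/
def FX (q : (ℤ → Bool) × (ℤ → Fin m)) : X m := ⟨F q, F_mem_shiftSet q⟩

theorem measurable_FX : Measurable (FX : (ℤ → Bool) × (ℤ → Fin m) → X m) :=
  measurable_F.subtype_mk

variable [NeZero m]

theorem muTilde_eq : muTilde m = ((bernoulli Bool).prod (bernoulli (Fin m))).map FX := by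
  have hval : MeasurableEmbedding (Subtype.val : X m → ℤ → Letter m) :=
    .subtype_coe measurableSet_shiftSet
  have h : ((bernoulli Bool).prod (bernoulli (Fin m))).map F =
      (((bernoulli Bool).prod (bernoulli (Fin m))).map FX).map Subtype.val := by
    rw [Measure.map_map hval.measurable measurable_FX]; rfl
  rw [muTilde, h, hval.comap_map]

instance : IsProbabilityMeasure (muTilde m) := by
  rw [muTilde_eq]
  exact Measure.isProbabilityMeasure_map measurable_FX.aemeasurable

theorem muTilde_map_pattern : (muTilde m).map (fun x => pattern x.1) = bernoulli Bool := by
  have hpm : Measurable fun y : X m => pattern y.1 :=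
    measurable_pattern.comp measurable_subtype_coe
  rw [muTilde_eq, Measure.map_map hpm measurable_FX]
  have h : (fun x : X m => pattern x.1) ∘ FX = Prod.fst := funext fun q => pattern_F q
  rw [h]
  exact Measure.map_fst_prod.trans (by simp)

theorem ae_LU_RU_muTilde : ∀ᵐ x ∂muTilde m, LU (pattern x.1) ∧ RU (pattern x.1) := by
  have h := ae_LU_RU_bernoulli
  rw [← muTilde_map_pattern (m := m)] at h
  exact ae_of_ae_map (measurable_pattern.comp measurable_subtype_coe).aemeasurable h

/-- Apply a permutation of the symbols at the position `t`. -/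
def permuteAt {S : Type*} (t : ℤ) (π : Equiv.Perm S) (a : ℤ → S) : ℤ → S :=
  fun i => if i = t then π (a i) else a i

theorem measurable_permuteAt {S Ω : Type*} [MeasurableSpace S] [DiscreteMeasurableSpace S]
    [MeasurableSpace Ω] (π : Equiv.Perm S) {t : Ω → ℤ} (ht : Measurable t) {a : Ω → ℤ → S}
    (ha : Measurable a) : Measurable fun ω => permuteAt (t ω) π (a ω) := by
  refine measurable_pi_lambda _ fun i => ?_
  have h : MeasurableSet {ω | i = t ω} := measurableSet_eq_fun measurable_const ht
  exact Measurable.ite h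
    ((Measurable.of_discrete (f := π)).comp ((measurable_pi_apply i).comp ha))
    ((measurable_pi_apply i).comp ha)

theorem bernoulli_map_permuteAt {S : Type} [Finite S] [Nonempty S] [MeasurableSpace S]
    [DiscreteMeasurableSpace S] (t : ℤ) (π : Equiv.Perm S) :
    (bernoulli S).map (permuteAt t π) = bernoulli S := by
  have hm : Measurable (permuteAt t π) := measurable_permuteAt π measurable_const measurable_id
  have := Measure.isProbabilityMeasure_map (μ := bernoulli S) hm.aemeasurable
  refine eq_bernoulli fun s w => ?_
  refine (Measure.map_apply hm (measurableSet_coords s id w)).trans ?_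
  rw [← bernoulli_coords s (e := id) Function.injective_id.injOn
    (fun i => if i = t then π.symm (w i) else w i)]
  congr 1
  ext a
  refine forall₂_congr fun i _ => ?_
  simp only [permuteAt, id]
  split_ifs
  · exact π.eq_symm_apply.symm
  · rfl

/-- Retyping at n amounts to permuting the single symbol of a that belongs to the opener of n. For a
fixed pattern this preserves the product measure, so the skew product preserves the joint law;
injectivity of γ on opening positions ensures that no other pair is affected. -/
theorem muTilde_typeSymmetric : TypeSymmetric (muTilde m) := by
  intro n π
  refine ⟨measurable_retypeX n π, ?_⟩
  obtain ⟨Θ, hΘ⟩ : ∃ Θ : (ℤ → Bool) × (ℤ → Fin m) → (ℤ → Bool) × (ℤ → Fin m),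
      Θ = fun q => (id q.1, permuteAt (gam q.1 (opener q.1 n)) π q.2) := ⟨_, rfl⟩
  have hpres : MeasurePreserving Θ ((bernoulli Bool).prod (bernoulli (Fin m)))
      ((bernoulli Bool).prod (bernoulli (Fin m))) := by
    rw [hΘ]
    refine (MeasurePreserving.id _).skew_product
      (g := fun z a => permuteAt (gam z (opener z n)) π a) ?_
      (ae_of_all _ fun z => bernoulli_map_permuteAt _ π)
    exact measurable_permuteAt π ((measurable_gam_opener n).comp measurable_fst) measurable_snd
  rw [muTilde_eq, Measure.map_map (measurable_retypeX n π) measurable_FX]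
  conv_rhs => rw [← hpres.map_eq, Measure.map_map measurable_FX hpres.measurable]
  refine Measure.map_congr ?_
  have hLU : ∀ᵐ q ∂(bernoulli Bool).prod (bernoulli (Fin m)), LU q.1 :=
    Measure.quasiMeasurePreserving_fst.ae (ae_LU_RU_bernoulli.mono fun _ h => h.1)
  filter_upwards [hLU] with q hq
  refine Subtype.ext (funext fun i => letter_ext ?_ ?_)
  · have h1 : pattern (retype n π (F q)) = pattern (F (Θ q)) := by
      rw [pattern_retype, pattern_F, pattern_F, hΘ]; rfl
    exact congrFun h1 i
  · show typ (retype n π (F q) i) = typ (F (Θ q) i)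
    have h2 : typ (F (Θ q) i) =
        permuteAt (gam q.1 (opener q.1 n)) π q.2 (gam q.1 (opener q.1 i)) := by
      rw [typ_F, hΘ]; rfl
    rw [h2]
    by_cases hp : Partner q.1 n i
    · rw [retype_of_partner _ (by rwa [pattern_F]), typ_mapTyp, typ_F, permuteAt,
        if_pos (by rw [hq.partner_iff.1 hp])]
    · rw [retype_of_not_partner _ (by rwa [pattern_F]), typ_F, permuteAt, if_neg fun h => hp ?_]
      exact hq.partner_iff.2 (gam_injOn q.1 (hq.opener_eq_true i) (hq.opener_eq_true n) h)

end Dyck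

namespace Dyck

variable {m : ℕ}

/-! ### Invariance of `μ̃` -/

/-- A permutation without fixed points, applied at u_j, spoils exactly the j-th equation. The events
that only the j-th equation fails are disjoint and each at least as likely as the event that all
hold, so the latter is null. -/
theorem bernoulli_forall_eq_null (hm : 2 ≤ m) [NeZero m] {u v : ℕ → ℤ}
    (hu : Function.Injective u) (huv : ∀ i j, u i ≠ v j) :
    bernoulli (Fin m) {a | ∀ j, a (u j) = a (v j)} = 0 := by
  obtain ⟨π, hπ⟩ : ∃ π : Equiv.Perm (Fin m), ∀ i, π i ≠ i := by
    -- Adding 1 cyclically has no fixed point because m ≥ 2.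
    refine ⟨Equiv.addRight 1, fun i h => ?_⟩
    have h : i + 1 = i := h
    rw [add_eq_left] at h
    have h := congrArg Fin.val h
    rw [Fin.val_one', Nat.mod_eq_of_lt (by omega), Fin.val_zero] at h
    omega
  have hmeas (j : ℕ) : MeasurableSet {a : ℤ → Fin m | a (u j) = a (v j)} :=
    measurableSet_eq_fun (measurable_pi_apply _) (measurable_pi_apply _)
  let D (j : ℕ) : Set (ℤ → Fin m) :=
    {a | a (u j) = a (v j)}ᶜ ∩ ⋂ i ∈ {i | i ≠ j}, {a | a (u i) = a (v i)}
  have hD (j : ℕ) : MeasurableSet (D j) :=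
    (hmeas j).compl.inter (MeasurableSet.biInter (Set.to_countable _) fun i _ => hmeas i)
  have hle (j : ℕ) : bernoulli (Fin m) {a | ∀ j, a (u j) = a (v j)} ≤ bernoulli (Fin m) (D j) := by
    have hp : Measurable (permuteAt (u j) π) :=
      measurable_permuteAt π measurable_const measurable_id
    conv_rhs => rw [← bernoulli_map_permuteAt (u j) π]
    rw [Measure.map_apply hp (hD j)]
    refine measure_mono fun a ha => ?_
    have hv (i : ℕ) : permuteAt (u j) π a (v i) = a (v i) := if_neg (huv j i).symm
    refine ⟨fun h => ?_, Set.mem_iInter₂.2 fun i hi => ?_⟩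
    · have h : permuteAt (u j) π a (u j) = permuteAt (u j) π a (v j) := h
      rw [hv, permuteAt, if_pos rfl, ← ha j] at h
      exact hπ _ h
    · show permuteAt (u j) π a (u i) = permuteAt (u j) π a (v i)
      rw [hv, permuteAt, if_neg (hu.ne hi), ha i]
  by_contra hne
  have h1 : ∑' j, bernoulli (Fin m) (D j) = bernoulli (Fin m) (⋃ j, D j) := by
    refine (measure_iUnion (fun i j hij => ?_) hD).symm
    exact Set.disjoint_left.2 fun a ha ha' => ha.1 (Set.mem_iInter₂.1 ha'.2 i hij)
  have h2 := ENNReal.tsum_le_tsum hle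
  rw [ENNReal.tsum_const_eq_top_of_ne_zero hne, h1] at h2
  exact measure_ne_top _ _ (top_le_iff.1 h2)

/-- The position `l ≤ n` is the last one before `n` at its height or below. -/
def Ladder (z : ℤ → Bool) (l n : ℤ) : Prop :=
  l ≤ n ∧ ∀ k, l < k → k ≤ n → zWalk z l < zWalk z k

@[fun_prop]
theorem measurable_ladder (l n : ℤ) : Measurable fun z => Ladder z l n := by
  unfold Ladder; fun_prop

theorem LU.exists_ladder {z : ℤ → Bool} (hz : LU z) {n h : ℤ} (hh : h < zWalk z n) :
    ∃ l, Ladder z l n ∧ zWalk z l = h ∧ z l = true := by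
  obtain ⟨i, hi, hi'⟩ := hz h n
  obtain ⟨l, ⟨h1, h2⟩, h3⟩ := Int.exists_greatest_of_bdd (P := fun l => l ≤ n ∧ zWalk z l ≤ h)
    ⟨n, fun l hl => hl.1⟩ ⟨i, hi.le, hi'.le⟩
  have key : ∀ k, l < k → k ≤ n → h < zWalk z k := by
    intro k hk hk'
    by_contra hcon
    have := h3 k ⟨hk', not_lt.1 hcon⟩
    omega
  have hln : l < n := by
    rcases h1.lt_or_eq with h | rfl
    · exact h
    · omega
  have h4 := key (l + 1) (by omega) (by omega)
  have heq : zWalk z l = h := by rcases zWalk_step z l with h | h <;> omega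
  refine ⟨l, ⟨h1, fun k hk hk' => heq ▸ key k hk hk'⟩, heq, ?_⟩
  by_contra hcon
  have := zWalk_succ_false (z := z) (i := l) (by simpa using hcon)
  omega

/-- The types of the ladder positions before `n` at the heights `h ≤ b` and `h - d` agree. -/
def periodicTypes (m : ℕ) (n d b : ℤ) : Set (X m) :=
  {x | ∀ h ≤ b, ∀ l l', Ladder (pattern x.1) l n → zWalk (pattern x.1) l = h →
    Ladder (pattern x.1) l' n → zWalk (pattern x.1) l' = h - d → typ (x.1 l) = typ (x.1 l')}

theorem measurableSet_periodicTypes (n d b : ℤ) : MeasurableSet (periodicTypes m n d b) := by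
  have h1 (l l' : ℤ) : Measurable fun x : X m => typ (x.1 l) = typ (x.1 l') :=
    measurableSet_setOfPred.1
      (measurableSet_eq_fun (measurable_typ_apply l) (measurable_typ_apply l'))
  have hpm : Measurable fun y : X m => pattern y.1 :=
    measurable_pattern.comp measurable_subtype_coe
  have h2 (l : ℤ) : Measurable fun x : X m => Ladder (pattern x.1) l n :=
    (measurable_ladder l n).comp hpm
  have h3 (l c : ℤ) : Measurable fun x : X m => zWalk (pattern x.1) l = c :=
    measurableSet_setOfPred.1 (measurableSet_eq_fun ((measurable_zWalk l).comp hpm) measurable_const)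
  unfold periodicTypes
  exact Measurable.setOf (by fun_prop)

/-- For a fixed pattern the types at ladder positions are independent, and the condition imposes
infinitely many equations between them. -/
theorem muTilde_periodicTypes (hm : 2 ≤ m) [NeZero m] {n d b : ℤ} (hd : 0 < d) :
    muTilde m (periodicTypes m n d b) = 0 := by
  have hS : MeasurableSet (FX ⁻¹' periodicTypes m n d b) :=
    measurable_FX (measurableSet_periodicTypes n d b)
  rw [muTilde_eq, Measure.map_apply measurable_FX (measurableSet_periodicTypes n d b),
    Measure.measure_prod_null hS]
  filter_upwards [ae_LU_RU_bernoulli] with z hz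
  -- The bound keeps all heights c − jd strictly below the height at n, so each has a ladder
  -- position.
  obtain ⟨c, hc⟩ : ∃ c, c = min b (zWalk z n - 1) := ⟨_, rfl⟩
  have hex (j : ℕ) : ∃ l, Ladder z l n ∧ zWalk z l = c - j * d ∧ z l = true :=
    hz.1.exists_ladder (by nlinarith [min_le_right b (zWalk z n - 1)])
  choose l hl hlW hlz using hex
  have hW {i j : ℕ} (h : gam z (l i) = gam z (l j)) : i = j := by
    have h1 := gam_injOn z (hlz i) (hlz j) h
    have h2 := hlW i
    rw [h1, hlW j] at h2
    have h3 : (j : ℤ) * d = i * d := by omega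
    have := mul_right_cancel₀ hd.ne' h3
    omega
  -- Comparing the heights of index 2j and 2j + 1 makes the two families of coordinates disjoint.
  have hnull := bernoulli_forall_eq_null hm (u := fun j => gam z (l (2 * j)))
    (v := fun j => gam z (l (2 * j + 1))) (fun i j h => by have := hW h; omega)
    fun i j h => by have := hW h; omega
  refine measure_mono_null ?_ hnull
  intro a ha j
  have h1 := ha (c - (2 * j : ℕ) * d) (by
      have := min_le_left b (zWalk z n - 1)
      have : 0 ≤ ((2 * j : ℕ) : ℤ) * d := by positivity
      omega) (l (2 * j)) (l (2 * j + 1))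
  have h2 : pattern (FX (z, a)).1 = z := pattern_F (z, a)
  rw [h2] at h1
  have h3 := h1 (hl _) (hlW _) (hl _) (by rw [hlW]; push_cast; ring)
  have h4 (i : ℕ) : typ ((FX (z, a)).1 (l i)) = a (gam z (l i)) := by
    show typ (F (z, a) (l i)) = _
    rw [typ_F]
    simp [opener, hlz]
  rwa [h4, h4] at h3

/-- A common closing bracket far to the right is matched, in x and in y, with ladder positions of
the common left tail. Because the height offset changes from C to C + d, those two positions differ
in height by d. Their types agree, being the type of the same letter. -/
theorem mem_periodicTypes_of_tail {x y : X m} {n : ℕ}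
    (hxy : ∀ k : ℤ, (n : ℤ) < |k| → x.1 k = y.1 k) (hRU : RU (pattern x.1)) {C d : ℤ}
    (hC : ∀ i ≤ -(n : ℤ), zWalk (pattern x.1) i = zWalk (pattern y.1) i + C)
    (hCd : ∀ i ≥ (n : ℤ) + 1, zWalk (pattern x.1) i = zWalk (pattern y.1) i + C + d) :
    ∃ b₀, ∀ b ≤ b₀, x ∈ periodicTypes m (-n - 1) d b ∧ y ∈ periodicTypes m (-n - 1) d (b - C) := by
  obtain ⟨c, hc⟩ := exists_bound_Icc (zWalk (pattern x.1)) (-n - 1) (n + 1)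
  obtain ⟨c', hc'⟩ := exists_bound_Icc (zWalk (pattern y.1)) (-n - 1) (n + 1)
  have main : ∀ h < min c (c' + C + d), ∀ l l', Ladder (pattern x.1) l (-n - 1) →
      zWalk (pattern x.1) l = h → Ladder (pattern y.1) l' (-n - 1) →
      zWalk (pattern y.1) l' = h - d - C → typ (x.1 l) = typ (y.1 l') := by
    intro h hh l l' hl hlh hl' hlh'
    have hh1 := min_le_left c (c' + C + d)
    have hh2 := min_le_right c (c' + C + d)
    obtain ⟨i, hi, hi'⟩ := hRU h (n + 1)
    -- Beyond the window, k is the first time at which the walk of x comes down to h, so k − 1 is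
    -- the common closing bracket.
    obtain ⟨k, ⟨hk, hk'⟩, hmin⟩ := Int.exists_least_of_bdd
      (P := fun k => (n : ℤ) + 1 ≤ k ∧ zWalk (pattern x.1) k ≤ h) ⟨n + 1, fun k hk => hk.1⟩
      ⟨i, hi.le, hi'.le⟩
    have hnk : (n : ℤ) + 1 < k := by
      rcases hk.lt_or_eq with h | h
      · exact h
      · have := hc k (by omega) (by omega); omega
    have key : ∀ j, (n : ℤ) + 1 ≤ j → j ≤ k - 1 → h < zWalk (pattern x.1) j := by
      intro j hj hj'
      by_contra hcon
      have := hmin j ⟨hj, not_lt.1 hcon⟩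
      omega
    have hkW : zWalk (pattern x.1) k = h := by
      have h1 := key (k - 1) (by omega) le_rfl
      have h2 := zWalk_step (pattern x.1) (k - 1)
      rw [sub_add_cancel] at h2
      omega
    have hlt := hl.1
    have hlt' := hl'.1
    have hM : Matched (pattern x.1) l (k - 1) := by
      refine ⟨by omega, by rw [sub_add_cancel]; omega, fun j hj hj' => ?_⟩
      rcases le_or_gt j (-n - 1) with h1 | h1
      · exact hl.2 j hj h1
      rcases le_or_gt ((n : ℤ) + 1) j with h2 | h2
      · have := key j h2 hj'; omega
      · have := hc j (by omega) (by omega); omega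
    have hM' : Matched (pattern y.1) l' (k - 1) := by
      refine ⟨by omega, ?_, fun j hj hj' => ?_⟩
      · rw [sub_add_cancel]
        have := hCd k (by omega); omega
      rcases le_or_gt j (-n - 1) with h1 | h1
      · exact hl'.2 j hj h1
      rcases le_or_gt ((n : ℤ) + 1) j with h2 | h2
      · have := key j h2 hj'; have := hCd j h2; omega
      · have := hc' j (by omega) (by omega); omega
    rw [typ_eq_of_matched x.2 hM, typ_eq_of_matched y.2 hM', hxy]
    rw [abs_of_pos (by omega)]; omega
  have hlad : ∀ l, Ladder (pattern x.1) l (-n - 1) ↔ Ladder (pattern y.1) l (-n - 1) := by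
    intro l
    refine and_congr_right fun hl => forall₃_congr fun k hk hk' => ?_
    have := hC l (by omega)
    have := hC k (by omega)
    constructor <;> intro h <;> omega
  have hleft {l : ℤ} (hl : l ≤ -n - 1) : x.1 l = y.1 l :=
    hxy l (by rw [abs_of_neg (by omega)]; omega)
  refine ⟨min c (c' + C + d) - 1, fun b hb => ⟨fun h hh l l' hl hlh hl' hlh' => ?_,
    fun h hh l l' hl hlh hl' hlh' => ?_⟩⟩
  · rw [main h (by omega) l l' hl hlh ((hlad l').1 hl')
      (by have := hC l' (by have := hl'.1; omega); omega), hleft hl'.1]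
  · rw [← hleft hl.1]
    exact main (h + C) (by omega) l l' ((hlad l).2 hl)
      (by have := hC l (by have := hl.1; omega); omega) hl' (by omega)

/-- In a large window the minimum is attained where the patterns agree, so both ends and the minimum
are shifted by the same C. In `two_mul_freeTypes` the shift cancels. -/
theorem freeTypes_eq_of_tail {z z' : ℤ → Bool} (hLU : LU z) {n : ℕ} {C : ℤ}
    (hC : ∀ i ≤ -(n : ℤ), zWalk z i = zWalk z' i + C)
    (hC' : ∀ i ≥ (n : ℤ) + 1, zWalk z i = zWalk z' i + C) :
    ∃ n₀ : ℕ, ∀ N ≥ n₀,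
      freeTypes z (-(N : ℕ)) (2 * N + 1) = freeTypes z' (-(N : ℕ)) (2 * N + 1) := by
  obtain ⟨c, hc⟩ := exists_bound_Icc (zWalk z) (-n) (n + 1)
  obtain ⟨c', hc'⟩ := exists_bound_Icc (zWalk z') (-n) (n + 1)
  -- A position on the left that is lower than both central pieces, brought to the height scale of
  -- z.
  obtain ⟨i, hi, hi'⟩ := hLU (min c (c' + C)) (-n)
  have hi1 := min_le_left c (c' + C)
  have hi2 := min_le_right c (c' + C)
  refine ⟨(-i).toNat, fun N hN => ?_⟩
  obtain ⟨v, hvI, hv⟩ := Finset.exists_min_image (Finset.Icc (-(N : ℤ)) (N + 1)) (zWalk z)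
    ⟨0, by simp; omega⟩
  simp only [Finset.mem_Icc] at hvI hv
  have hvi := hv i (by omega)
  have hout : v < -n ∨ (n : ℤ) + 1 < v := by
    by_contra hcon
    have := hc v (by omega) (by omega)
    omega
  have hv' : zWalk z v = zWalk z' v + C := by
    rcases hout with h | h
    · exact hC v h.le
    · exact hC' v h.le
  have h1 := two_mul_freeTypes (z := z) (r := -(N : ℤ)) (N := 2 * N + 1) (v := zWalk z v)
    (fun k hk hk' => hv k ⟨hk, by push_cast at hk'; omega⟩)
    ⟨v, hvI.1, by push_cast; omega, rfl⟩
  have h2 := two_mul_freeTypes (z := z') (r := -(N : ℤ)) (N := 2 * N + 1) (v := zWalk z' v)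
    (fun k hk hk' => by
      have h3 := hv k ⟨hk, by push_cast at hk'; omega⟩
      rcases le_or_gt k (-n) with h | h
      · have := hC k h; omega
      rcases le_or_gt ((n : ℤ) + 1) k with h' | h'
      · have := hC' k h'; omega
      · have := hc' k h.le h'.le; omega)
    ⟨v, hvI.1, by push_cast; omega, rfl⟩
  rw [show -(N : ℤ) + ((2 * N + 1 : ℕ) : ℤ) = N + 1 by push_cast; ring] at h1 h2
  have h3 := hC (-N) (by omega)
  have h4 := hC' (N + 1) (by omega)
  omega

variable [NeZero m]

/-- A fair coin for each bracket and a uniform choice for each free type. -/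
theorem muTilde_centralCylinder (x : X m) (N : ℕ) :
    (m : ENNReal) ^ freeTypes (pattern x.1) (-(N : ℕ)) (2 * N + 1) *
      muTilde m (Subtype.val ⁻¹' centralCylinder N x.1) =
      ((Nat.card Bool : ENNReal)⁻¹) ^ (2 * N + 1) := by
  have h1 := (muTilde_typeSymmetric (m := m)).pow_mul_measure_window x (-N) (2 * N + 1)
    MeasurableSet.univ
  simp only [Set.mem_univ, and_true, Set.inter_univ] at h1
  rw [centralCylinder_eq_window]
  refine h1.trans ?_
  have h2 := bernoulli_coords (S := Bool) (Finset.Icc (-(N : ℤ)) N) (e := id)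
    Function.injective_id.injOn (pattern x.1)
  rw [← muTilde_map_pattern (m := m), Int.card_Icc] at h2
  rw [show ((N : ℤ) + 1 - -N).toNat = 2 * N + 1 by omega] at h2
  have hpm : Measurable fun y : X m => pattern y.1 :=
    measurable_pattern.comp measurable_subtype_coe
  rw [← h2, Measure.map_apply hpm (measurableSet_coords _ id _)]
  congr 1
  ext y
  simp only [window, Set.mem_ofPred_eq, Set.mem_preimage, Finset.mem_Icc, id]
  refine forall_congr' fun i => ⟨fun h hi => h hi.1 (by push_cast; omega), fun h hi hi' =>
    h ⟨hi, by push_cast at hi'; omega⟩⟩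

/-- Almost surely a modification leaves the height difference of the two tails unchanged; then the
cylinder weights of x and g x eventually coincide. -/
theorem muTilde_invariant (hm : 2 ≤ m) : IsInvariantProbability (muTilde m) := by
  refine ⟨inferInstance, fun A g hg => ?_⟩
  let Z : Set (X m) := {x | ¬ (LU (pattern x.1) ∧ RU (pattern x.1))} ∪
    ⋃ p : ℤ × {d : ℤ // 0 < d} × ℤ, periodicTypes m p.1 p.2.1 p.2.2
  have hZ : muTilde m Z = 0 := measure_union_null ae_LU_RU_muTilde
    (measure_iUnion_null fun p => muTilde_periodicTypes hm p.2.1.2)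
  refine measure_range_eq_of_centralCylinder (.subtype_coe measurableSet_shiftSet)
    hg.measurableSet hg.measurable hg.injective hZ (fun x => ?_) fun x => ?_
  · obtain ⟨n, hn⟩ := hg.doubleTail x
    exact ⟨n, fun k hk => (hn k hk).symm⟩
  · have ht := hg.doubleTail x
    generalize g x = y at ht
    generalize (x : X m) = x at ht
    by_cases hx : LU (pattern x.1) ∧ RU (pattern x.1)
    · obtain ⟨n, hn⟩ := id ht
      have hp : ∀ k : ℤ, (n : ℤ) < |k| → pattern x.1 k = pattern y.1 k := fun k hk =>
        congrArg Sum.isLeft (hn k hk)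
      obtain ⟨C, hCdef⟩ : ∃ C, C = zWalk (pattern x.1) (-n) - zWalk (pattern y.1) (-n) := ⟨_, rfl⟩
      obtain ⟨d, hd⟩ : ∃ d, d = zWalk (pattern x.1) (n + 1) - zWalk (pattern y.1) (n + 1) - C :=
        ⟨_, rfl⟩
      have hC : ∀ i ≤ -(n : ℤ), zWalk (pattern x.1) i = zWalk (pattern y.1) i + C := by
        intro i hi
        have := zWalk_sub_congr hi fun j hj hj' => hp j (by rw [abs_of_neg (by omega)]; omega)
        omega
      have hCd : ∀ i ≥ (n : ℤ) + 1, zWalk (pattern x.1) i = zWalk (pattern y.1) i + C + d := by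
        intro i hi
        have := zWalk_sub_congr hi fun j hj hj' => hp j (by rw [abs_of_pos (by omega)]; omega)
        omega
      -- If d ≠ 0, both points lie in the null set of periodic types; for negative d the roles of x
      -- and y are exchanged to obtain a positive period.
      rcases lt_trichotomy d 0 with h0 | h0 | h0
      · obtain ⟨b, hb⟩ := mem_periodicTypes_of_tail (fun k hk => (hn k hk).symm) (ht.RU hx.2)
          (C := -C) (d := -d) (fun i hi => by have := hC i hi; omega)
          (fun i hi => by have := hCd i hi; omega)
        obtain ⟨h1, h2⟩ := hb b le_rfl
        exact .inl ⟨.inr (Set.mem_iUnion.2 ⟨(_, ⟨-d, by omega⟩, _), h2⟩),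
          .inr (Set.mem_iUnion.2 ⟨(_, ⟨-d, by omega⟩, _), h1⟩)⟩
      · right
        obtain ⟨n₀, hn₀⟩ := freeTypes_eq_of_tail hx.1 hC
          (fun i hi => by have := hCd i hi; omega)
        refine ⟨n₀, fun N hN => ?_⟩
        have h1 := muTilde_centralCylinder x N
        rw [← muTilde_centralCylinder y N, hn₀ N hN] at h1
        refine ((ENNReal.mul_right_inj ?_ ?_).1 h1).symm
        · exact pow_ne_zero _ (by exact_mod_cast NeZero.ne m)
        · exact ENNReal.pow_ne_top (ENNReal.natCast_ne_top m)
      · obtain ⟨b, hb⟩ := mem_periodicTypes_of_tail hn hx.2 hC hCd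
        obtain ⟨h1, h2⟩ := hb b le_rfl
        exact .inl ⟨.inr (Set.mem_iUnion.2 ⟨(_, ⟨d, h0⟩, _), h1⟩),
          .inr (Set.mem_iUnion.2 ⟨(_, ⟨d, h0⟩, _), h2⟩)⟩
    · exact .inl ⟨.inl hx, .inl fun h => hx ⟨ht.symm.LU h.1, ht.symm.RU h.2⟩⟩

/-- Both measures are blind to types and have a fair coin as the law of their patterns. -/
theorem eq_muTilde {μ : Measure (X m)} (hμ : IsInvariantProbability μ)
    (h : ∀ᵐ x ∂μ, LU (pattern x.1) ∧ RU (pattern x.1)) : μ = muTilde m := by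
  have := hμ.isProbabilityMeasure
  exact hμ.typeSymmetric.ext muTilde_typeSymmetric
    ((hμ.map_pattern_eq h).trans muTilde_map_pattern.symm)

end Dyck

namespace Dyck

variable {m : ℕ} {μ : Measure (X m)}

/-! ### The ergodic invariant probabilities -/

theorem measurable_pattern_val : Measurable fun x : X m => pattern x.1 :=
  measurable_pattern.comp measurable_subtype_coe

theorem IsInvariantProbability.ergodic_of_ae_unique (hμ : IsInvariantProbability μ)
    {p : (ℤ → Bool) → Prop} (hp : Measurable p) (h : ∀ᵐ x ∂μ, p (pattern x.1))
    (huniq : ∀ ν : Measure (X m), IsInvariantProbability ν → (∀ᵐ x ∂ν, p (pattern x.1)) → ν = μ) :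
    IsErgodicInvariantProbability μ := by
  have hY : MeasurableSet {x : X m | p (pattern x.1)} :=
    measurable_pattern_val (Measurable.setOf hp)
  have := hμ.isProbabilityMeasure
  refine hμ.ergodic_of_unique hY ((mem_ae_iff_prob_eq_one hY).1 h) fun ν hν hνY => huniq ν hν ?_
  have := hν.isProbabilityMeasure
  exact (mem_ae_iff_prob_eq_one hY).2 hνY

theorem ae_map_rev {p : (ℤ → Bool) → Prop} (hp : Measurable p) :
    (∀ᵐ x ∂μ.map rev, p (pattern x.1)) ↔ ∀ᵐ x ∂μ, p (mirror (pattern x.1)) := by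
  have hY : MeasurableSet {x : X m | p (pattern x.1)} :=
    measurable_pattern_val (Measurable.setOf hp)
  rw [ae_map_iff rev.measurable.aemeasurable hY]
  simp only [pattern_rev]

theorem ae_map_T {p : (ℤ → Bool) → Prop} (hp : Measurable p) :
    (∀ᵐ x ∂μ.map T, p (pattern x.1)) ↔ ∀ᵐ x ∂μ, p fun i => pattern x.1 (i + 1) := by
  have hY : MeasurableSet {x : X m | p (pattern x.1)} :=
    measurable_pattern_val (Measurable.setOf hp)
  rw [← coe_shiftEquiv, ae_map_iff shiftEquiv.measurable.aemeasurable hY]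
  rfl

theorem measurable_LU_not_RU : Measurable fun z => LU z ∧ ¬ RU z := by fun_prop

theorem measurable_not_LU_RU : Measurable fun z => ¬ LU z ∧ RU z := by fun_prop

theorem not_LU_RU_of_mem_B {s t : Set EReal} (hs : ⊥ ∉ s) (ht : ⊥ ∉ t) {x : X m}
    (hx : x ∈ B m s t) : ¬ LU (pattern x.1) ∧ ¬ RU (pattern x.1) := by
  have hx1 := hx.1
  have hx2 := hx.2
  rw [H_eq] at hx1 hx2
  exact ⟨liminf_atBot_ne_bot_iff.1 fun h => ht (h ▸ hx2),
    liminf_atTop_ne_bot_iff.1 fun h => hs (h ▸ hx1)⟩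

variable [NeZero m]

theorem ae_krieger (hm : 2 ≤ m) : ∀ᵐ x ∂krieger m, LU (pattern x.1) ∧ ¬ RU (pattern x.1) := by
  have hY : MeasurableSet {x : X m | LU (pattern x.1) ∧ ¬ RU (pattern x.1)} :=
    measurable_pattern_val (Measurable.setOf measurable_LU_not_RU)
  rw [krieger, ae_map_iff measurable_liftX.aemeasurable hY]
  filter_upwards [ae_mem_B hm] with y hy
  obtain ⟨h1, h2⟩ := mem_B_top_bot.1 hy
  exact ⟨h2, liminf_atTop_ne_bot_iff.1 (by rw [h1]; exact bot_ne_top.symm)⟩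

theorem isInvariantProbability_krieger (hm : 2 ≤ m) : IsInvariantProbability (krieger m) :=
  krieger_invariant ((ae_drift hm).mono fun _ h => LU_of_tendsto h.2)

theorem eq_krieger_rev {ν : Measure (X m)} (hν : IsInvariantProbability ν)
    (h : ∀ᵐ x ∂ν, ¬ LU (pattern x.1) ∧ RU (pattern x.1)) : ν = (krieger m).map rev := by
  rw [← eq_krieger hν.map_rev, map_rev_rev]
  rw [ae_map_rev (p := fun z => LU z ∧ ¬ RU z) measurable_LU_not_RU]
  exact h.mono fun x hx => ⟨LU_mirror.2 hx.2, fun h => hx.1 (RU_mirror.1 h)⟩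

theorem ae_muPlus (hm : 2 ≤ m) : ∀ᵐ x ∂muPlus m, LU (pattern x.1) ∧ ¬ RU (pattern x.1) := by
  rw [muPlus_eq hm]; exact ae_krieger hm

theorem ae_muMinus (hm : 2 ≤ m) : ∀ᵐ x ∂muMinus m, ¬ LU (pattern x.1) ∧ RU (pattern x.1) := by
  rw [muMinus_eq hm, ae_map_rev (p := fun z => ¬ LU z ∧ RU z) measurable_not_LU_RU]
  exact (ae_krieger hm).mono fun x hx => ⟨fun h => hx.2 (LU_mirror.1 h), RU_mirror.2 hx.1⟩

theorem muPlus_invariant (hm : 2 ≤ m) : IsInvariantProbability (muPlus m) := by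
  rw [muPlus_eq hm]; exact isInvariantProbability_krieger hm

theorem muMinus_invariant (hm : 2 ≤ m) : IsInvariantProbability (muMinus m) := by
  rw [muMinus_eq hm]; exact (isInvariantProbability_krieger hm).map_rev

theorem muPlus_ergodic (hm : 2 ≤ m) : IsErgodicInvariantProbability (muPlus m) :=
  (muPlus_invariant hm).ergodic_of_ae_unique measurable_LU_not_RU (ae_muPlus hm)
    fun _ hν h => (eq_krieger hν h).trans (muPlus_eq hm).symm

theorem muMinus_ergodic (hm : 2 ≤ m) : IsErgodicInvariantProbability (muMinus m) :=
  (muMinus_invariant hm).ergodic_of_ae_unique measurable_not_LU_RU (ae_muMinus hm)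
    fun _ hν h => (eq_krieger_rev hν h).trans (muMinus_eq hm).symm

theorem muTilde_ergodic (hm : 2 ≤ m) : IsErgodicInvariantProbability (muTilde m) :=
  (muTilde_invariant hm).ergodic_of_ae_unique (p := fun z => LU z ∧ RU z) (by fun_prop)
    ae_LU_RU_muTilde fun _ hν h => eq_muTilde hν h

/-- The shifted measure is again invariant with `LU` and not `RU`, so uniqueness gives shift
invariance; the cylinder bound gives the entropy. -/
theorem muPlus_maximalEntropy (hm : 2 ≤ m) : IsMaximalEntropy (muPlus m) := by
  have := (muPlus_invariant hm).isProbabilityMeasure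
  refine isMaximalEntropy_of_cylinder_le ?_ fun n w => ?_
  · refine (eq_krieger (muPlus_invariant hm).map_shift ?_).trans (muPlus_eq hm).symm
    rw [ae_map_T (p := fun z => LU z ∧ ¬ RU z) measurable_LU_not_RU]
    simpa only [LU_shift, RU_shift] using ae_muPlus hm
  · rw [muPlus_eq hm]
    exact krieger_cylinder_le (e := fun k : Fin n => ((k : ℕ) : ℤ))
      (fun a b h => Fin.ext (Int.natCast_inj.1 h)) w

theorem muMinus_maximalEntropy (hm : 2 ≤ m) : IsMaximalEntropy (muMinus m) := by
  have := (muMinus_invariant hm).isProbabilityMeasure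
  refine isMaximalEntropy_of_cylinder_le ?_ fun n w => ?_
  · refine (eq_krieger_rev (muMinus_invariant hm).map_shift ?_).trans (muMinus_eq hm).symm
    rw [ae_map_T (p := fun z => ¬ LU z ∧ RU z) measurable_not_LU_RU]
    simpa only [LU_shift, RU_shift] using ae_muMinus hm
  · rw [muMinus_eq hm, rev.map_apply]
    -- Under `rev`, coordinates 0, …, n − 1 become −1, …, −n with brackets exchanged.
    convert krieger_cylinder_le (m := m) (e := fun k : Fin n => -1 - ((k : ℕ) : ℤ))
      (fun a b h => Fin.ext (by simpa using h)) (fun k => (w k).swap) using 2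
    ext x
    simp only [Set.mem_preimage, Set.mem_ofPred_eq, rev_apply]
    exact forall_congr' fun k => ⟨fun h => by rw [← h, Sum.swap_swap], fun h => by rw [h, Sum.swap_swap]⟩

/-- Each of `LU` and `RU` holds almost surely or fails almost surely; three of the four combinations
have a unique invariant probability and the fourth has none. -/
theorem IsErgodicInvariantProbability.eq_of_ergodic (hm : 2 ≤ m)
    (hμ : IsErgodicInvariantProbability μ) : μ = muPlus m ∨ μ = muMinus m ∨ μ = muTilde m := by
  have := hμ.isProbabilityMeasure
  have hdich {p : (ℤ → Bool) → Prop} (hp : Measurable p)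
      (hs : ∀ x y : X m, DoubleTail x y → p (pattern x.1) → p (pattern y.1)) :
      (∀ᵐ x ∂μ, p (pattern x.1)) ∨ ∀ᵐ x ∂μ, ¬ p (pattern x.1) := by
    have hY : MeasurableSet {x : X m | p (pattern x.1)} :=
      measurable_pattern_val (Measurable.setOf hp)
    rcases hμ.ergodic _ hY hs with h | h
    · exact .inr (measure_eq_zero_iff_ae_notMem.1 h)
    · exact .inl ((mem_ae_iff_prob_eq_one hY).2 h)
  have hi := hμ.toIsInvariantProbability
  rcases hdich measurable_LU fun _ _ h => h.LU with h | h <;>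
    rcases hdich measurable_RU fun _ _ h => h.RU with h' | h'
  · exact .inr (.inr (eq_muTilde hi (h.and h')))
  · exact .inl ((eq_krieger hi (h.and h')).trans (muPlus_eq hm).symm)
  · exact .inr (.inl ((eq_krieger_rev hi (h.and h')).trans (muMinus_eq hm).symm))
  · exact (not_invariant_of_bounded_below hi (h.and h')).elim

end Dyck

end

/-! ### The main theorem -/

theorem mainTheorem2 (m : ℕ) [NeZero m] (hm : 2 ≤ m) :
    (∀ s ∈ ({{⊤}, Dyck.reals} : Set (Set EReal)), ∀ t ∈ ({{⊤}, Dyck.reals} : Set (Set EReal)),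
      ¬ ∃ μ : Measure (Dyck.X m), Dyck.IsInvariantProbability μ ∧ μ (Dyck.B m s t) = 1) ∧
    Dyck.IsMaximalEntropy (Dyck.muPlus m) ∧ Dyck.IsMaximalEntropy (Dyck.muMinus m) ∧
    Dyck.muPlus m ≠ Dyck.muMinus m ∧ Dyck.muPlus m ≠ Dyck.muTilde m ∧
    Dyck.muMinus m ≠ Dyck.muTilde m ∧
    {μ : Measure (Dyck.X m) | Dyck.IsErgodicInvariantProbability μ} =
      {Dyck.muPlus m, Dyck.muMinus m, Dyck.muTilde m} := by
  have hplus := (Dyck.muPlus_invariant hm).isProbabilityMeasure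
  have hminus := (Dyck.muMinus_invariant hm).isProbabilityMeasure
  have hbot : ∀ s ∈ ({{⊤}, Dyck.reals} : Set (Set EReal)), ⊥ ∉ s := by
    rintro s (rfl | rfl) h
    · exact bot_ne_top h
    · obtain ⟨r, hr⟩ := h
      exact EReal.coe_ne_bot r hr
  refine ⟨fun s hs t ht => ?_, Dyck.muPlus_maximalEntropy hm, Dyck.muMinus_maximalEntropy hm,
    fun h => ?_, fun h => ?_, fun h => ?_, ?_⟩
  · rintro ⟨μ, hμ, hB⟩
    have := hμ.isProbabilityMeasure
    refine Dyck.not_invariant_of_bounded_below hμ ?_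
    have hY : MeasurableSet
        {x : Dyck.X m | ¬ Dyck.LU (Dyck.pattern x.1) ∧ ¬ Dyck.RU (Dyck.pattern x.1)} :=
      Dyck.measurable_pattern_val (Measurable.setOf (p := fun z => ¬ Dyck.LU z ∧ ¬ Dyck.RU z)
        (by fun_prop))
    refine (mem_ae_iff_prob_eq_one hY).2 (le_antisymm prob_le_one (hB.symm.trans_le ?_))
    exact measure_mono fun x hx => Dyck.not_LU_RU_of_mem_B (hbot s hs) (hbot t ht) hx
  -- The three measures live on disjoint sets, told apart by `LU` and `RU`.
  · have h1 := Dyck.ae_muPlus hm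
    rw [h] at h1
    obtain ⟨x, hx, hx'⟩ := (h1.and (Dyck.ae_muMinus hm)).exists
    exact hx.2 hx'.2
  · have h1 := Dyck.ae_muPlus hm
    rw [h] at h1
    obtain ⟨x, hx, hx'⟩ := (h1.and (Dyck.ae_LU_RU_muTilde (m := m))).exists
    exact hx.2 hx'.2
  · have h1 := Dyck.ae_muMinus hm
    rw [h] at h1
    obtain ⟨x, hx, hx'⟩ := (h1.and (Dyck.ae_LU_RU_muTilde (m := m))).exists
    exact hx.1 hx'.1
  · ext μ
    constructor
    · intro h
      exact Dyck.IsErgodicInvariantProbability.eq_of_ergodic hm h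
    · rintro (rfl | rfl | rfl)
      · exact Dyck.muPlus_ergodic hm
      · exact Dyck.muMinus_ergodic hm
      · exact Dyck.muTilde_ergodic hm
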